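/- Let $\mathbb H$ be the quaternions and $\mathbb S=\{q\in\mathbb H: q^2=-1\}$. Let $\mathsf H\neq\{0\}$ be a quaternionic right Hilbert space, with scalar product $\langle u|v\rangle$ that is right $\mathbb H$-linear in $v$ and satisfies $\langle v|u\rangle=\overline{\langle u|v\rangle}$. Let $\mathfrak B(\mathsf H)$ be the bounded right $\mathbb H$-linear operators on $\mathsf H$; $S\ge 0$ means $\langle u|Su\rangle\in[0,\infty)$ for all $u$, and $|S|$ is the positive square root of $S^*S$. Fix $\imath\in\mathbb S$, and put $\mathbb C_\imath=\{\alpha+\imath\beta:\alpha,\beta\in\mathbb R\}$, $\mathbb C_\imath^+=\{\alpha+\imath\beta:\alpha,\beta\in\mathbb R,\ \beta\ge0\}$, and $\mathbb S_q=\{\alpha+\kappa\beta:\kappa\in\mathbb S\}$ for $q=\alpha+\jmath\beta$ with $\alpha,\beta\in\mathbb R$, $\jmath\in\mathbb S$. Definitions. - A *left scalar multiplication* of $\mathsf H$ is a map $\mathcal L:\mathbb H\to\mathfrak B(\mathsf H)$, $q\mapsto L_q$, of the form $L_qu=\sum_{z\in N}zq\langle z|u\rangle$ for some Hilbert basis $N$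 of $\mathsf H$. - A *qPVM* over $\mathbb C_\imath^+$ is a map $P$ from the Borel sets of $\mathbb C^+_\imath$ to the positive operators in $\mathfrak B(\mathsf H)$ such that $P(\mathbb C_\imath^+)=\mathrm I$, $P(E)P(E')=P(E\cap E')$, and $P(\bigcup_nE_n)u=\sum_nP(E_n)u$ for all $u\in\mathsf H$ and all sequences of pairwise disjoint Borel sets $E_n$. Its support $\operatorname{supp}P$ is the complement in $\mathbb C_\imath^+$ of the union of all open $O\subset\mathbb C_\imath^+$ with $P(O)=0$; $P$ is *bounded* if $\operatorname{supp}P$ is bounded. - An *iqPVM* over $\mathbb C_\imath^+$ is a pair $\mathcal P=(P,\mathcal L)$ of a qPVM and a left scalar multiplication with $P(E)L_q=L_qP(E)$ for all Borel $E$ and all $q\in\mathbb H$; it is *bounded* if $P$ is. - For a simple function, $\int\sum_\ell S_\ell\chi_{E_\ell}\,d\mathcal P=\sum_\ell L_{S_\ell}P(E_\ell)$ (the $E_\ell$ being pairwise disjoint Borel sets and $S_\ell\in\mathbb H$). If $\psi:\mathbb C^+_\imath\to\mathbb H$ is bounded and Borel measurable on $\operatorname{supp}P$, then $\int\psi\,d\mathcal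 P$ is the operator-norm limit of the integrals of simple functions converging uniformly to $\psi\chi_{\operatorname{supp}P}$. - For $T\in\mathfrak B(\mathsf H)$ and $q\in\mathbb H$ let $\Delta_q(T)=T^2-2\operatorname{Re}(q)T+|q|^2\mathrm I$. The spherical resolvent set consists of the $q$ for which $\Delta_q(T)$ is injective with dense range and bounded inverse on that range; $\sigma_S(T)$ is its complement. Further, $\sigma_{pS}(T)$ is the set of $q$ with $\Delta_q(T)$ not injective; $\sigma_{rS}(T)$ is the set of $q$ with $\Delta_q(T)$ injective but without dense range; $\sigma_{cS}(T)$ is the set of $q$ with $\Delta_q(T)$ injective, with dense range, and with unbounded inverse. **Theorem.** Let $T\in\mathfrak B(\mathsf H)$ be normal. There is a bounded iqPVM $\mathcal P=(P,\mathcal L)$ over $\mathbb C_\imath^+$ in $\mathsf H$ with $$T=\int_{\mathbb C_\imath^+}\mathrm{id}\,d\mathcal P ,$$ where $\mathrm{id}:\mathbb C^+_\imath\hookrightarrow\mathbb H$ is the inclusion. Moreover: (a) If $\mathcal P'=(P',\mathcal L')$ is any bounded iqPVM over $\mathbb C_\imath^+$ in $\mathsf H$ with $T=\int\mathrm{id}\,d\mathcal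 P'$, then $P'=P$, and $L'_qu=L_qu$ for all $q\in\mathbb C_\imath$ and $u\in\operatorname{Ker}(T-T^*)^\perp$. Furthermore $L'_\imath T=TL'_\imath$ and $L'_\imath T^*=T^*L'_\imath$; $L'_\jmath T=T^*L'_\jmath$ for every $\jmath\in\mathbb S$ with $\imath\jmath=-\jmath\imath$; and $-L'_\imath(T-T^*)=|T-T^*|=\int2\beta\,d\mathcal P'$, where $2\beta$ denotes the function $\alpha+\imath\beta\mapsto2\beta$. (b) For a left scalar multiplication $\mathcal L'$ of $\mathsf H$, the pair $(P,\mathcal L')$ is an iqPVM with $T=\int\mathrm{id}\,d(P,\mathcal L')$ if and only if $L'_\imath T=TL'_\imath$, $L'_\jmath T=T^*L'_\jmath$ for some $\jmath\in\mathbb S$ with $\imath\jmath=-\jmath\imath$, and $-L'_\imath(T-T^*)\ge0$. (c) $\operatorname{supp}P=\sigma_S(T)\cap\mathbb C_\imath^+$. (d) $P(\mathbb R)(\mathsf H)=\operatorname{Ker}(T-T^*)$ and $P(\mathbb C_\imath^+\setminus\mathbb R)(\mathsf H)=\operatorname{Ker}(T-T^*)^\perp$. (e) For $q\in\mathbb H$: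 $q\in\sigma_{pS}(T)$ if and only if $P(\mathbb S_q\cap\mathbb C_\imath^+)\ne0$; in particular, for $q\in\mathbb C_\imath^+$, $q\in\sigma_{pS}(T)$ if and only if $P(\{q\})\neq0$. Every isolated point of $\sigma_S(T)\cap\mathbb C_\imath^+$ belongs to $\sigma_{pS}(T)$. (f) $\sigma_{rS}(T)=\emptyset$. (g) For $q\in\mathbb H$: $q\in\sigma_{cS}(T)$ if and only if $P(\mathbb S_q\cap\mathbb C_\imath^+)=0$ and $P(U)\neq0$ for every open subset $U$ of $\mathbb C_\imath^+$ containing $\mathbb S_q\cap\mathbb C_\imath^+$; in particular, for $q\in\mathbb C_\imath^+$, $q\in\sigma_{cS}(T)$ if and only if $P(\{q\})=0$ and $P(U)\ne0$ for every open neighbourhood $U$ of $q$ in $\mathbb C_\imath^+$. If $q\in\sigma_{cS}(T)$, then for every $\epsilon>0$ there is $u\in\mathsf H$ with $\|u\|=1$ and $\|Tu-uq\|<\epsilon$. -/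

import Mathlib

open scoped Quaternion
open MulOpposite Filter Topology MeasureTheory

noncomputable section

/-! ### Quaternions -/

instance : MeasurableSpace ℍ := borel ℍ

instance : BorelSpace ℍ := ⟨rfl⟩

/-- The sphere of imaginary units. -/
def imUnits : Set ℍ := {q | q * q = -1}

/-- The complex plane `ℂ_ι = {α + ι β}`. -/
def slicePlane (ι : ℍ) : Set ℍ := {q | ∃ α β : ℝ, q = (α : ℍ) + ι * (β : ℍ)}

/-- The slice half-plane `ℂ⁺_ι = {α + ι β | β ≥ 0}`; as a type it carries the topology and the
Borel σ-algebra induced from `ℍ`. -/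
def sliceHalfPlane (ι : ℍ) : Set ℍ := {q | ∃ α β : ℝ, 0 ≤ β ∧ q = (α : ℍ) + ι * (β : ℍ)}

/-- The sphere `𝕊_q = α + β 𝕊`, where `q = α + j β` with `j` an imaginary unit. -/
def qSphere (q : ℍ) : Set ℍ :=
  {x | ∃ α β : ℝ, ∃ j ∈ imUnits, ∃ κ ∈ imUnits,
    q = (α : ℍ) + j * (β : ℍ) ∧ x = (α : ℍ) + κ * (β : ℍ)}

/-! ### Quaternionic Hilbert spaces -/

/-- A Hermitian quaternionic scalar product `⟨u|v⟩` on a right `ℍ`-module, inducing the norm. The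
right multiplication `u q` is `op q • u`. Together with `CompleteSpace H` this is a quaternionic
(right) Hilbert space. -/
class QuaternionicInner (H : Type*) [NormedAddCommGroup H] [Module ℍᵐᵒᵖ H] where
  qinner : H → H → ℍ
  qinner_add_right : ∀ u v w, qinner u (v + w) = qinner u v + qinner u w
  qinner_smul_right : ∀ u v (p : ℍ), qinner u (op p • v) = qinner u v * p
  star_qinner : ∀ u v, star (qinner v u) = qinner u v
  qinner_self : ∀ u, qinner u u = ((‖u‖ ^ 2 : ℝ) : ℍ)

open QuaternionicInner

section Hilbert

variable {H : Type*} [NormedAddCommGroup H] [Module ℍᵐᵒᵖ H] [QuaternionicInner H]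

theorem norm_op_smul (p : ℍ) (u : H) : ‖op p • u‖ = ‖p‖ * ‖u‖ := by
  have h := qinner_self (op p • u)
  rw [qinner_smul_right, ← star_qinner, qinner_smul_right, star_mul, star_qinner, qinner_self,
    mul_assoc, (Quaternion.coe_commutes _ _ : _ * p = _), ← mul_assoc, Quaternion.star_mul_self,
    ← Quaternion.coe_mul, Quaternion.coe_inj, Quaternion.normSq_eq_norm_mul_self] at h
  have h2 : (‖p‖ * ‖u‖) ^ 2 = ‖op p • u‖ ^ 2 := by rw [← h]; ring
  exact ((pow_left_inj₀ (by positivity) (by positivity) two_ne_zero).1 h2).symm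

theorem qinner_add_left (u v w : H) : qinner (u + v) w = qinner u w + qinner v w := by
  rw [← star_qinner, qinner_add_right, star_add, star_qinner, star_qinner]

theorem qinner_smul_left (u v : H) (p : ℍ) : qinner (op p • u) v = star p * qinner u v := by
  rw [← star_qinner, qinner_smul_right, star_mul, star_qinner]

/-- The underlying real inner product space, used only to obtain adjoints. -/
abbrev realInnerSpace (H : Type*) [NormedAddCommGroup H] [Module ℍᵐᵒᵖ H] [QuaternionicInner H] :
    InnerProductSpace ℝ H :=
  { Module.compHom H (algebraMap ℝ ℍᵐᵒᵖ) with
    norm_smul_le := fun r u => by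
      have := norm_op_smul (r : ℍ) u
      rw [Quaternion.norm_coe] at this
      exact this.le
    inner := fun u v => (qinner u v).re
    norm_sq_eq_re_inner := fun u => by
      change _ = (qinner u u).re
      rw [qinner_self, Quaternion.re_coe]
    conj_inner_symm := fun u v => by simp [← star_qinner u v]
    add_left := fun u v w => by simp [qinner_add_left]
    smul_left := fun u v r => by
      have : qinner (op (r : ℍ) • u) v = star (r : ℍ) * qinner u v := qinner_smul_left u v r
      change (qinner (op (r : ℍ) • u) v).re = _
      rw [this]; simp }

theorem qinner_ext {x y : H} (h : ∀ v, qinner x v = qinner y v) : x = y := by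
  have h1 : qinner (x - y) (x - y) = 0 := by
    have h2 : ∀ v, qinner (x - y) v + qinner y v = qinner x v := fun v => by
      rw [← qinner_add_left, sub_add_cancel]
    have h3 := h2 (x - y)
    rw [h] at h3
    simpa using h3
  rw [qinner_self] at h1
  have h4 : ‖x - y‖ ^ 2 = 0 := by
    rw [← Quaternion.coe_zero] at h1
    exact Quaternion.coe_injective h1
  exact sub_eq_zero.1 (norm_eq_zero.1 (pow_eq_zero_iff two_ne_zero |>.1 h4))

theorem exists_adjoint [CompleteSpace H] (T : H →L[ℍᵐᵒᵖ] H) :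
    ∃ S : H →L[ℍᵐᵒᵖ] H, ∀ u v, qinner (S u) v = qinner u (T v) := by
  let _ : InnerProductSpace ℝ H := realInnerSpace H
  let TR : H →L[ℝ] H :=
    { toFun := T, map_add' := map_add T, map_smul' := fun r u => T.map_smul (op (r : ℍ)) u,
      cont := T.continuous }
  let S := ContinuousLinearMap.adjoint TR
  have hre : ∀ u v, (qinner (S u) v).re = (qinner u (T v)).re :=
    fun u v => ContinuousLinearMap.adjoint_inner_left TR v u
  have hS : ∀ u v, qinner (S u) v = qinner u (T v) := fun u v => by
    have key : ∀ p : ℍ, (qinner (S u) v * p).re = (qinner u (T v) * p).re := fun p => by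
      rw [← qinner_smul_right, ← qinner_smul_right, hre, T.map_smul]
    simp only [Quaternion.re_mul] at key
    ext
    · simpa using key 1
    · simpa using key (⟨0, 1, 0, 0⟩ : ℍ[ℝ])
    · simpa using key (⟨0, 0, 1, 0⟩ : ℍ[ℝ])
    · simpa using key (⟨0, 0, 0, 1⟩ : ℍ[ℝ])
  refine ⟨{ toFun := S, map_add' := map_add S, map_smul' := fun p u => ?_,
            cont := S.continuous }, hS⟩
  refine qinner_ext fun v => ?_
  obtain ⟨p, rfl⟩ := op_surjective p
  simp only [RingHom.id_apply, hS, qinner_smul_left]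

/-- The adjoint `T*`, characterised by `⟨T* u|v⟩ = ⟨u|T v⟩`. -/
def qadjoint [CompleteSpace H] (T : H →L[ℍᵐᵒᵖ] H) : H →L[ℍᵐᵒᵖ] H :=
  Classical.choose (exists_adjoint T)

theorem qinner_qadjoint [CompleteSpace H] (T : H →L[ℍᵐᵒᵖ] H) (u v : H) :
    qinner (qadjoint T u) v = qinner u (T v) :=
  Classical.choose_spec (exists_adjoint T) u v

def IsNormalOp [CompleteSpace H] (T : H →L[ℍᵐᵒᵖ] H) : Prop :=
  T * qadjoint T = qadjoint T * T

/-- `T ≥ 0`: every `⟨u|T u⟩` is a non-negative real number. -/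
def IsPositiveOp (T : H →L[ℍᵐᵒᵖ] H) : Prop :=
  ∀ u, ∃ r : ℝ, 0 ≤ r ∧ qinner u (T u) = (r : ℍ)

/-- `A = |S|`, i.e. `A` is the positive square root of `S* S`. -/
def IsAbsOp [CompleteSpace H] (S A : H →L[ℍᵐᵒᵖ] H) : Prop :=
  IsPositiveOp A ∧ A * A = qadjoint S * S

def opKer (T : H →L[ℍᵐᵒᵖ] H) : Set H := {u | T u = 0}

def qperp (N : Set H) : Set H := {u | ∀ z ∈ N, qinner u z = 0}

structure IsHilbertBasis (N : Set H) : Prop where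
  norm_one : ∀ z ∈ N, ‖z‖ = 1
  orthogonal : ∀ z ∈ N, ∀ z' ∈ N, z ≠ z' → qinner z z' = 0
  perp : qperp N = {0}

/-- `L` is the left scalar multiplication induced by some Hilbert basis `N`:
`L_q u = ∑_{z ∈ N} z q ⟨z|u⟩`. -/
def IsLeftScalarMul (L : ℍ → H →L[ℍᵐᵒᵖ] H) : Prop :=
  ∃ N : Set H, IsHilbertBasis N ∧
    ∀ (q : ℍ) (u : H), HasSum (fun z : N => op (q * qinner (z : H) u) • (z : H)) (L q u)

/-! ### Spherical spectrum -/

/-- `Δ_q(T) = T² - T (2 Re q) + 1 |q|²`. -/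
def sphDelta (T : H →L[ℍᵐᵒᵖ] H) (q : ℍ) (u : H) : H :=
  T (T u) - op ((2 * q.re : ℝ) : ℍ) • T u + op ((‖q‖ ^ 2 : ℝ) : ℍ) • u

/-- Boundedness of `Δ_q(T)⁻¹ : Ran Δ_q(T) → H` (for injective `Δ_q(T)`). -/
def sphInvBounded (T : H →L[ℍᵐᵒᵖ] H) (q : ℍ) : Prop :=
  ∃ C : ℝ, ∀ u, ‖u‖ ≤ C * ‖sphDelta T q u‖

def sphResolvent (T : H →L[ℍᵐᵒᵖ] H) : Set ℍ :=
  {q | {u | sphDelta T q u = 0} = {0} ∧ Dense (Set.range (sphDelta T q)) ∧ sphInvBounded T q}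

def sphSpectrum (T : H →L[ℍᵐᵒᵖ] H) : Set ℍ := (sphResolvent T)ᶜ

def sphPointSpectrum (T : H →L[ℍᵐᵒᵖ] H) : Set ℍ :=
  {q | {u | sphDelta T q u = 0} ≠ {0}}

def sphResidualSpectrum (T : H →L[ℍᵐᵒᵖ] H) : Set ℍ :=
  {q | {u | sphDelta T q u = 0} = {0} ∧ closure (Set.range (sphDelta T q)) ≠ Set.univ}

def sphContinuousSpectrum (T : H →L[ℍᵐᵒᵖ] H) : Set ℍ :=
  {q | {u | sphDelta T q u = 0} = {0} ∧ closure (Set.range (sphDelta T q)) = Set.univ ∧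
    ¬ sphInvBounded T q}

end Hilbert

/-! ### Quaternionic projection-valued measures -/

/-- A qPVM over `ℂ⁺_ι` in `H`. Only the values on Borel sets are meaningful. -/
structure QPVM (ι : ℍ) (H : Type*) [NormedAddCommGroup H] [Module ℍᵐᵒᵖ H]
    [QuaternionicInner H] where
  toFun : Set (sliceHalfPlane ι) → H →L[ℍᵐᵒᵖ] H
  map_univ : toFun Set.univ = 1
  map_inter : ∀ E E', MeasurableSet E → MeasurableSet E' → toFun E * toFun E' = toFun (E ∩ E')
  map_iUnion : ∀ E : ℕ → Set (sliceHalfPlane ι), (∀ n, MeasurableSet (E n)) →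
    Pairwise (fun m n => Disjoint (E m) (E n)) →
    ∀ u, HasSum (fun n => toFun (E n) u) (toFun (⋃ n, E n) u)
  nonneg : ∀ E, MeasurableSet E → IsPositiveOp (toFun E)

section Measure

variable {ι : ℍ} {H : Type*} [NormedAddCommGroup H] [Module ℍᵐᵒᵖ H] [QuaternionicInner H]

instance : CoeFun (QPVM ι H) (fun _ => Set (sliceHalfPlane ι) → H →L[ℍᵐᵒᵖ] H) := ⟨QPVM.toFun⟩

def QPVM.supp (P : QPVM ι H) : Set (sliceHalfPlane ι) :=
  (⋃₀ {O | IsOpen O ∧ P O = 0})ᶜ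

/-- The pair `(P, L)` is an iqPVM. -/
structure IsIQPVM (P : QPVM ι H) (L : ℍ → H →L[ℍᵐᵒᵖ] H) : Prop where
  leftMul : IsLeftScalarMul L
  commute : ∀ E, MeasurableSet E → ∀ q, P E * L q = L q * P E

/-- The integral `∑ L_{S_ℓ} P(E_ℓ)` of a simple function `s = ∑ S_ℓ χ_{E_ℓ}`. -/
def simpleIntegral (P : QPVM ι H) (L : ℍ → H →L[ℍᵐᵒᵖ] H)
    (s : SimpleFunc (sliceHalfPlane ι) ℍ) : H →L[ℍᵐᵒᵖ] H :=
  ∑ q ∈ s.range, L q * P (s ⁻¹' {q})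

/-- Convergence of a sequence of operators in the operator norm. -/
def OpTendsto (S : ℕ → H →L[ℍᵐᵒᵖ] H) (T : H →L[ℍᵐᵒᵖ] H) : Prop :=
  ∀ ε : ℝ, 0 < ε → ∀ᶠ n in atTop, ∀ u, ‖S n u - T u‖ ≤ ε * ‖u‖

/-- `T = ∫ ψ d(P, L)`: the restriction of `ψ` to `supp P` is bounded and measurable, and `T` is the
operator-norm limit of the integrals of any sequence of simple functions converging uniformly to
the extension by `0` of that restriction (such sequences exist). -/
structure HasIQIntegral (P : QPVM ι H) (L : ℍ → H →L[ℍᵐᵒᵖ] H) (ψ : sliceHalfPlane ι → ℍ)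
    (T : H →L[ℍᵐᵒᵖ] H) : Prop where
  bounded : ∃ C : ℝ, ∀ z ∈ P.supp, ‖ψ z‖ ≤ C
  measurable : Measurable (P.supp.indicator ψ)
  exists_approx : ∃ s : ℕ → SimpleFunc (sliceHalfPlane ι) ℍ,
    TendstoUniformly (fun n => ⇑(s n)) (P.supp.indicator ψ) atTop
  tendsto : ∀ s : ℕ → SimpleFunc (sliceHalfPlane ι) ℍ,
    TendstoUniformly (fun n => ⇑(s n)) (P.supp.indicator ψ) atTop →
    OpTendsto (fun n => simpleIntegral P L (s n)) T

end Measure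

end

open QuaternionicInner

noncomputable section

/-! ### Imaginary units and the half-plane -/

/-! Right multiplication by ℂ ⊂ ℍ makes the space a complex Hilbert space on which T is normal, so
the complex continuous functional calculus applies. It is used only for real functions f pulled back
along the folding α + iβ ↦ α + ι|β|. The resulting operators Φ(f) are self-adjoint. By
Stone–Weierstrass they are limits of polynomials in T + T* (the function 2α) and -(T - T*)² (the
function 4β²), so they commute with right multiplication by every quaternion
(`SliceCalculus.map_op_smul`).

Riesz–Markov–Kakutani turns f ↦ ⟨u, Φ(f)u⟩ into a measure μ_u. Polarisation and Fréchet–Riesz then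
give the operators P(E). Their multiplicativity comes from the relation ⟨P(E)u, Φ(g)u⟩ = ∫_E g dμ_u
(`inner_proj_map`).

The left multiplication must satisfy L_ι|T - T*| = T - T* and commute with every Φ(f). Zorn's lemma
supplies a maximal set S of vectors u with (T - T*)u = (|T - T*|u)ι on which all entries ⟨u|Φ(f)v⟩
are real. Maximality makes S a closed real subspace, invariant under the calculus and with zero
orthogonal complement (`qperp_of_maximal`). A real orthonormal basis of S is then a Hilbert basis,
and the multiplication it defines satisfies L_q u = uq on S.

Integrals against (P, L) are controlled by ‖(∫ψ)u‖² = ∫|ψ|² dμ_u, so pointwise identities on the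
support become operator identities (`IsSliceIntegral.unique`). This gives the commutation rules. It
also gives uniqueness of P: the functions whose integral equals Φ(f) form an algebra that separates
points. The operator -L_ι(T - T*) is the unique positive square root of -(T - T*)², which fixes L_ι
on Ker(T - T*)^⊥. Conversely, the algebraic conditions of (b) make L_ι and L_j commute with the
calculus, and then all L_q do because ℍ = ℂ_ι + ℂ_ι j.

For the spectrum, Δ_q(T) is the integral of z² - 2Re(q)z + |q|², whose only zero in the half-plane
is the point w of the sphere of q. The kernel of Δ_q(T) is therefore the range of P({w}). Its
inverse is bounded exactly when w lies off the support, and its range is dense once it is injective,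
because the integral is normal. -/

theorem norm_of_mem_imUnits {q : ℍ} (hq : q ∈ imUnits) : ‖q‖ = 1 := by
  have h : ‖q‖ * ‖q‖ = 1 := by rw [← norm_mul, show q * q = -1 from hq, norm_neg, norm_one]
  nlinarith [norm_nonneg q]

theorem star_of_mem_imUnits {q : ℍ} (hq : q ∈ imUnits) : star q = -q := by
  have h0 : q ≠ 0 := fun h => by simpa [h] using norm_of_mem_imUnits hq
  have h1 : q * star q = 1 := by
    rw [Quaternion.self_mul_star, Quaternion.normSq_eq_norm_mul_self, norm_of_mem_imUnits hq]
    simp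
  have h2 : q * -q = 1 := by rw [mul_neg, show q * q = -1 from hq, neg_neg]
  exact mul_left_cancel₀ h0 (h1.trans h2.symm)

theorem re_of_mem_imUnits {q : ℍ} (hq : q ∈ imUnits) : q.re = 0 := by
  have h := congrArg QuaternionAlgebra.re (star_of_mem_imUnits hq)
  simp at h
  linarith

section HalfPlane

variable {ι : ℍ}

/-- The coordinate `α` of `α + ι β`. -/
def hpRe (z : sliceHalfPlane ι) : ℝ := (z : ℍ).re

/-- The coordinate `β` of `α + ι β`. -/
def hpIm (z : sliceHalfPlane ι) : ℝ := ‖(z : ℍ).im‖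

theorem continuous_hpRe : Continuous (hpRe : sliceHalfPlane ι → ℝ) :=
  Quaternion.continuous_re.comp continuous_subtype_val

theorem continuous_hpIm : Continuous (hpIm : sliceHalfPlane ι → ℝ) :=
  (Quaternion.continuous_im.comp continuous_subtype_val).norm

theorem hpIm_nonneg (z : sliceHalfPlane ι) : 0 ≤ hpIm z := norm_nonneg _

theorem im_coe_add_mul (hι : ι ∈ imUnits) (α β : ℝ) :
    ((α : ℍ) + ι * (β : ℍ)).im = ι * (β : ℍ) := by
  have := re_of_mem_imUnits hι
  ext <;> simp [this]

theorem re_coe_add_mul (hι : ι ∈ imUnits) (α β : ℝ) :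
    ((α : ℍ) + ι * (β : ℍ)).re = α := by
  simp [re_of_mem_imUnits hι]

theorem norm_im_coe_add_mul (hι : ι ∈ imUnits) (α β : ℝ) :
    ‖((α : ℍ) + ι * (β : ℍ)).im‖ = |β| := by
  rw [im_coe_add_mul hι, norm_mul, norm_of_mem_imUnits hι, Quaternion.norm_coe, one_mul,
    Real.norm_eq_abs]

/-- The point `α + ι |β|` of the half-plane. -/
def hpMk (ι : ℍ) (α β : ℝ) : sliceHalfPlane ι :=
  ⟨(α : ℍ) + ι * ((|β| : ℝ) : ℍ), α, |β|, abs_nonneg β, rfl⟩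

theorem hpRe_hpMk (hι : ι ∈ imUnits) (α β : ℝ) : hpRe (hpMk ι α β) = α :=
  re_coe_add_mul hι α |β|

theorem hpIm_hpMk (hι : ι ∈ imUnits) (α β : ℝ) : hpIm (hpMk ι α β) = |β| :=
  (norm_im_coe_add_mul hι α |β|).trans (abs_abs β)

theorem coe_eq_hpRe_add (hι : ι ∈ imUnits) (z : sliceHalfPlane ι) :
    (z : ℍ) = (hpRe z : ℍ) + ι * (hpIm z : ℍ) := by
  obtain ⟨z, α, β, hβ, rfl⟩ := z
  simp only [hpRe, hpIm, re_coe_add_mul hι, norm_im_coe_add_mul hι, abs_of_nonneg hβ]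

theorem hp_ext (hι : ι ∈ imUnits) {z w : sliceHalfPlane ι} (h1 : hpRe z = hpRe w)
    (h2 : hpIm z = hpIm w) : z = w := by
  apply Subtype.ext
  rw [coe_eq_hpRe_add hι z, coe_eq_hpRe_add hι w, h1, h2]

theorem hpMk_hpRe_hpIm (hι : ι ∈ imUnits) (z : sliceHalfPlane ι) :
    hpMk ι (hpRe z) (hpIm z) = z :=
  hp_ext hι (hpRe_hpMk hι _ _) ((hpIm_hpMk hι _ _).trans (abs_of_nonneg (hpIm_nonneg z)))

theorem continuous_hpMk : Continuous fun z : ℂ => hpMk ι z.re z.im := by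
  refine Continuous.subtype_mk ?_ _
  have h1 : Continuous fun z : ℂ => ((z.re : ℝ) : ℍ) :=
    Quaternion.continuous_coe.comp Complex.continuous_re
  have h2 : Continuous fun z : ℂ => ((|z.im| : ℝ) : ℍ) :=
    Quaternion.continuous_coe.comp Complex.continuous_im.abs
  exact h1.add (continuous_const.mul h2)

end HalfPlane

/-! ### The scalar product -/

section Inner

variable {H : Type*} [NormedAddCommGroup H] [Module ℍᵐᵒᵖ H] [QuaternionicInner H]

@[simp] theorem qinner_zero_right (u : H) : qinner u (0 : H) = 0 := by
  have := qinner_add_right u 0 0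
  simpa using this

@[simp] theorem qinner_zero_left (u : H) : qinner (0 : H) u = 0 := by
  rw [← star_qinner, qinner_zero_right, star_zero]

theorem qinner_neg_right (u v : H) : qinner u (-v) = -qinner u v := by
  have := qinner_add_right u v (-v)
  rw [add_neg_cancel, qinner_zero_right] at this
  exact (neg_eq_of_add_eq_zero_right this.symm).symm

theorem qinner_neg_left (u v : H) : qinner (-u) v = -qinner u v := by
  rw [← star_qinner, qinner_neg_right, star_neg, star_qinner]

theorem qinner_sub_right (u v w : H) : qinner u (v - w) = qinner u v - qinner u w := by
  rw [sub_eq_add_neg, qinner_add_right, qinner_neg_right, sub_eq_add_neg]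

theorem qinner_sub_left (u v w : H) : qinner (u - v) w = qinner u w - qinner v w := by
  rw [sub_eq_add_neg, qinner_add_left, qinner_neg_left, sub_eq_add_neg]

theorem norm_coeComplex (z : ℂ) : ‖(z : ℍ)‖ = ‖z‖ := by
  have h : ‖(z : ℍ)‖ ^ 2 = ‖z‖ ^ 2 := by
    rw [sq, ← Quaternion.normSq_eq_norm_mul_self, Quaternion.normSq_def', Complex.sq_norm,
      Complex.normSq_apply]
    simp; ring
  exact (pow_left_inj₀ (norm_nonneg _) (norm_nonneg _) two_ne_zero).1 h

/-- The embedding of `ℂ` into `ℍᵐᵒᵖ`. -/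
def complexToQuaternionOp : ℂ →+* ℍᵐᵒᵖ where
  toFun z := op (z : ℍ)
  map_one' := by simp
  map_zero' := by simp
  map_add' z w := by simp
  map_mul' z w := by rw [mul_comm, Quaternion.coeComplex_mul, op_mul]

variable (H) in
/-- The complex Hilbert space structure given by right multiplication with `ℂ ⊆ ℍ`. -/
@[reducible] def complexInnerSpace : InnerProductSpace ℂ H :=
  { Module.compHom H complexToQuaternionOp with
    norm_smul_le := fun c u => by
      have := norm_op_smul (c : ℍ) u
      rw [norm_coeComplex] at this
      exact this.le
    inner := fun u v => ⟨(qinner u v).re, (qinner u v).imI⟩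
    norm_sq_eq_re_inner := fun u => by
      change _ = (qinner u u).re
      rw [qinner_self, Quaternion.re_coe]
    conj_inner_symm := fun u v => by
      rw [← star_qinner u v]; apply Complex.ext <;> simp
    add_left := fun u v w => by apply Complex.ext <;> simp [qinner_add_left]
    smul_left := fun u v c => by
      have : qinner (op (c : ℍ) • u) v = star (c : ℍ) * qinner u v := qinner_smul_left u v c
      change (⟨(qinner (op (c : ℍ) • u) v).re, (qinner (op (c : ℍ) • u) v).imI⟩ : ℂ) = _
      rw [this]; apply Complex.ext <;> simp }

attribute [local instance] complexInnerSpace InnerProductSpace.complexToReal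

theorem complex_smul_def (c : ℂ) (u : H) : c • u = op (c : ℍ) • u := rfl

theorem real_smul_def (c : ℝ) (u : H) : c • u = op (c : ℍ) • u := by
  change ((c : ℂ) • u : H) = _
  rw [complex_smul_def, Quaternion.coeComplex_coe]

theorem complex_inner_def (u v : H) : inner ℂ u v = ⟨(qinner u v).re, (qinner u v).imI⟩ := rfl

theorem real_inner_def (u v : H) : inner ℝ u v = (qinner u v).re := rfl

theorem real_smul_op_smul (c : ℝ) (p : ℍ) (u : H) : c • op p • u = op p • c • u := by
  rw [real_smul_def, real_smul_def, smul_smul, smul_smul, ← op_mul, ← op_mul,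
    Quaternion.coe_commutes]

theorem qinner_real_smul_right (c : ℝ) (u v : H) : qinner u (c • v) = c * qinner u v := by
  rw [real_smul_def, qinner_smul_right, Quaternion.coe_commutes]

/-- Real Cauchy–Schwarz applied to u and vā with a = ⟨u|v⟩, for which the scalar product is the real
number |a|². -/
theorem norm_qinner_le (u v : H) : ‖qinner u v‖ ≤ ‖u‖ * ‖v‖ := by
  set a := qinner u v with ha
  have h1 : qinner u (op (star a) • v) = ((‖a‖ * ‖a‖ : ℝ) : ℍ) := by
    rw [qinner_smul_right, ← ha, Quaternion.self_mul_star, Quaternion.normSq_eq_norm_mul_self]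
  have h2 := real_inner_le_norm u (op (star a) • v)
  rw [real_inner_def, h1, norm_op_smul, Quaternion.norm_star, Quaternion.re_coe] at h2
  rcases (norm_nonneg a).eq_or_lt with h | h
  · rw [← h]; positivity
  · nlinarith

theorem continuous_qinner : Continuous fun x : H × H => qinner x.1 x.2 := by
  rw [continuous_iff_continuousAt]
  rintro ⟨u, v⟩
  have key : ∀ x : H × H, ‖qinner x.1 x.2 - qinner u v‖ ≤
      ‖x.1‖ * ‖x.2 - v‖ + ‖x.1 - u‖ * ‖v‖ := fun x => by
    have : qinner x.1 x.2 - qinner u v = qinner x.1 (x.2 - v) + qinner (x.1 - u) v := by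
      rw [qinner_sub_right, qinner_sub_left]; abel
    rw [this]
    exact (norm_add_le _ _).trans (add_le_add (norm_qinner_le _ _) (norm_qinner_le _ _))
  have hlim : Tendsto (fun x : H × H => ‖x.1‖ * ‖x.2 - v‖ + ‖x.1 - u‖ * ‖v‖) (𝓝 (u, v)) (𝓝 0) := by
    have : Continuous fun x : H × H => ‖x.1‖ * ‖x.2 - v‖ + ‖x.1 - u‖ * ‖v‖ := by fun_prop
    simpa using this.tendsto (u, v)
  rw [ContinuousAt, tendsto_iff_norm_sub_tendsto_zero]
  exact squeeze_zero (fun _ => norm_nonneg _) key hlim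

theorem Continuous.qinner {Y : Type*} [TopologicalSpace Y] {f g : Y → H} (hf : Continuous f)
    (hg : Continuous g) : Continuous fun y => QuaternionicInner.qinner (f y) (g y) :=
  continuous_qinner.comp (hf.prodMk hg)

theorem continuous_op_smul (p : ℍ) : Continuous fun u : H => op p • u := by
  have : LipschitzWith ‖p‖₊ fun u : H => op p • u := by
    refine LipschitzWith.of_dist_le_mul fun u v => ?_
    rw [dist_eq_norm, dist_eq_norm, ← smul_sub, norm_op_smul, coe_nnnorm]
  exact this.continuous

/-- For p = i, j, k the real parts kill the three imaginary coordinates of a. The i-coordinate for p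
= i kills the real part. -/
theorem quaternion_eq_zero_of_comm {a : ℍ} (h : ∀ p : ℍ, a * p = star p * a) : a = 0 := by
  simp only [Quaternion.ext_iff, Quaternion.re_mul, Quaternion.imI_mul, Quaternion.imJ_mul,
    Quaternion.imK_mul, Quaternion.re_star, Quaternion.imI_star, Quaternion.imJ_star,
    Quaternion.imK_star] at h
  obtain ⟨h1, h2, -⟩ := h (⟨0, 1, 0, 0⟩ : ℍ[ℝ])
  obtain ⟨h3, -⟩ := h (⟨0, 0, 1, 0⟩ : ℍ[ℝ])
  obtain ⟨h4, -⟩ := h (⟨0, 0, 0, 1⟩ : ℍ[ℝ])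
  simp only [mul_zero, mul_one, zero_mul, neg_zero, add_zero, zero_add, sub_zero, zero_sub,
    neg_mul, one_mul] at h1 h2 h3 h4
  ext <;> simp only [Quaternion.re_zero, Quaternion.imI_zero, Quaternion.imJ_zero,
    Quaternion.imK_zero] <;> linarith

theorem quaternion_coe_re {a : ℍ} (h : star a = a) : a = (a.re : ℍ) := by
  have := Quaternion.ext_iff.1 h
  simp at this
  obtain ⟨h1, h2, h3⟩ := this
  ext <;> simp <;> linarith

/-- A quaternionic operator is determined by its quadratic form. -/
theorem ext_of_qform {S S' : H →L[ℍᵐᵒᵖ] H} (h : ∀ u, qinner u (S u) = qinner u (S' u)) :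
    S = S' := by
  set D := S - S'
  have hD : ∀ u, qinner u (D u) = 0 := fun u => by
    simp [D, qinner_sub_right, h]
  have hs : ∀ u v, qinner u (D v) + qinner v (D u) = 0 := fun u v => by
    have := hD (u + v)
    simpa [qinner_add_left, qinner_add_right, hD, add_comm] using this
  have h0 : ∀ u v, qinner u (D v) = 0 := fun u v => by
    -- Replacing v by vp in ⟨u|Dv⟩ = -⟨v|Du⟩ shows that a = ⟨u|Dv⟩ satisfies ap = p̄a for every p.
    refine quaternion_eq_zero_of_comm fun p => ?_
    have := hs u (op p • v)
    rw [map_smul, qinner_smul_right, qinner_smul_left, ← eq_neg_iff_add_eq_zero] at this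
    rw [this, eq_neg_of_add_eq_zero_right (hs u v), mul_neg, neg_neg]
  have : D = 0 := by
    ext u
    refine qinner_ext fun v => ?_
    rw [← star_qinner, h0]; simp
  exact sub_eq_zero.1 this

/-! ### Algebra of quaternionic adjoints -/

section Adjoint

variable [CompleteSpace H]

theorem qinner_qadjoint_right (T : H →L[ℍᵐᵒᵖ] H) (u v : H) :
    qinner u (qadjoint T v) = qinner (T u) v := by
  rw [← star_qinner, qinner_qadjoint, star_qinner]

theorem eq_qadjoint_of {S T : H →L[ℍᵐᵒᵖ] H} (h : ∀ u v, qinner (S u) v = qinner u (T v)) :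
    S = qadjoint T := by
  ext u
  exact qinner_ext fun v => by rw [h, qinner_qadjoint]

theorem qadjoint_qadjoint (T : H →L[ℍᵐᵒᵖ] H) : qadjoint (qadjoint T) = T :=
  (eq_qadjoint_of fun u v => (qinner_qadjoint_right T u v).symm).symm

theorem qadjoint_mul (S T : H →L[ℍᵐᵒᵖ] H) : qadjoint (S * T) = qadjoint T * qadjoint S :=
  (eq_qadjoint_of fun u v => by
    simp only [mul_apply_eq_comp, qinner_qadjoint]).symm

theorem qadjoint_add (S T : H →L[ℍᵐᵒᵖ] H) : qadjoint (S + T) = qadjoint S + qadjoint T :=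
  (eq_qadjoint_of fun u v => by
    simp only [add_apply, qinner_qadjoint, qinner_add_left,
      qinner_add_right]).symm

theorem qadjoint_neg (S : H →L[ℍᵐᵒᵖ] H) : qadjoint (-S) = -qadjoint S :=
  (eq_qadjoint_of fun u v => by
    simp only [neg_apply, qinner_qadjoint, qinner_neg_left,
      qinner_neg_right]).symm

theorem qadjoint_sub (S T : H →L[ℍᵐᵒᵖ] H) : qadjoint (S - T) = qadjoint S - qadjoint T := by
  rw [sub_eq_add_neg, qadjoint_add, qadjoint_neg, sub_eq_add_neg]

theorem IsPositiveOp.qadjoint_eq {S : H →L[ℍᵐᵒᵖ] H} (hS : IsPositiveOp S) : qadjoint S = S :=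
  ext_of_qform fun u => by
    obtain ⟨r, -, hr⟩ := hS u
    rw [qinner_qadjoint_right, ← star_qinner, hr, Quaternion.star_coe]

end Adjoint

/-- A quaternionic operator as a complex-linear operator. -/
def toComplexOp (T : H →L[ℍᵐᵒᵖ] H) : H →L[ℂ] H :=
  { toFun := T, map_add' := map_add T, map_smul' := fun c u => T.map_smul (op (c : ℍ)) u,
    cont := T.continuous }

@[simp] theorem toComplexOp_apply (T : H →L[ℍᵐᵒᵖ] H) (u : H) : toComplexOp T u = T u := rfl

theorem qop_map_real_smul (T : H →L[ℍᵐᵒᵖ] H) (c : ℝ) (u : H) : T (c • u) = c • T u := by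
  rw [real_smul_def, map_smul, real_smul_def]

theorem exists_bound (T : H →L[ℍᵐᵒᵖ] H) : ∃ C : ℝ, 0 < C ∧ ∀ u, ‖T u‖ ≤ C * ‖u‖ := by
  refine ⟨‖toComplexOp T‖ + 1, by positivity, fun u => ?_⟩
  have := (toComplexOp T).le_opNorm u
  rw [toComplexOp_apply] at this
  nlinarith [norm_nonneg u]

theorem adjoint_toComplexOp [CompleteSpace H] (T : H →L[ℍᵐᵒᵖ] H) :
    ContinuousLinearMap.adjoint (toComplexOp T) = toComplexOp (qadjoint T) := by
  symm
  rw [ContinuousLinearMap.eq_adjoint_iff]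
  intro u v
  simp [complex_inner_def, qinner_qadjoint]

end Inner

/-! ### Hilbert bases and left scalar multiplications -/

section LeftMul

variable {H : Type*} [NormedAddCommGroup H] [Module ℍᵐᵒᵖ H] [QuaternionicInner H]

attribute [local instance] complexInnerSpace InnerProductSpace.complexToReal

/-- `p ↦ z p` for a unit vector `z`. -/
def unitLine (z : H) (hz : ‖z‖ = 1) : ℍ →ₗᵢ[ℝ] H where
  toFun p := op p • z
  map_add' p q := by rw [op_add, add_smul]
  map_smul' c p := by
    rw [RingHom.id_apply, real_smul_def, smul_smul, ← op_mul, ← Quaternion.coe_mul_eq_smul,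
      Quaternion.coe_commutes]
  norm_map' p := by simp [norm_op_smul, hz]

namespace IsHilbertBasis

variable {N : Set H}

theorem orthogonalFamily (hN : IsHilbertBasis N) :
    OrthogonalFamily ℝ (fun _ : N => ℍ) fun z => unitLine (z : H) (hN.norm_one z z.2) := by
  intro z z' hzz p q
  change inner ℝ (op p • (z : H)) (op q • (z' : H)) = 0
  rw [real_inner_def, qinner_smul_right, qinner_smul_left,
    hN.orthogonal z z.2 z' z'.2 fun h => hzz (Subtype.ext h)]
  simp

theorem norm_sum_sq (hN : IsHilbertBasis N) (f : N → ℍ) (s : Finset N) :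
    ‖∑ z ∈ s, op (f z) • (z : H)‖ ^ 2 = ∑ z ∈ s, ‖f z‖ ^ 2 :=
  hN.orthogonalFamily.norm_sum f s

theorem summable_iff (hN : IsHilbertBasis N) [CompleteSpace H] (f : N → ℍ) :
    Summable (fun z : N => op (f z) • (z : H)) ↔ Summable fun z => ‖f z‖ ^ 2 :=
  hN.orthogonalFamily.summable_iff_norm_sq_summable f

theorem sum_norm_qinner_sq_le (hN : IsHilbertBasis N) (u : H) (s : Finset N) :
    ∑ z ∈ s, ‖qinner (z : H) u‖ ^ 2 ≤ ‖u‖ ^ 2 := by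
  set v := ∑ z ∈ s, op (qinner (z : H) u) • (z : H) with hv
  have h1 : ‖v‖ ^ 2 = ∑ z ∈ s, ‖qinner (z : H) u‖ ^ 2 := hN.norm_sum_sq _ s
  have h2 : inner ℝ u v = ∑ z ∈ s, ‖qinner (z : H) u‖ ^ 2 := by
    rw [hv, inner_sum]
    refine Finset.sum_congr rfl fun z _ => ?_
    rw [real_inner_def, qinner_smul_right, ← star_qinner, Quaternion.star_mul_self,
      Quaternion.normSq_eq_norm_mul_self, Quaternion.re_coe, sq]
  have h3 := norm_sub_sq_real u v
  nlinarith [sq_nonneg ‖u - v‖]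

theorem summable_mul (hN : IsHilbertBasis N) [CompleteSpace H] (q : ℍ) (u : H) :
    Summable fun z : N => op (q * qinner (z : H) u) • (z : H) := by
  rw [hN.summable_iff]
  refine summable_of_sum_le (c := ‖q‖ ^ 2 * ‖u‖ ^ 2) (fun _ => sq_nonneg _) fun s => ?_
  simp only [norm_mul, mul_pow, ← Finset.mul_sum]
  exact mul_le_mul_of_nonneg_left (hN.sum_norm_qinner_sq_le u s) (sq_nonneg _)

theorem norm_tsum_mul_le (hN : IsHilbertBasis N) [CompleteSpace H] (q : ℍ) (u : H) :
    ‖∑' z : N, op (q * qinner (z : H) u) • (z : H)‖ ≤ ‖q‖ * ‖u‖ := by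
  refine le_of_tendsto (hN.summable_mul q u).hasSum.norm (Eventually.of_forall fun s => ?_)
  refine (sq_le_sq₀ (norm_nonneg _) (by positivity)).1 ?_
  rw [hN.norm_sum_sq]
  simp only [norm_mul, mul_pow, ← Finset.mul_sum]
  exact mul_le_mul_of_nonneg_left (hN.sum_norm_qinner_sq_le u s) (sq_nonneg _)

theorem hasSum_op_smul (p : ℍ) {f : N → H} {u : H} (h : HasSum f u) :
    HasSum (fun z => op p • f z) (op p • u) :=
  h.map (DistribSMul.toAddMonoidHom H (op p)) (continuous_op_smul p)

/-- The left multiplication by `q` defined by a Hilbert basis. -/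
def leftMul (hN : IsHilbertBasis N) [CompleteSpace H] (q : ℍ) : H →L[ℍᵐᵒᵖ] H :=
  have hadd : ∀ u v : H, ∑' z : N, op (q * qinner (z : H) (u + v)) • (z : H) =
      ∑' z : N, op (q * qinner (z : H) u) • (z : H) +
        ∑' z : N, op (q * qinner (z : H) v) • (z : H) := fun u v => by
    rw [← (hN.summable_mul q u).tsum_add (hN.summable_mul q v)]
    simp only [qinner_add_right, mul_add, op_add, add_smul]
  { toFun := fun u => ∑' z : N, op (q * qinner (z : H) u) • (z : H)
    map_add' := hadd
    map_smul' := fun p u => by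
      obtain ⟨p, rfl⟩ := op_surjective p
      rw [RingHom.id_apply, ← (hasSum_op_smul p (hN.summable_mul q u).hasSum).tsum_eq]
      simp only [qinner_smul_right, ← mul_assoc, smul_smul]
      simp only [← op_mul, mul_assoc]
    cont := AddMonoidHomClass.continuous_of_bound
      (AddMonoidHom.mk' (fun u => ∑' z : N, op (q * qinner (z : H) u) • (z : H)) hadd) ‖q‖
      (hN.norm_tsum_mul_le q) }

theorem hasSum_leftMul (hN : IsHilbertBasis N) [CompleteSpace H] (q : ℍ) (u : H) :
    HasSum (fun z : N => op (q * qinner (z : H) u) • (z : H)) (hN.leftMul q u) :=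
  (hN.summable_mul q u).hasSum

theorem isLeftScalarMul (hN : IsHilbertBasis N) [CompleteSpace H] :
    IsLeftScalarMul fun q => hN.leftMul q :=
  ⟨N, hN, hN.hasSum_leftMul⟩

theorem ext_qinner (hN : IsHilbertBasis N) {u v : H} (h : ∀ z ∈ N, qinner z u = qinner z v) :
    u = v := by
  have : u - v ∈ qperp N := fun z hz => by
    rw [← star_qinner, qinner_sub_right, h z hz, sub_self, star_zero]
  rw [hN.perp] at this
  exact sub_eq_zero.1 this

theorem qinner_of_hasSum (hN : IsHilbertBasis N) {q : ℍ} {u w : H}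
    (h : HasSum (fun z : N => op (q * qinner (z : H) u) • (z : H)) w) {z : H} (hz : z ∈ N) :
    qinner z w = q * qinner z u := by
  have h1 := h.map (AddMonoidHom.mk' (fun x => qinner z x) (qinner_add_right z))
    (continuous_const.qinner continuous_id)
  have h2 := hasSum_single (f := fun z' : N => qinner z (op (q * qinner (z' : H) u) • (z' : H)))
    (⟨z, hz⟩ : N) fun z' hz' => by
      rw [qinner_smul_right, hN.orthogonal z hz z' z'.2 fun h => hz' (Subtype.ext h.symm),
        zero_mul]
  have h3 : qinner z w = _ := h1.unique h2
  rw [h3, qinner_smul_right, qinner_self, hN.norm_one z hz]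
  simp

theorem hasSum_qinner_smul (hN : IsHilbertBasis N) [CompleteSpace H] (u : H) :
    HasSum (fun z : N => op (qinner (z : H) u) • (z : H)) u := by
  have h := hN.hasSum_leftMul 1 u
  have : hN.leftMul 1 u = u :=
    hN.ext_qinner fun z hz => by rw [hN.qinner_of_hasSum h hz, one_mul]
  simpa [this] using h

theorem hasSum_qinner (hN : IsHilbertBasis N) [CompleteSpace H] (u v : H) :
    HasSum (fun z : N => star (qinner (z : H) u) * qinner (z : H) v) (qinner u v) := by
  have h := (hN.hasSum_qinner_smul v).map (AddMonoidHom.mk' (fun x => qinner u x)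
    (qinner_add_right u)) (continuous_const.qinner continuous_id)
  refine h.congr_fun ?_
  intro z
  change _ = qinner u (op (qinner (z : H) v) • (z : H))
  rw [qinner_smul_right, star_qinner]

theorem op_ext (hN : IsHilbertBasis N) [CompleteSpace H] {S S' : H →L[ℍᵐᵒᵖ] H}
    (h : ∀ z ∈ N, S z = S' z) : S = S' := by
  ext u
  have h1 := (hN.hasSum_qinner_smul u).mapL S
  have h2 := (hN.hasSum_qinner_smul u).mapL S'
  refine h1.unique (h2.congr_fun ?_)
  intro z
  rw [map_smul, map_smul, h z z.2]

end IsHilbertBasis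

namespace IsLeftScalarMul

variable {L : ℍ → H →L[ℍᵐᵒᵖ] H}

/-- In the coordinates ⟨z|u⟩ the operator L_q is left multiplication by q. The algebraic rules for L
are then coordinatewise identities in ℍ. -/
theorem exists_basis (hL : IsLeftScalarMul L) : ∃ N : Set H, IsHilbertBasis N ∧
    (∀ z ∈ N, ∀ q u, qinner z (L q u) = q * qinner z u) ∧ ∀ z ∈ N, ∀ q, L q z = op q • z := by
  obtain ⟨N, hN, h⟩ := hL
  have h1 : ∀ z ∈ N, ∀ q u, qinner z (L q u) = q * qinner z u :=
    fun z hz q u => hN.qinner_of_hasSum (h q u) hz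
  refine ⟨N, hN, h1, fun z hz q => hN.ext_qinner fun w hw => ?_⟩
  rw [h1 w hw, qinner_smul_right]
  by_cases hwz : w = z
  · rw [hwz, qinner_self, Quaternion.coe_commutes]
  · rw [hN.orthogonal w hw z hz hwz]; simp

theorem map_add (hL : IsLeftScalarMul L) (p q : ℍ) : L (p + q) = L p + L q := by
  obtain ⟨N, hN, h, -⟩ := hL.exists_basis
  ext u
  refine hN.ext_qinner fun z hz => ?_
  rw [add_apply, qinner_add_right, h z hz, h z hz, h z hz, add_mul]

theorem map_mul (hL : IsLeftScalarMul L) (p q : ℍ) : L (p * q) = L p * L q := by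
  obtain ⟨N, hN, h, -⟩ := hL.exists_basis
  ext u
  refine hN.ext_qinner fun z hz => ?_
  rw [mul_apply_eq_comp, h z hz, h z hz, h z hz, mul_assoc]

theorem map_coe (hL : IsLeftScalarMul L) (r : ℝ) (u : H) : L (r : ℍ) u = r • u := by
  obtain ⟨N, hN, h, -⟩ := hL.exists_basis
  refine hN.ext_qinner fun z hz => ?_
  rw [h z hz, qinner_real_smul_right]

theorem map_one (hL : IsLeftScalarMul L) : L 1 = 1 := by
  ext u
  have := hL.map_coe 1 u
  simpa using this

theorem map_zero (hL : IsLeftScalarMul L) : L 0 = 0 := by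
  ext u
  have := hL.map_coe 0 u
  simpa using this

theorem map_neg (hL : IsLeftScalarMul L) (p : ℍ) : L (-p) = -L p := by
  have := hL.map_add (-p) p
  rw [neg_add_cancel, hL.map_zero] at this
  exact eq_neg_of_add_eq_zero_left this.symm

theorem qadjoint_apply (hL : IsLeftScalarMul L) [CompleteSpace H] (q : ℍ) :
    qadjoint (L q) = L (star q) := by
  obtain ⟨N, hN, h, -⟩ := hL.exists_basis
  refine (eq_qadjoint_of fun u v => ?_).symm
  refine (hN.hasSum_qinner _ v).unique ((hN.hasSum_qinner u _).congr_fun ?_)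
  intro z
  rw [h z z.2, h z z.2, star_mul, star_star, mul_assoc]

end IsLeftScalarMul

end LeftMul

/-! ### Continuous functional calculus over the half-plane -/

section Calculus

variable {ι : ℍ} {H : Type*} [NormedAddCommGroup H] [Module ℍᵐᵒᵖ H] [QuaternionicInner H]

attribute [local instance] complexInnerSpace InnerProductSpace.complexToReal

/-- A quaternionic operator as a real-linear operator. -/
def toRealOp (T : H →L[ℍᵐᵒᵖ] H) : H →L[ℝ] H := (toComplexOp T).restrictScalars ℝ

@[simp] theorem toRealOp_apply (T : H →L[ℍᵐᵒᵖ] H) (u : H) : toRealOp T u = T u := rfl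

variable (ι) in
/-- The function `α + ι β ↦ 2 α`. -/
def twoRe : C(sliceHalfPlane ι, ℝ) := ⟨fun z => 2 * hpRe z, continuous_const.mul continuous_hpRe⟩

variable (ι) in
/-- The function `α + ι β ↦ 2 β`. -/
def twoIm : C(sliceHalfPlane ι, ℝ) := ⟨fun z => 2 * hpIm z, continuous_const.mul continuous_hpIm⟩

/-- A functional calculus with real continuous functions on the half-plane, for which
`T = ∫ (α + ι β)`. -/
structure SliceCalculus (ι : ℍ) [CompleteSpace H] (T : H →L[ℍᵐᵒᵖ] H) where
  toHom : C(sliceHalfPlane ι, ℝ) →ₐ[ℝ] (H →L[ℝ] H)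
  carrier : Set (sliceHalfPlane ι)
  isCompact : IsCompact carrier
  norm_le : ∀ f c, 0 ≤ c → (∀ x ∈ carrier, |f x| ≤ c) → ‖toHom f‖ ≤ c
  symm : ∀ f u v, inner ℝ (toHom f u) v = inner ℝ u (toHom f v)
  -- Only the values on 2α and 4β² are prescribed. These two functions generate a point-separating
  -- algebra, and the operators assigned to them are available without a left multiplication.
  map_twoRe : toHom (twoRe ι) = toRealOp (T + qadjoint T)
  map_twoIm_sq : toHom (twoIm ι * twoIm ι) = -toRealOp ((T - qadjoint T) * (T - qadjoint T))

theorem isStarNormal_toComplexOp [CompleteSpace H] {T : H →L[ℍᵐᵒᵖ] H} (hT : IsNormalOp T) :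
    IsStarNormal (toComplexOp T) := by
  refine ⟨?_⟩
  rw [ContinuousLinearMap.star_eq_adjoint, adjoint_toComplexOp]
  ext u
  exact (DFunLike.congr_fun hT u).symm

/-- Pullback of a function on the half-plane to `ℂ` along `α + i β ↦ α + ι |β|`. -/
def pullbackComplex (f : C(sliceHalfPlane ι, ℝ)) (z : ℂ) : ℂ := ((f (hpMk ι z.re z.im) : ℝ) : ℂ)

theorem continuous_pullbackComplex (f : C(sliceHalfPlane ι, ℝ)) :
    Continuous (pullbackComplex f) :=
  Complex.continuous_ofReal.comp (f.continuous.comp continuous_hpMk)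

/-- The complex calculus of T, restricted to real functions that are symmetric under conjugation.
Real values give symmetric operators, and the symmetry lets f live on the half-plane. The carrier is
the folded complex spectrum. -/
theorem exists_sliceCalculus [CompleteSpace H] (hι : ι ∈ imUnits) {T : H →L[ℍᵐᵒᵖ] H}
    (hT : IsNormalOp T) : Nonempty (SliceCalculus ι T) := by
  have hN := isStarNormal_toComplexOp hT
  set a := toComplexOp T with ha
  have hstar : star a = toComplexOp (qadjoint T) := by
    rw [ContinuousLinearMap.star_eq_adjoint, adjoint_toComplexOp]
  have hc : ∀ f : C(sliceHalfPlane ι, ℝ), ContinuousOn (pullbackComplex f) (spectrum ℂ a) :=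
    fun f => (continuous_pullbackComplex f).continuousOn
  have hid : ContinuousOn (fun z : ℂ => z) (spectrum ℂ a) := continuousOn_id
  have hconj : ContinuousOn (fun z : ℂ => star z) (spectrum ℂ a) := continuous_star.continuousOn
  let Φ₀ : C(sliceHalfPlane ι, ℝ) →ₐ[ℝ] (H →L[ℂ] H) :=
    AlgHom.ofLinearMap
      { toFun := fun f => cfc (pullbackComplex f) a
        map_add' := fun f g => by
          rw [← cfc_add (a := a) _ _ (hc f) (hc g)]
          congr 1; ext z; simp [pullbackComplex]
        map_smul' := fun c f => by
          rw [RingHom.id_apply, ← cfc_smul c _ a (hc f)]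
          congr 1; ext z; simp [pullbackComplex] }
      (by
        change cfc (pullbackComplex 1) a = 1
        rw [← cfc_one ℂ a]
        congr 1)
      (fun f g => by
        change cfc (pullbackComplex (f * g)) a =
          cfc (pullbackComplex f) a * cfc (pullbackComplex g) a
        rw [← cfc_mul _ _ a (hc f) (hc g)]
        congr 1; ext z; simp [pullbackComplex])
  let R : (H →L[ℂ] H) →ₐ[ℝ] (H →L[ℝ] H) :=
    AlgHom.ofLinearMap
      { toFun := fun S => S.restrictScalars ℝ
        map_add' := fun _ _ => rfl
        map_smul' := fun _ _ => rfl } rfl fun _ _ => rfl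
  refine ⟨R.comp Φ₀, (fun z : ℂ => hpMk ι z.re z.im) '' spectrum ℂ a,
    (spectrum.isCompact a).image continuous_hpMk, ?_, ?_, ?_, ?_⟩
  · intro f c hc0 h
    change ‖(cfc (pullbackComplex f) a).restrictScalars ℝ‖ ≤ c
    rw [ContinuousLinearMap.norm_restrictScalars]
    refine norm_cfc_le hc0 fun z hz => ?_
    rw [pullbackComplex, Complex.norm_real]
    exact h _ ⟨z, hz, rfl⟩
  · intro f u v
    have h : star (cfc (pullbackComplex f) a) = cfc (pullbackComplex f) a := by
      rw [← cfc_star]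
      congr 1; ext z; simp [pullbackComplex]
    change (inner ℂ (cfc (pullbackComplex f) a u) v).re =
      (inner ℂ u (cfc (pullbackComplex f) a v)).re
    rw [ContinuousLinearMap.star_eq_adjoint] at h
    conv_lhs => rw [← h]
    rw [ContinuousLinearMap.adjoint_inner_left]
  · change (cfc (pullbackComplex (twoRe ι)) a).restrictScalars ℝ = _
    have h : pullbackComplex (twoRe ι) = fun z => z + star z := by
      ext z
      simp only [pullbackComplex, twoRe, ContinuousMap.coe_mk, hpRe_hpMk hι]
      rw [← Complex.add_conj z]; rfl
    rw [h, cfc_add (a := a) _ _ hid hconj, cfc_id' ℂ a, cfc_star_id a, hstar]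
    rfl
  · change (cfc (pullbackComplex (twoIm ι * twoIm ι)) a).restrictScalars ℝ = _
    -- The absolute value introduced by folding disappears on squaring: 4|β|² = -(z - z̄)².
    have h : pullbackComplex (twoIm ι * twoIm ι) = fun z => -((z - star z) * (z - star z)) := by
      ext z
      simp only [pullbackComplex, twoIm, ContinuousMap.coe_mk, hpIm_hpMk hι,
        ContinuousMap.mul_apply]
      rw [show star z = (starRingEnd ℂ) z from rfl, Complex.sub_conj]
      have : ((|z.im| : ℝ) : ℂ) * ((|z.im| : ℝ) : ℂ) = z.im * z.im := by
        rw [← Complex.ofReal_mul, abs_mul_abs_self, Complex.ofReal_mul]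
      push_cast
      linear_combination 4 * this + 4 * z.im * z.im * Complex.I_mul_I
    have hs : ContinuousOn (fun z : ℂ => z - star z) (spectrum ℂ a) := hid.sub hconj
    rw [h, cfc_neg, cfc_mul _ _ a hs hs, cfc_sub _ _ a hid hconj, cfc_id' ℂ a, cfc_star_id a,
      hstar]
    rfl

namespace SliceCalculus

variable [CompleteSpace H] {T : H →L[ℍᵐᵒᵖ] H}

/-- Polynomials in `2 α` and `4 β²` separate the points of the half-plane. -/
theorem separatesPoints (hι : ι ∈ imUnits) {A : Subalgebra ℝ C(sliceHalfPlane ι, ℝ)}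
    (h1 : twoRe ι ∈ A) (h2 : twoIm ι * twoIm ι ∈ A) : A.SeparatesPoints := by
  intro z w hzw
  by_contra hcon
  push Not at hcon
  have e1 := hcon _ ⟨_, h1, rfl⟩
  have e2 := hcon _ ⟨_, h2, rfl⟩
  simp only [twoRe, twoIm, ContinuousMap.coe_mk, ContinuousMap.mul_apply] at e1 e2
  refine hzw (hp_ext hι (by linarith) ?_)
  -- Since β ≥ 0 on the half-plane, β² determines β.
  have h3 : hpIm z ^ 2 = hpIm w ^ 2 := by nlinarith
  exact (pow_left_inj₀ (hpIm_nonneg z) (hpIm_nonneg w) two_ne_zero).1 h3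

/-- An operator commuting with `T + T*` and `(T - T*)²` commutes with the calculus. -/
theorem commute (hι : ι ∈ imUnits) (Φ : SliceCalculus ι T) {S : H →L[ℝ] H}
    (h1 : Commute S (toRealOp (T + qadjoint T)))
    (h2 : Commute S (toRealOp ((T - qadjoint T) * (T - qadjoint T))))
    (f : C(sliceHalfPlane ι, ℝ)) : Commute S (Φ.toHom f) := by
  let A : Subalgebra ℝ C(sliceHalfPlane ι, ℝ) := (Subalgebra.centralizer ℝ {S}).comap Φ.toHom
  have hmem : ∀ g, g ∈ A ↔ Commute S (Φ.toHom g) := fun g => by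
    simp [A, Subalgebra.mem_centralizer_iff, Commute, SemiconjBy]
  have hA : A.SeparatesPoints := separatesPoints hι
    ((hmem _).2 (by rw [Φ.map_twoRe]; exact h1))
    ((hmem _).2 (by rw [Φ.map_twoIm_sq]; exact h2.neg_right))
  -- Stone–Weierstrass gives g in the commutant algebra within ε of f on the carrier. The commutator
  -- of S with Φ(f) equals that with Φ(f - g).
  have hsmall : ∀ ε : ℝ, 0 < ε → ‖S * Φ.toHom f - Φ.toHom f * S‖ ≤ ε * (2 * ‖S‖) := by
    intro ε hε
    obtain ⟨g, hg, hgf⟩ :=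
      ContinuousMap.exists_mem_subalgebra_near_continuous_of_isCompact_of_separatesPoints hA f
        Φ.isCompact hε
    have hn : ‖Φ.toHom (f - g)‖ ≤ ε := Φ.norm_le _ _ hε.le fun x hx => by
      have := (hgf x hx).le
      rwa [norm_sub_rev] at this
    have hgc : S * Φ.toHom g = Φ.toHom g * S := (hmem g).1 hg
    have : S * Φ.toHom f - Φ.toHom f * S = S * Φ.toHom (f - g) - Φ.toHom (f - g) * S := by
      rw [map_sub, mul_sub, sub_mul, hgc]; abel
    rw [this]
    calc _ ≤ ‖S * Φ.toHom (f - g)‖ + ‖Φ.toHom (f - g) * S‖ := norm_sub_le _ _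
      _ ≤ ‖S‖ * ε + ε * ‖S‖ := add_le_add
          ((norm_mul_le _ _).trans (by gcongr)) ((norm_mul_le _ _).trans (by gcongr))
      _ = _ := by ring
  have h0 : ‖S * Φ.toHom f - Φ.toHom f * S‖ ≤ 0 := by
    refine le_of_forall_pos_le_add fun ε hε => ?_
    have := hsmall (ε / (2 * ‖S‖ + 1)) (by positivity)
    refine this.trans ?_
    rw [zero_add, div_mul_eq_mul_div, div_le_iff₀ (by positivity)]
    nlinarith
  exact sub_eq_zero.1 (norm_le_zero_iff.1 h0)

/-- Right multiplication by a quaternion. -/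
def _root_.rightMul (p : ℍ) : H →L[ℝ] H :=
  { toFun := fun u => op p • u
    map_add' := fun u v => smul_add _ u v
    map_smul' := fun c u => (real_smul_op_smul c p u).symm
    cont := continuous_op_smul p }

/-- Right multiplication by p is in general only real-linear, which is why the calculus takes values
in real-linear operators. It commutes with the two generators because these are ℍ-linear, hence with
the whole calculus. -/
theorem map_op_smul (hι : ι ∈ imUnits) (Φ : SliceCalculus ι T) (f : C(sliceHalfPlane ι, ℝ))
    (p : ℍ) (u : H) : Φ.toHom f (op p • u) = op p • Φ.toHom f u := by
  have h := Φ.commute hι (S := rightMul p)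
    (ContinuousLinearMap.ext fun u => ((T + qadjoint T).map_smul (op p) u).symm)
    (ContinuousLinearMap.ext fun u =>
      (((T - qadjoint T) * (T - qadjoint T)).map_smul (op p) u).symm) f
  exact (DFunLike.congr_fun h u).symm

end SliceCalculus

end Calculus

/-! ### Spectral measures -/

section SpectralMeasure

theorem isClosed_sliceHalfPlane {ι : ℍ} (hι : ι ∈ imUnits) : IsClosed (sliceHalfPlane ι) := by
  have h : sliceHalfPlane ι = {q : ℍ | q = (q.re : ℍ) + ι * ((‖q.im‖ : ℝ) : ℍ)} := by
    ext q
    constructor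
    · intro hq
      exact coe_eq_hpRe_add hι ⟨q, hq⟩
    · intro hq
      exact ⟨q.re, ‖q.im‖, norm_nonneg _, hq⟩
  rw [h]
  exact isClosed_eq continuous_id
    ((Quaternion.continuous_coe.comp Quaternion.continuous_re).add
      (continuous_const.mul (Quaternion.continuous_coe.comp Quaternion.continuous_im.norm)))

theorem locallyCompactSpace_sliceHalfPlane {ι : ℍ} (hι : ι ∈ imUnits) :
    LocallyCompactSpace (sliceHalfPlane ι) :=
  have : ProperSpace ℍ := FiniteDimensional.proper_real ℍ
  (isClosed_sliceHalfPlane hι).locallyCompactSpace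

/-- A linear relation between the integrals of bounded continuous functions against finite
measures holds for the measures themselves. -/
theorem sum_mul_measureReal_eq_zero {X κ : Type*} [TopologicalSpace X] [MeasurableSpace X]
    [BorelSpace X] [HasOuterApproxClosed X] [Fintype κ] (c : κ → ℝ) (μ : κ → Measure X)
    [∀ i, IsFiniteMeasure (μ i)]
    (h : ∀ f : BoundedContinuousFunction X ℝ, ∑ i, c i * ∫ x, f x ∂μ i = 0) (E : Set X) :
    ∑ i, c i * (μ i).real E = 0 := by
  -- Separating positive and negative coefficients turns the signed relation into an equality of two
  -- finite measures, which bounded continuous functions determine.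
  let α : Measure X := ∑ i, (c i).toNNReal • μ i
  let β : Measure X := ∑ i, (-c i).toNNReal • μ i
  have hintegrable : ∀ (f : BoundedContinuousFunction X ℝ) (d : κ → NNReal),
      ∫ x, f x ∂(∑ i, d i • μ i) = ∑ i, (d i : ℝ) * ∫ x, f x ∂μ i := fun f d => by
    rw [integral_finsetSum_measure fun i _ => f.integrable _]
    exact Finset.sum_congr rfl fun i _ => integral_smul_nnreal_measure _ _
  have hreal : ∀ d : κ → NNReal, (∑ i, d i • μ i : Measure X).real E =
      ∑ i, (d i : ℝ) * (μ i).real E := fun d => by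
    rw [measureReal_def, Measure.finsetSum_apply, 
      ENNReal.toReal_sum (fun i _ => measure_ne_top _ _)]
    exact Finset.sum_congr rfl fun i _ => by
      rw [Measure.smul_apply, ENNReal.toReal_smul, measureReal_def]; rfl
  have hsub : ∀ i, c i = ((c i).toNNReal : ℝ) - ((-c i).toNNReal : ℝ) := fun i => by
    rw [Real.coe_toNNReal', Real.coe_toNNReal']
    exact (max_zero_sub_max_neg_zero_eq_self (c i)).symm
  have hαβ : α = β := by
    refine ext_of_forall_integral_eq_of_IsFiniteMeasure fun f => ?_
    rw [hintegrable, hintegrable, ← sub_eq_zero, ← Finset.sum_sub_distrib, ← h f]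
    exact Finset.sum_congr rfl fun i _ => by rw [← sub_mul, ← hsub]
  have : α.real E - β.real E = 0 := by rw [hαβ, sub_self]
  rw [hreal, hreal, ← Finset.sum_sub_distrib] at this
  rw [← this]
  exact Finset.sum_congr rfl fun i _ => by rw [← sub_mul, ← hsub]

variable {ι : ℍ} {H : Type*} [NormedAddCommGroup H] [Module ℍᵐᵒᵖ H] [QuaternionicInner H]

attribute [local instance] complexInnerSpace InnerProductSpace.complexToReal

namespace SliceCalculus

variable [CompleteSpace H] {T : H →L[ℍᵐᵒᵖ] H}

theorem map_eq_zero (Φ : SliceCalculus ι T) {f : C(sliceHalfPlane ι, ℝ)}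
    (h : ∀ x ∈ Φ.carrier, f x = 0) : Φ.toHom f = 0 :=
  norm_le_zero_iff.1 (Φ.norm_le f 0 le_rfl fun x hx => by rw [h x hx, abs_zero])

/-- A nonnegative f is the square of √f, and Φ(√f) is symmetric. -/
theorem inner_map_nonneg (Φ : SliceCalculus ι T) {f : C(sliceHalfPlane ι, ℝ)} (hf : ∀ x, 0 ≤ f x)
    (u : H) : 0 ≤ inner ℝ u (Φ.toHom f u) := by
  let g : C(sliceHalfPlane ι, ℝ) := ⟨fun x => √(f x), f.continuous.sqrt⟩
  have hg : f = g * g := by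
    ext x
    exact (Real.mul_self_sqrt (hf x)).symm
  rw [hg, map_mul, mul_apply_eq_comp, ← Φ.symm]
  exact real_inner_self_nonneg

/-- The positive functional `f ↦ ⟨u, f(T) u⟩`. -/
def functional (Φ : SliceCalculus ι T) (u : H) :
    CompactlySupportedContinuousMap (sliceHalfPlane ι) ℝ →ₚ[ℝ] ℝ :=
  PositiveLinearMap.mk₀
    { toFun := fun f => inner ℝ u (Φ.toHom f.toContinuousMap u)
      map_add' := fun f g => by
        rw [← inner_add_right, ← add_apply, ← map_add]; rfl
      map_smul' := fun c f => by
        rw [RingHom.id_apply, smul_eq_mul, ← real_inner_smul_right, ← smul_apply, ← map_smul]; rfl }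
    fun f hf => Φ.inner_map_nonneg hf u

/-- Riesz–Markov–Kakutani covers compactly supported functions. Bump functions vanishing on the
carrier show that its complement is null. An arbitrary f is then replaced by fχ with a cutoff χ
equal to 1 on the carrier. -/
theorem exists_measure (hι : ι ∈ imUnits) (Φ : SliceCalculus ι T) (u : H) :
    ∃ μ : Measure (sliceHalfPlane ι), IsFiniteMeasure μ ∧ μ Φ.carrierᶜ = 0 ∧
      ∀ f : C(sliceHalfPlane ι, ℝ), ∫ x, f x ∂μ = inner ℝ u (Φ.toHom f u) := by
  have := locallyCompactSpace_sliceHalfPlane hι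
  let μ := RealRMK.rieszMeasure (Φ.functional u)
  have hK : μ Φ.carrierᶜ = 0 := by
    rw [Φ.isCompact.isClosed.isOpen_compl.measure_eq_iSup_isCompact]
    simp only [ENNReal.iSup_eq_zero]
    intro K hKsub hK
    obtain ⟨f, hf1, hf0, hfc, hf⟩ := exists_continuous_one_zero_of_isCompact hK
      Φ.isCompact.isClosed (Set.subset_compl_iff_disjoint_right.1 hKsub)
    have h := RealRMK.rieszMeasure_le_of_eq_one (Φ.functional u)
      (f := ⟨f, hfc⟩) (fun x => (hf x).1) hK hf1
    have h0 : Φ.functional u ⟨f, hfc⟩ = 0 := by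
      change inner ℝ u (Φ.toHom f u) = 0
      rw [Φ.map_eq_zero hf0]; simp
    rw [h0, ENNReal.ofReal_zero] at h
    exact le_antisymm h zero_le
  refine ⟨μ, ⟨?_⟩, hK, fun f => ?_⟩
  · rw [← Set.union_compl_self Φ.carrier]
    refine (measure_union_le _ _).trans_lt ?_
    rw [hK, add_zero]
    exact Φ.isCompact.measure_lt_top
  · obtain ⟨χ, hχ1, -, hχc, -⟩ := exists_continuous_one_zero_of_isCompact Φ.isCompact
      isClosed_empty (Set.disjoint_empty _)
    have hc : HasCompactSupport (f * χ) := hχc.mul_left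
    have h1 := RealRMK.integral_rieszMeasure (Φ.functional u) ⟨f * χ, hc⟩
    have h2 : Φ.functional u ⟨f * χ, hc⟩ = inner ℝ u (Φ.toHom f u) := by
      change inner ℝ u (Φ.toHom (f * χ) u) = _
      have : Φ.toHom (f * χ - f) = 0 :=
        Φ.map_eq_zero fun x hx => by simp [hχ1 hx]
      rw [map_sub, sub_eq_zero] at this
      rw [this]
    rw [← h2, ← h1]
    refine integral_congr_ae ?_
    have : ∀ᵐ x ∂μ, x ∈ Φ.carrier := hK
    filter_upwards [this] with x hx
    simp [hχ1 hx]

/-- The spectral measure of a vector. -/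
def measure (hι : ι ∈ imUnits) (Φ : SliceCalculus ι T) (u : H) : Measure (sliceHalfPlane ι) :=
  Classical.choose (Φ.exists_measure hι u)

instance (hι : ι ∈ imUnits) (Φ : SliceCalculus ι T) (u : H) : IsFiniteMeasure (Φ.measure hι u) :=
  (Classical.choose_spec (Φ.exists_measure hι u)).1

theorem measure_compl_carrier (hι : ι ∈ imUnits) (Φ : SliceCalculus ι T) (u : H) :
    Φ.measure hι u Φ.carrierᶜ = 0 :=
  (Classical.choose_spec (Φ.exists_measure hι u)).2.1

theorem integral_measure (hι : ι ∈ imUnits) (Φ : SliceCalculus ι T) (u : H)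
    (f : C(sliceHalfPlane ι, ℝ)) :
    ∫ x, f x ∂Φ.measure hι u = inner ℝ u (Φ.toHom f u) :=
  (Classical.choose_spec (Φ.exists_measure hι u)).2.2 f

theorem measureReal_univ (hι : ι ∈ imUnits) (Φ : SliceCalculus ι T) (u : H) :
    (Φ.measure hι u).real Set.univ = ‖u‖ ^ 2 := by
  have h := Φ.integral_measure hι u 1
  rw [map_one, one_apply_eq_self, real_inner_self_eq_norm_sq] at h
  simpa using h

/-- The bilinear form `⟨u, P(E) v⟩`. -/
def form (hι : ι ∈ imUnits) (Φ : SliceCalculus ι T) (E : Set (sliceHalfPlane ι)) (u v : H) : ℝ :=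
  ((Φ.measure hι (u + v)).real E - (Φ.measure hι u).real E - (Φ.measure hι v).real E) / 2

theorem inner_map_comm (Φ : SliceCalculus ι T) (f : C(sliceHalfPlane ι, ℝ)) (u v : H) :
    inner ℝ v (Φ.toHom f u) = inner ℝ u (Φ.toHom f v) := by
  rw [← Φ.symm, real_inner_comm]

theorem inner_map_add_self (Φ : SliceCalculus ι T) (f : C(sliceHalfPlane ι, ℝ)) (u v : H) :
    inner ℝ (u + v) (Φ.toHom f (u + v)) =
      inner ℝ u (Φ.toHom f u) + inner ℝ v (Φ.toHom f v) + 2 * inner ℝ u (Φ.toHom f v) := by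
  rw [map_add, inner_add_left, inner_add_right, inner_add_right, Φ.inner_map_comm f u v]
  ring

/-- Linear relations between the forms `⟨u, f(T) v⟩` carry over to the forms `⟨u, P(E) v⟩`. -/
theorem sum_mul_form_eq_zero (hι : ι ∈ imUnits) (Φ : SliceCalculus ι T) {κ : Type*} [Fintype κ]
    (c : κ → ℝ) (u v : κ → H) (h : ∀ f, ∑ i, c i * inner ℝ (u i) (Φ.toHom f (v i)) = 0)
    (E : Set (sliceHalfPlane ι)) : ∑ i, c i * Φ.form hι E (u i) (v i) = 0 := by
  -- Each form is a combination of the measures of u + v, u and v with weights 1/2, -1/2, -1/2, so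
  -- the index set is tripled.
  have key := sum_mul_measureReal_eq_zero (κ := κ ⊕ κ ⊕ κ)
    (Sum.elim (fun i => c i / 2) (Sum.elim (fun i => -(c i / 2)) fun i => -(c i / 2)))
    (fun x => Φ.measure hι ((Sum.elim (fun i => u i + v i) (Sum.elim u v) : κ ⊕ κ ⊕ κ → H) x))
    (fun f => ?_) E
  · rw [← key]
    simp only [Fintype.sum_sum_type, Sum.elim_inl, Sum.elim_inr, ← Finset.sum_add_distrib, form]
    exact Finset.sum_congr rfl fun i _ => by ring
  · have hf : ∀ w, ∫ x, f x ∂Φ.measure hι w = inner ℝ w (Φ.toHom f.toContinuousMap w) :=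
      fun w => Φ.integral_measure hι w f.toContinuousMap
    simp only [Fintype.sum_sum_type, Sum.elim_inl, Sum.elim_inr, ← Finset.sum_add_distrib, hf]
    rw [← h f.toContinuousMap]
    refine Finset.sum_congr rfl fun i _ => ?_
    rw [Φ.inner_map_add_self]
    ring

theorem form_add_left (hι : ι ∈ imUnits) (Φ : SliceCalculus ι T) (E : Set (sliceHalfPlane ι))
    (u u' v : H) : Φ.form hι E (u + u') v = Φ.form hι E u v + Φ.form hι E u' v := by
  have := Φ.sum_mul_form_eq_zero hι ![1, -1, -1] ![u + u', u, u'] ![v, v, v] (fun f => by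
    simp [Fin.sum_univ_succ, inner_add_left]
    ring) E
  simp [Fin.sum_univ_succ] at this
  linarith

theorem form_comm (hι : ι ∈ imUnits) (Φ : SliceCalculus ι T) (E : Set (sliceHalfPlane ι))
    (u v : H) : Φ.form hι E u v = Φ.form hι E v u := by
  rw [form, form, add_comm u v]; ring

theorem form_smul_left (hι : ι ∈ imUnits) (Φ : SliceCalculus ι T) (E : Set (sliceHalfPlane ι))
    (c : ℝ) (u v : H) : Φ.form hι E (c • u) v = c * Φ.form hι E u v := by
  have := Φ.sum_mul_form_eq_zero hι ![1, -c] ![c • u, u] ![v, v] (fun f => by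
    simp [Fin.sum_univ_succ, real_inner_smul_left]) E
  simp [Fin.sum_univ_succ] at this
  linarith

/-- Applied to right multiplications by p and p̄ this makes P(E) ℍ-linear. Applied to an operator
commuting with the calculus it gives commutation with P(E). -/
theorem form_adjoint (hι : ι ∈ imUnits) (Φ : SliceCalculus ι T) (E : Set (sliceHalfPlane ι))
    {S S' : H → H} (h : ∀ f u v, inner ℝ (S u) (Φ.toHom f v) = inner ℝ u (Φ.toHom f (S' v)))
    (u v : H) : Φ.form hι E (S u) v = Φ.form hι E u (S' v) := by
  have := Φ.sum_mul_form_eq_zero hι ![1, -1] ![S u, u] ![v, S' v] (fun f => by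
    simp [Fin.sum_univ_succ, h]) E
  simp [Fin.sum_univ_succ] at this
  linarith

theorem measureReal_le (hι : ι ∈ imUnits) (Φ : SliceCalculus ι T) (E : Set (sliceHalfPlane ι))
    (u : H) : (Φ.measure hι u).real E ≤ ‖u‖ ^ 2 := by
  rw [← Φ.measureReal_univ hι]
  exact measureReal_mono (Set.subset_univ E)

/-- Reduces to μ_{u+u} = 4μ_u, whence the weights 1 and -4. -/
theorem form_self (hι : ι ∈ imUnits) (Φ : SliceCalculus ι T) (E : Set (sliceHalfPlane ι))
    (u : H) : Φ.form hι E u u = (Φ.measure hι u).real E := by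
  have key := sum_mul_measureReal_eq_zero ![1, -4] (fun i => Φ.measure hι (![u + u, u] i))
    (fun f => ?_) E
  · simp [Fin.sum_univ_succ] at key
    rw [form]
    linarith
  · have hf : ∀ w, ∫ x, f x ∂Φ.measure hι w = inner ℝ w (Φ.toHom f.toContinuousMap w) :=
      fun w => Φ.integral_measure hι w f.toContinuousMap
    simp only [hf]
    simp only [Fin.sum_univ_succ, Matrix.cons_val_zero, Φ.inner_map_add_self]
    simp
    ring

/-- For unit vectors the three masses are at most 4, 1 and 1; homogeneity gives the general case.
The constant 3 is crude, as only boundedness of the form matters. -/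
theorem abs_form_le (hι : ι ∈ imUnits) (Φ : SliceCalculus ι T) (E : Set (sliceHalfPlane ι))
    (u v : H) : |Φ.form hι E u v| ≤ 3 * ‖u‖ * ‖v‖ := by
  have h0 : ∀ w, Φ.form hι E 0 w = 0 := fun w => by
    have := Φ.form_smul_left hι E 0 0 w
    simpa using this
  by_cases hu : u = 0
  · simp [hu, h0]
  by_cases hv : v = 0
  · rw [form_comm]; simp [hv, h0]
  have hunit : ∀ x y : H, ‖x‖ = 1 → ‖y‖ = 1 → |Φ.form hι E x y| ≤ 3 := fun x y hx hy => by
    have h1 := Φ.measureReal_le hι E (x + y)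
    have h2 := Φ.measureReal_le hι E x
    have h3 := Φ.measureReal_le hι E y
    have h4 := norm_add_le x y
    have h5 : ‖x + y‖ ^ 2 ≤ 4 := by
      rw [hx, hy] at h4
      nlinarith [norm_nonneg (x + y)]
    have p1 : 0 ≤ (Φ.measure hι (x + y)).real E := measureReal_nonneg
    have p2 : 0 ≤ (Φ.measure hι x).real E := measureReal_nonneg
    have p3 : 0 ≤ (Φ.measure hι y).real E := measureReal_nonneg
    rw [hx] at h2
    rw [hy] at h3
    rw [form, abs_le]
    constructor <;> linarith
  have hu' := norm_pos_iff.2 hu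
  have hv' := norm_pos_iff.2 hv
  have h := hunit (‖u‖⁻¹ • u) (‖v‖⁻¹ • v)
    (by rw [norm_smul, norm_inv, norm_norm, inv_mul_cancel₀ hu'.ne'])
    (by rw [norm_smul, norm_inv, norm_norm, inv_mul_cancel₀ hv'.ne'])
  rw [form_smul_left, form_comm, form_smul_left, form_comm, abs_mul, abs_mul,
    abs_of_pos (inv_pos.2 hu'), abs_of_pos (inv_pos.2 hv'), ← mul_assoc, ← mul_inv,
    inv_mul_le_iff₀ (by positivity)] at h
  linarith

/-- Fréchet–Riesz for the real scalar product represents the bounded form. The real adjoint of right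
multiplication by p is right multiplication by p̄, and this yields ℍ-linearity. -/
theorem exists_proj (hι : ι ∈ imUnits) (Φ : SliceCalculus ι T) (E : Set (sliceHalfPlane ι)) :
    ∃ S : H →L[ℍᵐᵒᵖ] H, ∀ u v, inner ℝ (S u) v = Φ.form hι E u v := by
  let B : H → StrongDual ℝ H := fun u => LinearMap.mkContinuous
    { toFun := fun v => Φ.form hι E u v
      map_add' := fun v v' => by
        rw [form_comm, form_add_left, form_comm, Φ.form_comm hι E v' u]
      map_smul' := fun c v => by
        rw [form_comm, form_smul_left, form_comm]; rfl } (3 * ‖u‖)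
    (fun v => Φ.abs_form_le hι E u v)
  let S : H → H := fun u => (InnerProductSpace.toDual ℝ H).symm (B u)
  have hS : ∀ u v, inner ℝ (S u) v = Φ.form hι E u v := fun u v =>
    InnerProductSpace.toDual_symm_apply
  have hadd : ∀ u v, S (u + v) = S u + S v := fun u v =>
    ext_inner_right ℝ fun w => by rw [inner_add_left, hS, hS, hS, form_add_left]
  refine ⟨{ toFun := S
            map_add' := hadd
            map_smul' := fun p u => ?_
            cont := AddMonoidHomClass.continuous_of_bound (AddMonoidHom.mk' S hadd) 3
              fun u => ?_ }, hS⟩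
  · obtain ⟨p, rfl⟩ := op_surjective p
    have hadj : ∀ x y : H, inner ℝ (op p • x) y = inner ℝ x (op (star p) • y) := fun x y => by
      rw [real_inner_def, real_inner_def, qinner_smul_left, qinner_smul_right]
      simp only [Quaternion.re_mul]
      simp
      ring
    refine ext_inner_right ℝ fun w => ?_
    rw [RingHom.id_apply, hadj, hS, hS]
    refine Φ.form_adjoint hι E (S := fun x => op p • x) (S' := fun x => op (star p) • x)
      (fun f x y => ?_) u w
    rw [hadj, Φ.map_op_smul hι]
  · change ‖(InnerProductSpace.toDual ℝ H).symm (B u)‖ ≤ 3 * ‖u‖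
    rw [LinearIsometryEquiv.norm_map]
    exact LinearMap.mkContinuous_norm_le _ (by positivity) _

/-- The spectral projection of a set. -/
def proj (hι : ι ∈ imUnits) (Φ : SliceCalculus ι T) (E : Set (sliceHalfPlane ι)) :
    H →L[ℍᵐᵒᵖ] H :=
  Classical.choose (Φ.exists_proj hι E)

theorem inner_proj (hι : ι ∈ imUnits) (Φ : SliceCalculus ι T) (E : Set (sliceHalfPlane ι))
    (u v : H) : inner ℝ (Φ.proj hι E u) v = Φ.form hι E u v :=
  Classical.choose_spec (Φ.exists_proj hι E) u v

theorem inner_proj_comm (hι : ι ∈ imUnits) (Φ : SliceCalculus ι T) (E : Set (sliceHalfPlane ι))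
    (u v : H) : inner ℝ (Φ.proj hι E u) v = inner ℝ u (Φ.proj hι E v) := by
  rw [real_inner_comm _ u, inner_proj, inner_proj, form_comm]

theorem inner_proj_self (hι : ι ∈ imUnits) (Φ : SliceCalculus ι T) (E : Set (sliceHalfPlane ι))
    (u : H) : inner ℝ (Φ.proj hι E u) u = (Φ.measure hι u).real E := by
  rw [inner_proj, form_self]

/-- An operator that commutes with the calculus, and has an adjoint, commutes with the spectral
projections. -/
theorem proj_commute (hι : ι ∈ imUnits) (Φ : SliceCalculus ι T) (E : Set (sliceHalfPlane ι))
    {S S' : H → H} (hS : ∀ u v, inner ℝ (S u) v = inner ℝ u (S' v))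
    (h : ∀ f u, S' (Φ.toHom f u) = Φ.toHom f (S' u)) (u : H) :
    Φ.proj hι E (S u) = S (Φ.proj hι E u) :=
  ext_inner_right ℝ fun w => by
    rw [hS, inner_proj, inner_proj]
    exact Φ.form_adjoint hι E (fun f x y => by rw [hS, h]) u w

end SliceCalculus

end SpectralMeasure

/-! ### Scalar measures of a projection-valued measure -/

section QPVMBasic

variable {ι : ℍ} {H : Type*} [NormedAddCommGroup H] [Module ℍᵐᵒᵖ H] [QuaternionicInner H]

attribute [local instance] complexInnerSpace InnerProductSpace.complexToReal

namespace QPVM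

variable (P : QPVM ι H) {E F : Set (sliceHalfPlane ι)}

/-- The constant sequence ∅ is pairwise disjoint, and a summable constant sequence is zero. -/
theorem map_empty : P ∅ = 0 := by
  ext u
  have h := (P.map_iUnion (fun _ => ∅) (fun _ => MeasurableSet.empty)
    (fun _ _ _ => disjoint_bot_left) u).summable
  exact (summable_const_iff _).1 h

theorem map_inter_apply (hE : MeasurableSet E) (hF : MeasurableSet F) (u : H) :
    P E (P F u) = P (E ∩ F) u := by
  rw [← P.map_inter E F hE hF, mul_apply_eq_comp]

theorem map_idem (hE : MeasurableSet E) (u : H) : P E (P E u) = P E u := by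
  rw [P.map_inter_apply hE hE, Set.inter_self]

theorem map_union (hE : MeasurableSet E) (hF : MeasurableSet F) (h : Disjoint E F) :
    P (E ∪ F) = P E + P F := by
  refine ContinuousLinearMap.ext fun u => ?_
  let G : ℕ → Set (sliceHalfPlane ι) := fun n => if n = 0 then E else if n = 1 then F else ∅
  have hG : ∀ n, MeasurableSet (G n) := fun n => by
    simp only [G]
    split_ifs <;> simp [hE, hF]
  have hd : Pairwise fun m n => Disjoint (G m) (G n) := fun m n hmn => by
    simp only [G]
    split_ifs <;> simp_all [h.symm]
  have hU : ⋃ n, G n = E ∪ F := by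
    ext x
    simp only [G, Set.mem_iUnion, Set.mem_union]
    constructor
    · rintro ⟨n, hn⟩
      split_ifs at hn
      · exact Or.inl hn
      · exact Or.inr hn
      · exact hn.elim
    · rintro (hx | hx)
      · exact ⟨0, by simpa using hx⟩
      · exact ⟨1, by simpa using hx⟩
  have h1 := P.map_iUnion G hG hd u
  rw [hU] at h1
  have h2 : HasSum (fun n => P (G n) u) _ := hasSum_sum_of_ne_finset_zero
    (f := fun n => P (G n) u) (s := Finset.range 2)
    fun n hn => by
      have : 1 < n := by simpa using hn
      simp [G, show n ≠ 0 by lia, show n ≠ 1 by lia, P.map_empty]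
  rw [h1.unique h2]
  simp [Finset.sum_range_succ, G]

theorem map_compl (hE : MeasurableSet E) : P Eᶜ = 1 - P E := by
  rw [eq_sub_iff_add_eq', ← P.map_union hE hE.compl disjoint_compl_right, Set.union_compl_self,
    P.map_univ]

theorem isClosed_supp : IsClosed P.supp :=
  (isOpen_sUnion fun _ hO => hO.1).isClosed_compl

variable [CompleteSpace H]

theorem symm (hE : MeasurableSet E) (u v : H) : qinner (P E u) v = qinner u (P E v) := by
  conv_lhs => rw [← (P.nonneg E hE).qadjoint_eq]
  rw [qinner_qadjoint]

theorem qinner_apply_self (hE : MeasurableSet E) (u : H) :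
    qinner u (P E u) = ((‖P E u‖ ^ 2 : ℝ) : ℍ) := by
  rw [← qinner_self, P.symm hE, P.map_idem hE]

theorem inner_symm (hE : MeasurableSet E) (u v : H) :
    inner ℝ (P E u) v = inner ℝ u (P E v) := by
  rw [real_inner_def, P.symm hE, real_inner_def]

theorem inner_apply_self (hE : MeasurableSet E) (u : H) : inner ℝ u (P E u) = ‖P E u‖ ^ 2 := by
  rw [real_inner_def, P.qinner_apply_self hE, Quaternion.re_coe]

theorem hasSum_norm_sq {G : ℕ → Set (sliceHalfPlane ι)} (hG : ∀ n, MeasurableSet (G n))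
    (hd : Pairwise fun m n => Disjoint (G m) (G n)) (u : H) :
    HasSum (fun n => ‖P (G n) u‖ ^ 2) (‖P (⋃ n, G n) u‖ ^ 2) := by
  have h := (P.map_iUnion G hG hd u).mapL (innerSL ℝ u)
  simp only [innerSL_apply_apply, P.inner_apply_self (hG _),
    P.inner_apply_self (MeasurableSet.iUnion hG)] at h
  exact h

/-- The measure `E ↦ ⟨u|P(E) u⟩`. -/
def measure (u : H) : Measure (sliceHalfPlane ι) :=
  Measure.ofMeasurable (fun E _ => ENNReal.ofReal (‖P E u‖ ^ 2)) (by simp [P.map_empty])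
    fun G hG hd => by
      rw [← (P.hasSum_norm_sq hG hd u).tsum_eq,
        ENNReal.ofReal_tsum_of_nonneg (fun _ => sq_nonneg _) (P.hasSum_norm_sq hG hd u).summable]

theorem measure_apply (hE : MeasurableSet E) (u : H) :
    P.measure u E = ENNReal.ofReal (‖P E u‖ ^ 2) :=
  Measure.ofMeasurable_apply E hE

theorem measureReal_apply (hE : MeasurableSet E) (u : H) :
    (P.measure u).real E = ‖P E u‖ ^ 2 := by
  rw [measureReal_def, P.measure_apply hE, ENNReal.toReal_ofReal (sq_nonneg _)]

instance (u : H) : IsFiniteMeasure (P.measure u) :=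
  ⟨by rw [P.measure_apply MeasurableSet.univ]; exact ENNReal.ofReal_lt_top⟩

theorem measureReal_univ (u : H) : (P.measure u).real Set.univ = ‖u‖ ^ 2 := by
  rw [P.measureReal_apply MeasurableSet.univ, P.map_univ, one_apply_eq_self]

theorem measure_eq_zero_iff (hE : MeasurableSet E) (u : H) : P.measure u E = 0 ↔ P E u = 0 := by
  rw [P.measure_apply hE, ENNReal.ofReal_eq_zero]
  constructor
  · intro h
    exact norm_eq_zero.1 (pow_eq_zero_iff two_ne_zero |>.1 (le_antisymm h (sq_nonneg _)))
  · intro h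
    simp [h]

/-- The union of null open sets may be uncountable; second countability reduces it to a countable
one, where the scalar measures apply. -/
theorem map_compl_supp : P P.suppᶜ = 0 := by
  ext u
  rw [zero_apply, ← P.measure_eq_zero_iff P.isClosed_supp.measurableSet.compl]
  obtain ⟨S, hS, hSc, hSU⟩ := TopologicalSpace.isOpen_sUnion_countable
    {O : Set (sliceHalfPlane ι) | IsOpen O ∧ P O = 0} fun _ hO => hO.1
  rw [supp, compl_compl, ← hSU, measure_sUnion_null_iff hS]
  intro O hO
  rw [P.measure_eq_zero_iff (hSc hO).1.measurableSet, (hSc hO).2, zero_apply]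

theorem map_supp : P P.supp = 1 := by
  have := P.map_compl P.isClosed_supp.measurableSet
  rw [P.map_compl_supp] at this
  exact (sub_eq_zero.1 this.symm).symm

theorem ae_mem_supp (u : H) : ∀ᵐ x ∂P.measure u, x ∈ P.supp := by
  rw [ae_iff]
  exact (P.measure_eq_zero_iff P.isClosed_supp.measurableSet.compl u).2 (by
    rw [P.map_compl_supp, zero_apply])

theorem map_inter_supp (hE : MeasurableSet E) : P (E ∩ P.supp) = P E := by
  rw [← P.map_inter E _ hE P.isClosed_supp.measurableSet, P.map_supp, mul_one]

theorem ext_of_measure {P P' : QPVM ι H} (h : ∀ u, P.measure u = P'.measure u)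
    (hE : MeasurableSet E) : P E = P' E :=
  ext_of_qform fun u => by
    rw [P.qinner_apply_self hE, P'.qinner_apply_self hE, ← P.measureReal_apply hE,
      ← P'.measureReal_apply hE, h]

end QPVM

end QPVMBasic

/-! ### The projection-valued measure of a normal operator -/

section Spectral

variable {ι : ℍ} {H : Type*} [NormedAddCommGroup H] [Module ℍᵐᵒᵖ H] [QuaternionicInner H]

attribute [local instance] complexInnerSpace InnerProductSpace.complexToReal

/-- The real parts of ap for p = 1, i, j, k recover every coordinate of a. This upgrades symmetry
for the real scalar product to symmetry for the quaternionic one. -/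
theorem qinner_eq_of_inner_eq {x y : H} {S S' : H → H}
    (h : ∀ p : ℍ, inner ℝ x (op p • S y) = inner ℝ (S' x) (op p • y)) :
    qinner x (S y) = qinner (S' x) y := by
  have key : ∀ p : ℍ, (qinner x (S y) * p).re = (qinner (S' x) y * p).re := fun p => by
    rw [← qinner_smul_right, ← qinner_smul_right]
    exact h p
  simp only [Quaternion.re_mul] at key
  ext
  · simpa using key 1
  · simpa using key (⟨0, 1, 0, 0⟩ : ℍ[ℝ])
  · simpa using key (⟨0, 0, 1, 0⟩ : ℍ[ℝ])
  · simpa using key (⟨0, 0, 0, 1⟩ : ℍ[ℝ])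

namespace SliceCalculus

variable [CompleteSpace H] {T : H →L[ℍᵐᵒᵖ] H}

theorem qinner_proj_comm (hι : ι ∈ imUnits) (Φ : SliceCalculus ι T) (E : Set (sliceHalfPlane ι))
    (u v : H) : qinner u (Φ.proj hι E v) = qinner (Φ.proj hι E u) v :=
  qinner_eq_of_inner_eq fun p => by rw [← map_smul, inner_proj_comm]

theorem exists_bound_carrier (Φ : SliceCalculus ι T) (f : C(sliceHalfPlane ι, ℝ)) :
    ∃ c, 0 ≤ c ∧ ∀ x ∈ Φ.carrier, |f x| ≤ c := by
  obtain ⟨c, hc⟩ := Φ.isCompact.exists_bound_of_continuousOn f.continuous.continuousOn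
  exact ⟨max c 0, le_max_right _ _, fun x hx => (hc x hx).trans (le_max_left _ _)⟩

theorem ae_mem_carrier (hι : ι ∈ imUnits) (Φ : SliceCalculus ι T) (u : H) :
    ∀ᵐ x ∂Φ.measure hι u, x ∈ Φ.carrier :=
  Φ.measure_compl_carrier hι u

theorem integrable_measure (hι : ι ∈ imUnits) (Φ : SliceCalculus ι T) (u : H)
    (f : C(sliceHalfPlane ι, ℝ)) : Integrable f (Φ.measure hι u) := by
  obtain ⟨c, -, hc⟩ := Φ.exists_bound_carrier f
  refine Integrable.of_bound f.continuous.aestronglyMeasurable c ?_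
  filter_upwards [Φ.ae_mem_carrier hι u] with x hx using hc x hx

/-- The measure of Φ(f)u is f²μ_u, because ⟨Φ(f)u, Φ(g)Φ(f)u⟩ = ⟨u, Φ(f²g)u⟩. -/
theorem measureReal_map (hι : ι ∈ imUnits) (Φ : SliceCalculus ι T) (u : H)
    (f : C(sliceHalfPlane ι, ℝ)) {E : Set (sliceHalfPlane ι)} (hE : MeasurableSet E) :
    (Φ.measure hι (Φ.toHom f u)).real E = ∫ x in E, f x * f x ∂Φ.measure hι u := by
  set d : sliceHalfPlane ι → NNReal := fun x => (f x * f x).toNNReal with hd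
  have hdc : ∀ x, (d x : ℝ) = f x * f x := fun x => Real.coe_toNNReal _ (mul_self_nonneg _)
  have hdm : Measurable d := (f.continuous.mul f.continuous).measurable.real_toNNReal
  have hfin : IsFiniteMeasure ((Φ.measure hι u).withDensity fun x => (d x : ENNReal)) :=
    isFiniteMeasure_withDensity_ofReal (Φ.integrable_measure hι u (f * f)).2
  have h : Φ.measure hι (Φ.toHom f u) = (Φ.measure hι u).withDensity fun x => (d x : ENNReal) := by
    refine ext_of_forall_integral_eq_of_IsFiniteMeasure fun g => ?_
    rw [integral_withDensity_eq_integral_smul hdm]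
    have h1 := Φ.integral_measure hι (Φ.toHom f u) g.toContinuousMap
    have h2 := Φ.integral_measure hι u (f * f * g.toContinuousMap)
    rw [Φ.symm, ← mul_apply_eq_comp, ← mul_apply_eq_comp, ← map_mul, ← map_mul] at h1
    have h3 : f * g.toContinuousMap * f = f * f * g.toContinuousMap := by ring
    rw [h3, ← h2] at h1
    refine h1.trans (integral_congr_ae (Eventually.of_forall fun x => ?_))
    simp only [NNReal.smul_def, hdc, smul_eq_mul]
    rfl
  have h1 : ∫ _x in E, (1 : ℝ) ∂Φ.measure hι (Φ.toHom f u) =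
      (Φ.measure hι (Φ.toHom f u)).real E := by simp
  rw [← h1, h, setIntegral_withDensity_eq_setIntegral_smul hdm _ hE]
  refine setIntegral_congr_fun hE fun x _ => ?_
  simp only [NNReal.smul_def, hdc, smul_eq_mul, mul_one]

theorem proj_map_comm (hι : ι ∈ imUnits) (Φ : SliceCalculus ι T) (E : Set (sliceHalfPlane ι))
    (f : C(sliceHalfPlane ι, ℝ)) (u : H) :
    Φ.proj hι E (Φ.toHom f u) = Φ.toHom f (Φ.proj hι E u) :=
  Φ.proj_commute hι E (S := Φ.toHom f) (Φ.symm f) (fun g u => by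
    rw [← mul_apply_eq_comp, ← mul_apply_eq_comp, ← map_mul, ← map_mul, mul_comm]) u

/-- For g = f² this is the density formula for Φ(f)u, since P(E) commutes with Φ(f). Adding a
constant that bounds |g| on the carrier makes any g a square there. -/
theorem inner_proj_map (hι : ι ∈ imUnits) (Φ : SliceCalculus ι T) (u : H)
    (g : C(sliceHalfPlane ι, ℝ)) {E : Set (sliceHalfPlane ι)} (hE : MeasurableSet E) :
    inner ℝ (Φ.proj hι E u) (Φ.toHom g u) = ∫ x in E, g x ∂Φ.measure hι u := by
  obtain ⟨c, hc0, hc⟩ := Φ.exists_bound_carrier g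
  let f : C(sliceHalfPlane ι, ℝ) := ⟨fun x => √(g x + c), (g.continuous.add continuous_const).sqrt⟩
  have hf : ∀ x ∈ Φ.carrier, f x * f x = g x + c := fun x hx =>
    Real.mul_self_sqrt (by linarith [(abs_le.1 (hc x hx)).1])
  have h1 : Φ.toHom g = Φ.toHom f * Φ.toHom f - algebraMap ℝ _ c := by
    have : Φ.toHom (g - (f * f - algebraMap ℝ _ c)) = 0 := Φ.map_eq_zero fun x hx => by
      have := hf x hx
      simp only [ContinuousMap.sub_apply, ContinuousMap.mul_apply, _root_.algebraMap_apply,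
        smul_eq_mul, mul_one]
      linarith
    rw [map_sub, map_sub, map_mul, AlgHom.commutes] at this
    exact sub_eq_zero.1 this
  have h2 : inner ℝ (Φ.proj hι E u) (Φ.toHom f (Φ.toHom f u)) =
      ∫ x in E, f x * f x ∂Φ.measure hι u := by
    rw [← Φ.measureReal_map hι u f hE, ← inner_proj_self, proj_map_comm, Φ.symm]
  have h3 : ∫ x in E, f x * f x ∂Φ.measure hι u =
      ∫ x in E, g x ∂Φ.measure hι u + c * (Φ.measure hι u).real E := by
    have : ∫ x in E, f x * f x ∂Φ.measure hι u = ∫ x in E, (g x + c) ∂Φ.measure hι u := by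
      refine integral_congr_ae (ae_restrict_of_ae ?_)
      filter_upwards [Φ.ae_mem_carrier hι u] with x hx using hf x hx
    rw [this, integral_add (Φ.integrable_measure hι u g).integrableOn (integrable_const c)]
    simp [mul_comm]
  rw [h1, sub_apply, inner_sub_right, mul_apply_eq_comp, h2, h3, Algebra.algebraMap_eq_smul_one,
    smul_apply, one_apply_eq_self, real_inner_smul_right, inner_proj_self]
  ring

theorem proj_comm (hι : ι ∈ imUnits) (Φ : SliceCalculus ι T) (E F : Set (sliceHalfPlane ι))
    (u : H) : Φ.proj hι E (Φ.proj hι F u) = Φ.proj hι F (Φ.proj hι E u) :=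
  Φ.proj_commute hι E (S := Φ.proj hι F) (Φ.inner_proj_comm hι F)
    (fun f u => Φ.proj_map_comm hι F f u) u

/-- With w = P(E)u, `inner_proj_map` says that the polarised measure of the pair (w, u) has the same
integrals as μ_u restricted to E. The four indices are this restriction and the measures of w + u, w
and u. -/
theorem inner_proj_proj_self (hι : ι ∈ imUnits) (Φ : SliceCalculus ι T)
    {E F : Set (sliceHalfPlane ι)} (hE : MeasurableSet E) (hF : MeasurableSet F) (u : H) :
    inner ℝ (Φ.proj hι F (Φ.proj hι E u)) u = (Φ.measure hι u).real (F ∩ E) := by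
  set w := Φ.proj hι E u with hw
  have hfin : ∀ i : Option (Fin 3), IsFiniteMeasure
      (i.elim ((Φ.measure hι u).restrict E) fun i => Φ.measure hι (![w + u, w, u] i)) := by
    rintro (_ | i) <;> dsimp only [Option.elim] <;> infer_instance
  have key := sum_mul_measureReal_eq_zero (κ := Option (Fin 3))
    (fun i => i.elim (-1) ![1 / 2, -1 / 2, -1 / 2])
    (fun i => i.elim ((Φ.measure hι u).restrict E) fun i => Φ.measure hι (![w + u, w, u] i))
    ?_ F
  · rw [inner_proj, form]
    simp [Fin.sum_univ_succ, measureReal_restrict_apply hF] at key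
    linarith
  · intro f
    have hf : ∀ w, ∫ x, f x ∂Φ.measure hι w = inner ℝ w (Φ.toHom f.toContinuousMap w) :=
      fun w => Φ.integral_measure hι w f.toContinuousMap
    have hfE : ∫ x in E, f x ∂Φ.measure hι u = inner ℝ w (Φ.toHom f.toContinuousMap u) :=
      (Φ.inner_proj_map hι u f.toContinuousMap hE).symm
    simp only [Fintype.sum_option, Option.elim, hf, hfE]
    simp only [Fin.sum_univ_succ, Matrix.cons_val_zero, Φ.inner_map_add_self]
    simp
    ring

theorem proj_mul (hι : ι ∈ imUnits) (Φ : SliceCalculus ι T) {E F : Set (sliceHalfPlane ι)}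
    (hE : MeasurableSet E) (hF : MeasurableSet F) :
    Φ.proj hι E * Φ.proj hι F = Φ.proj hι (E ∩ F) := by
  have hsym : ∀ S : H →L[ℍᵐᵒᵖ] H, (∀ u v, qinner u (S v) = qinner (S u) v) →
      ∀ u, qinner u (S u) = ((inner ℝ (S u) u : ℝ) : ℍ) := fun S hS u => by
    have h : star (qinner u (S u)) = qinner u (S u) := by rw [star_qinner, hS]
    rw [real_inner_def, ← hS]
    exact quaternion_coe_re h
  refine ext_of_qform fun u => ?_
  rw [hsym _ (fun u v => Φ.qinner_proj_comm hι _ u v), inner_proj_self, hsym]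
  · rw [mul_apply_eq_comp, Φ.inner_proj_proj_self hι hF hE]
  · intro u v
    rw [mul_apply_eq_comp, mul_apply_eq_comp, qinner_proj_comm, qinner_proj_comm, proj_comm]

theorem norm_proj_sq (hι : ι ∈ imUnits) (Φ : SliceCalculus ι T) {E : Set (sliceHalfPlane ι)}
    (hE : MeasurableSet E) (u : H) : ‖Φ.proj hι E u‖ ^ 2 = (Φ.measure hι u).real E := by
  have h := Φ.inner_proj_proj_self hι hE hE u
  rw [inner_proj_comm, real_inner_self_eq_norm_sq, Set.inter_self] at h
  exact h

theorem proj_union (hι : ι ∈ imUnits) (Φ : SliceCalculus ι T) {E F : Set (sliceHalfPlane ι)}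
    (hF : MeasurableSet F) (h : Disjoint E F) :
    Φ.proj hι (E ∪ F) = Φ.proj hι E + Φ.proj hι F := by
  ext u
  refine ext_inner_right ℝ fun v => ?_
  rw [add_apply, inner_add_left, inner_proj, inner_proj, inner_proj, form, form, form,
    measureReal_union h hF, measureReal_union h hF, measureReal_union h hF]
  ring

theorem proj_empty (hι : ι ∈ imUnits) (Φ : SliceCalculus ι T) : Φ.proj hι ∅ = 0 := by
  ext u
  refine ext_inner_right ℝ fun v => ?_
  rw [inner_proj, form]; simp

theorem sum_proj (hι : ι ∈ imUnits) (Φ : SliceCalculus ι T) {G : ℕ → Set (sliceHalfPlane ι)}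
    (hG : ∀ n, MeasurableSet (G n)) (hd : Pairwise fun m n => Disjoint (G m) (G n))
    (s : Finset ℕ) : ∑ n ∈ s, Φ.proj hι (G n) = Φ.proj hι (⋃ n ∈ s, G n) := by
  induction s using Finset.induction_on with
  | empty => simp [proj_empty]
  | insert a s ha ih =>
    rw [Finset.sum_insert ha, ih, Finset.set_biUnion_insert, proj_union]
    · exact Finset.measurableSet_biUnion _ fun n _ => hG n
    · simp only [Set.disjoint_iUnion_right]
      intro n hn
      exact hd fun h => ha (h ▸ hn)

/-- The remainder after a finite partial sum is P of the remaining set applied to u. Its squared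
norm is the μ_u-mass of that set, which tends to 0. -/
theorem hasSum_proj (hι : ι ∈ imUnits) (Φ : SliceCalculus ι T) (G : ℕ → Set (sliceHalfPlane ι))
    (hG : ∀ n, MeasurableSet (G n)) (hd : Pairwise fun m n => Disjoint (G m) (G n)) (u : H) :
    HasSum (fun n => Φ.proj hι (G n) u) (Φ.proj hι (⋃ n, G n) u) := by
  have hm : HasSum (fun n => (Φ.measure hι u).real (G n)) ((Φ.measure hι u).real (⋃ n, G n)) := by
    have hs := measure_iUnion hd hG (μ := Φ.measure hι u)
    have := ENNReal.hasSum_toReal (f := fun n => Φ.measure hι u (G n)) (by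
      rw [← hs]; exact measure_ne_top _ _)
    rwa [← ENNReal.tsum_toReal_eq fun n => measure_ne_top _ _, ← hs] at this
  have key : ∀ s : Finset ℕ, ‖∑ n ∈ s, Φ.proj hι (G n) u - Φ.proj hι (⋃ n, G n) u‖ ^ 2 =
      (Φ.measure hι u).real (⋃ n, G n) - ∑ n ∈ s, (Φ.measure hι u).real (G n) := fun s => by
    have hms : MeasurableSet (⋃ n ∈ s, G n) := Finset.measurableSet_biUnion _ fun n _ => hG n
    have hU : (⋃ n, G n) = (⋃ n, G n) \ (⋃ n ∈ s, G n) ∪ ⋃ n ∈ s, G n :=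
      (Set.sdiff_union_of_subset (Set.iUnion₂_subset fun n _ => Set.subset_iUnion G n)).symm
    have hdis : Disjoint ((⋃ n, G n) \ ⋃ n ∈ s, G n) (⋃ n ∈ s, G n) := Set.disjoint_sdiff_left
    have h1 : ∑ n ∈ s, Φ.proj hι (G n) u = Φ.proj hι (⋃ n ∈ s, G n) u := by
      rw [← Φ.sum_proj hι hG hd]; simp
    have h2 : ∑ n ∈ s, (Φ.measure hι u).real (G n) = (Φ.measure hι u).real (⋃ n ∈ s, G n) :=
      (measureReal_biUnion_finset (fun i _ j _ hij => hd hij) fun n _ => hG n).symm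
    have h3 : Φ.proj hι (⋃ n, G n) u =
        Φ.proj hι ((⋃ n, G n) \ ⋃ n ∈ s, G n) u + Φ.proj hι (⋃ n ∈ s, G n) u := by
      conv_lhs => rw [hU]
      rw [Φ.proj_union hι hms hdis, add_apply]
    have h4 : (Φ.measure hι u).real (⋃ n, G n) =
        (Φ.measure hι u).real ((⋃ n, G n) \ ⋃ n ∈ s, G n) +
          (Φ.measure hι u).real (⋃ n ∈ s, G n) := by
      conv_lhs => rw [hU]
      rw [measureReal_union hdis hms (measure_ne_top _ _) (measure_ne_top _ _)]
    rw [h1, h2, h3, h4, sub_add_cancel_right, norm_neg,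
      Φ.norm_proj_sq hι ((MeasurableSet.iUnion hG).diff hms)]
    ring
  rw [HasSum, SummationFilter.unconditional_filter, tendsto_iff_norm_sub_tendsto_zero]
  have h0 : Tendsto (fun s : Finset ℕ => (Φ.measure hι u).real (⋃ n, G n) -
      ∑ n ∈ s, (Φ.measure hι u).real (G n)) atTop (𝓝 0) := by
    have := (tendsto_const_nhds (x := (Φ.measure hι u).real (⋃ n, G n))).sub hm
    simpa using this
  have h1 := h0.sqrt
  simp only [← key, Real.sqrt_sq (norm_nonneg _), Real.sqrt_zero] at h1
  exact h1

/-- The projection-valued measure of a normal operator. -/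
def qpvm (hι : ι ∈ imUnits) (Φ : SliceCalculus ι T) : QPVM ι H where
  toFun := Φ.proj hι
  map_univ := by
    refine ext_of_qform fun u => ?_
    have h := Φ.norm_proj_sq hι MeasurableSet.univ u
    have h2 : qinner u (Φ.proj hι Set.univ u) =
        ((‖Φ.proj hι Set.univ u‖ ^ 2 : ℝ) : ℍ) := by
      rw [← qinner_self, ← qinner_proj_comm, ← mul_apply_eq_comp (Φ.proj hι Set.univ),
        Φ.proj_mul hι MeasurableSet.univ MeasurableSet.univ, Set.inter_self]
    rw [h2, h, measureReal_univ, one_apply_eq_self, qinner_self]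
  map_inter := fun E F hE hF => Φ.proj_mul hι hE hF
  map_iUnion := Φ.hasSum_proj hι
  nonneg := fun E hE u => ⟨‖Φ.proj hι E u‖ ^ 2, sq_nonneg _, by
    rw [← qinner_self, ← qinner_proj_comm, ← mul_apply_eq_comp (Φ.proj hι E),
        Φ.proj_mul hι hE hE, Set.inter_self]⟩

theorem measure_qpvm (hι : ι ∈ imUnits) (Φ : SliceCalculus ι T) (u : H) :
    (Φ.qpvm hι).measure u = Φ.measure hι u := by
  ext E hE
  rw [QPVM.measure_apply _ hE]
  change ENNReal.ofReal (‖Φ.proj hι E u‖ ^ 2) = _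
  rw [Φ.norm_proj_sq hι hE, ofReal_measureReal]

end SliceCalculus

end Spectral

/-! ### Integrals of simple functions -/

section SimpleIntegral

variable {ι : ℍ} {H : Type*} [NormedAddCommGroup H] [Module ℍᵐᵒᵖ H] [QuaternionicInner H]

attribute [local instance] complexInnerSpace InnerProductSpace.complexToReal

instance : Nonempty (sliceHalfPlane ι) := ⟨hpMk ι 0 0⟩

theorem QPVM.map_preimage_finset (P : QPVM ι H) {α : Type*} (t : SimpleFunc (sliceHalfPlane ι) α)
    (s : Finset α) : P (t ⁻¹' (s : Set α)) = ∑ a ∈ s, P (t ⁻¹' {a}) := by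
  classical
  induction s using Finset.induction_on with
  | empty => simp [P.map_empty]
  | insert a s ha ih =>
    rw [Finset.sum_insert ha, ← ih, Finset.coe_insert, Set.insert_eq, Set.preimage_union,
      P.map_union (t.measurableSet_preimage _) (t.measurableSet_preimage _)]
    refine Disjoint.preimage _ ?_
    simpa using ha

/-- Lets sums and products of s and t be computed over the common fibres of the pair (s, t). -/
theorem simpleIntegral_map (P : QPVM ι H) (L : ℍ → H →L[ℍᵐᵒᵖ] H) {α : Type*}
    (t : SimpleFunc (sliceHalfPlane ι) α) (g : α → ℍ) :
    simpleIntegral P L (t.map g) = ∑ a ∈ t.range, L (g a) * P (t ⁻¹' {a}) := by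
  classical
  rw [simpleIntegral, SimpleFunc.range_map,
    ← Finset.sum_fiberwise_of_maps_to (t := t.range.image g) (g := g)
      fun a ha => Finset.mem_image_of_mem g ha]
  refine Finset.sum_congr rfl fun q _ => ?_
  rw [SimpleFunc.map_preimage_singleton, P.map_preimage_finset, Finset.mul_sum]
  refine Finset.sum_congr (Finset.filter_congr fun _ _ => Iff.rfl) fun a ha => ?_
  rw [(Finset.mem_filter.1 ha).2]

namespace IsIQPVM

variable {P : QPVM ι H} {L : ℍ → H →L[ℍᵐᵒᵖ] H}

theorem simpleIntegral_add (h : IsIQPVM P L) (s t : SimpleFunc (sliceHalfPlane ι) ℍ) :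
    simpleIntegral P L (s + t) = simpleIntegral P L s + simpleIntegral P L t := by
  have h1 := simpleIntegral_map P L (s.pair t) Prod.fst
  have h2 := simpleIntegral_map P L (s.pair t) Prod.snd
  have h3 := simpleIntegral_map P L (s.pair t) fun x => x.1 + x.2
  rw [SimpleFunc.map_fst_pair] at h1
  rw [SimpleFunc.map_snd_pair] at h2
  rw [h1, h2, ← Finset.sum_add_distrib]
  refine h3.trans (Finset.sum_congr rfl fun a _ => ?_)
  rw [h.leftMul.map_add, add_mul]

theorem simpleIntegral_neg (h : IsIQPVM P L) (s : SimpleFunc (sliceHalfPlane ι) ℍ) :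
    simpleIntegral P L (-s) = -simpleIntegral P L s := by
  rw [show -s = s.map fun q => -q from rfl, simpleIntegral_map, simpleIntegral,
    ← Finset.sum_neg_distrib]
  exact Finset.sum_congr rfl fun a _ => by rw [h.leftMul.map_neg]; rfl

theorem simpleIntegral_sub (h : IsIQPVM P L) (s t : SimpleFunc (sliceHalfPlane ι) ℍ) :
    simpleIntegral P L (s - t) = simpleIntegral P L s - simpleIntegral P L t := by
  rw [sub_eq_add_neg, sub_eq_add_neg, h.simpleIntegral_add, h.simpleIntegral_neg]

/-- Since P(E) commutes with L, the product of two terms contains P of an intersection of fibres, so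
only the diagonal survives. -/
theorem simpleIntegral_mul (h : IsIQPVM P L) (s t : SimpleFunc (sliceHalfPlane ι) ℍ) :
    simpleIntegral P L (s * t) = simpleIntegral P L s * simpleIntegral P L t := by
  have h1 := simpleIntegral_map P L (s.pair t) Prod.fst
  have h2 := simpleIntegral_map P L (s.pair t) Prod.snd
  have h3 := simpleIntegral_map P L (s.pair t) fun x => x.1 * x.2
  rw [SimpleFunc.map_fst_pair] at h1
  rw [SimpleFunc.map_snd_pair] at h2
  rw [h1, h2, Finset.sum_mul]
  refine h3.trans (Finset.sum_congr rfl fun a ha => ?_)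
  rw [Finset.mul_sum, Finset.sum_eq_single_of_mem a ha]
  · rw [mul_assoc (L a.1), ← mul_assoc (P _), h.commute _ ((s.pair t).measurableSet_preimage _),
      mul_assoc (L a.2), P.map_inter _ _ ((s.pair t).measurableSet_preimage _)
        ((s.pair t).measurableSet_preimage _), Set.inter_self, h.leftMul.map_mul, mul_assoc]
  · intro b _ hb
    rw [mul_assoc (L a.1), ← mul_assoc (P _), h.commute _ ((s.pair t).measurableSet_preimage _),
      mul_assoc (L b.2), P.map_inter _ _ ((s.pair t).measurableSet_preimage _)
        ((s.pair t).measurableSet_preimage _), ← Set.preimage_inter,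
      Set.singleton_inter_eq_empty.2 (by simpa using hb.symm), Set.preimage_empty, P.map_empty,
      mul_zero, mul_zero]

theorem _root_.simpleIntegral_const (P : QPVM ι H) (L : ℍ → H →L[ℍᵐᵒᵖ] H) (q : ℍ) :
    simpleIntegral P L (SimpleFunc.const _ q) = L q := by
  rw [simpleIntegral, SimpleFunc.range_const, Finset.sum_singleton]
  have : (SimpleFunc.const (sliceHalfPlane ι) q) ⁻¹' {q} = Set.univ := by
    ext x; simp
  rw [this, P.map_univ, mul_one]

variable [CompleteSpace H]

theorem qadjoint_simpleIntegral (h : IsIQPVM P L) (s : SimpleFunc (sliceHalfPlane ι) ℍ) :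
    qadjoint (simpleIntegral P L s) = simpleIntegral P L (s.map star) := by
  rw [simpleIntegral_map, simpleIntegral]
  have := map_sum (AddMonoidHom.mk' (qadjoint : (H →L[ℍᵐᵒᵖ] H) → _) qadjoint_add)
    (fun q => L q * P (s ⁻¹' {q})) s.range
  refine this.trans (Finset.sum_congr rfl fun q _ => ?_)
  change qadjoint (L q * P (s ⁻¹' {q})) = _
  rw [qadjoint_mul, h.leftMul.qadjoint_apply, (P.nonneg _ (s.measurableSet_preimage _)).qadjoint_eq,
    h.commute _ (s.measurableSet_preimage _)]

/-- Because L_q* = L_{q̄}, the imaginary part of q contributes nothing to the real quadratic form.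
-/
theorem inner_leftMul_proj (h : IsIQPVM P L) (q : ℍ) {E : Set (sliceHalfPlane ι)}
    (hE : MeasurableSet E) (u : H) : inner ℝ u (L q (P E u)) = q.re * ‖P E u‖ ^ 2 := by
  have h1 : ∀ w : H, inner ℝ w (L q w) = q.re * ‖w‖ ^ 2 := fun w => by
    have e1 : inner ℝ w (L (star q) w) = inner ℝ w (L q w) := by
      rw [← h.leftMul.qadjoint_apply, real_inner_def, qinner_qadjoint_right, ← real_inner_def,
        real_inner_comm]
    have e2 : inner ℝ w (L (q + star q) w) = (2 * q.re) * ‖w‖ ^ 2 := by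
      rw [Quaternion.self_add_star', h.leftMul.map_coe, real_inner_smul_right,
        real_inner_self_eq_norm_sq]
    rw [h.leftMul.map_add, add_apply, inner_add_right, e1] at e2
    linarith
  rw [← h1, P.inner_symm hE]
  have : P E (L q (P E u)) = L q (P E u) := by
    rw [← mul_apply_eq_comp (P E), h.commute E hE, mul_apply_eq_comp, P.map_idem hE]
  rw [this]

theorem inner_simpleIntegral (h : IsIQPVM P L) (s : SimpleFunc (sliceHalfPlane ι) ℍ) (u : H) :
    inner ℝ u (simpleIntegral P L s u) = ∫ x, (s x).re ∂P.measure u := by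
  have hI : Integrable (s.map fun q => q.re) (P.measure u) :=
    SimpleFunc.integrable_of_isFiniteMeasure _
  have h1 : ∫ x, (s x).re ∂P.measure u = (s.map fun q => q.re).integral (P.measure u) := by
    rw [SimpleFunc.integral_eq_integral _ hI]; rfl
  have hI' : Integrable s (P.measure u) := SimpleFunc.integrable_of_isFiniteMeasure _
  rw [h1, SimpleFunc.map_integral _ _ hI' (by simp), simpleIntegral, sum_apply, inner_sum]
  refine Finset.sum_congr rfl fun q _ => ?_
  rw [mul_apply_eq_comp, h.inner_leftMul_proj q (s.measurableSet_preimage _),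
    P.measureReal_apply (s.measurableSet_preimage _), smul_eq_mul, mul_comm]

/-- The preceding formula applied to s̄s, whose integral is the adjoint of the integral of s times
that integral. -/
theorem norm_simpleIntegral_sq (h : IsIQPVM P L) (s : SimpleFunc (sliceHalfPlane ι) ℍ) (u : H) :
    ‖simpleIntegral P L s u‖ ^ 2 = ∫ x, ‖s x‖ ^ 2 ∂P.measure u := by
  have h1 := h.inner_simpleIntegral (s.map star * s) u
  rw [h.simpleIntegral_mul, mul_apply_eq_comp, ← h.qadjoint_simpleIntegral, real_inner_def,
    qinner_qadjoint_right, qinner_self, Quaternion.re_coe] at h1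
  rw [h1]
  refine integral_congr_ae (Eventually.of_forall fun x => ?_)
  simp only [SimpleFunc.coe_mul, SimpleFunc.coe_map, Pi.mul_apply, Function.comp_apply,
    Quaternion.star_mul_self, Quaternion.re_coe, Quaternion.normSq_eq_norm_mul_self, sq]

theorem norm_simpleIntegral_le (h : IsIQPVM P L) {s : SimpleFunc (sliceHalfPlane ι) ℍ} {c : ℝ}
    (hc : 0 ≤ c) (hs : ∀ x ∈ P.supp, ‖s x‖ ≤ c) (u : H) :
    ‖simpleIntegral P L s u‖ ≤ c * ‖u‖ := by
  refine (sq_le_sq₀ (norm_nonneg _) (by positivity)).1 ?_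
  rw [h.norm_simpleIntegral_sq, mul_pow, ← P.measureReal_univ]
  have hI : Integrable (s.map fun q => ‖q‖ ^ 2) (P.measure u) :=
    SimpleFunc.integrable_of_isFiniteMeasure _
  calc ∫ x, ‖s x‖ ^ 2 ∂P.measure u ≤ ∫ _x, c ^ 2 ∂P.measure u := by
        refine integral_mono_ae hI (integrable_const _) ?_
        filter_upwards [P.ae_mem_supp u] with x hx
        exact pow_le_pow_left₀ (norm_nonneg _) (hs x hx) 2
    _ = _ := by simp [mul_comm]

end IsIQPVM

/-! ### Integrals of bounded functions -/

/-- `S` is the integral of `ψ`, in terms of uniform approximation on the support. -/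
def IsSliceIntegral (P : QPVM ι H) (L : ℍ → H →L[ℍᵐᵒᵖ] H) (ψ : sliceHalfPlane ι → ℍ)
    (S : H →L[ℍᵐᵒᵖ] H) : Prop :=
  ∀ ε : ℝ, 0 < ε → ∃ s : SimpleFunc (sliceHalfPlane ι) ℍ,
    (∀ x ∈ P.supp, ‖s x - ψ x‖ ≤ ε) ∧ ∀ u, ‖simpleIntegral P L s u - S u‖ ≤ ε * ‖u‖

namespace IsSliceIntegral

variable {P : QPVM ι H} {L : ℍ → H →L[ℍᵐᵒᵖ] H} {ψ φ : sliceHalfPlane ι → ℍ}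
  {S R : H →L[ℍᵐᵒᵖ] H}

theorem exists_bound (hS : IsSliceIntegral P L ψ S) : ∃ C : ℝ, ∀ x ∈ P.supp, ‖ψ x‖ ≤ C := by
  obtain ⟨s, hs, -⟩ := hS 1 one_pos
  obtain ⟨C, hC⟩ := s.exists_forall_norm_le
  refine ⟨C + 1, fun x hx => ?_⟩
  have := norm_sub_norm_le (ψ x) (s x)
  rw [norm_sub_rev] at this
  linarith [hs x hx, hC x]

theorem congr (hS : IsSliceIntegral P L ψ S) (h : ∀ x ∈ P.supp, ψ x = φ x) :
    IsSliceIntegral P L φ S := fun ε hε => by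
  obtain ⟨s, h1, h2⟩ := hS ε hε
  exact ⟨s, fun x hx => by rw [← h x hx]; exact h1 x hx, h2⟩

theorem const (P : QPVM ι H) (L : ℍ → H →L[ℍᵐᵒᵖ] H) (q : ℍ) :
    IsSliceIntegral P L (fun _ => q) (L q) :=
  fun ε hε => ⟨SimpleFunc.const _ q, fun x _ => by simpa using hε.le, fun u => by
    rw [simpleIntegral_const, sub_self, norm_zero]; positivity⟩

theorem add (h : IsIQPVM P L) (hS : IsSliceIntegral P L ψ S) (hR : IsSliceIntegral P L φ R) :
    IsSliceIntegral P L (fun x => ψ x + φ x) (S + R) := fun ε hε => by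
  obtain ⟨s, h1, h2⟩ := hS (ε / 2) (by positivity)
  obtain ⟨t, h3, h4⟩ := hR (ε / 2) (by positivity)
  refine ⟨s + t, fun x hx => ?_, fun u => ?_⟩
  · rw [SimpleFunc.coe_add, Pi.add_apply, add_sub_add_comm]
    linarith [norm_add_le (s x - ψ x) (t x - φ x), h1 x hx, h3 x hx]
  · rw [h.simpleIntegral_add, add_apply, add_apply, add_sub_add_comm]
    linarith [norm_add_le (simpleIntegral P L s u - S u) (simpleIntegral P L t u - R u), h2 u, h4 u]

theorem neg (h : IsIQPVM P L) (hS : IsSliceIntegral P L ψ S) :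
    IsSliceIntegral P L (fun x => -ψ x) (-S) := fun ε hε => by
  obtain ⟨s, h1, h2⟩ := hS ε hε
  refine ⟨-s, fun x hx => ?_, fun u => ?_⟩
  · rw [SimpleFunc.coe_neg, Pi.neg_apply, ← neg_sub', norm_neg]
    exact h1 x hx
  · rw [h.simpleIntegral_neg, neg_apply, neg_apply, ← neg_sub', norm_neg]
    exact h2 u

theorem sub (h : IsIQPVM P L) (hS : IsSliceIntegral P L ψ S) (hR : IsSliceIntegral P L φ R) :
    IsSliceIntegral P L (fun x => ψ x - φ x) (S - R) := by
  simp only [sub_eq_add_neg]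
  exact hS.add h (hR.neg h)

theorem mul (h : IsIQPVM P L) (hS : IsSliceIntegral P L ψ S) (hR : IsSliceIntegral P L φ R) :
    IsSliceIntegral P L (fun x => ψ x * φ x) (S * R) := fun ε hε => by
  obtain ⟨C₁, hC₁⟩ := hS.exists_bound
  obtain ⟨C₂, hC₂⟩ := hR.exists_bound
  obtain ⟨C₃, hC₃, hSb⟩ := _root_.exists_bound S
  obtain ⟨C₄, hC₄, hRb⟩ := _root_.exists_bound R
  set M := max (max C₁ C₂) (max C₃ C₄) with hM
  have hM1 : C₁ ≤ M := (le_max_left _ _).trans (le_max_left _ _)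
  have hM2 : C₂ ≤ M := (le_max_right _ _).trans (le_max_left _ _)
  have hM3 : C₃ ≤ M := (le_max_left _ _).trans (le_max_right _ _)
  have hM4 : C₄ ≤ M := (le_max_right _ _).trans (le_max_right _ _)
  have hM0 : 0 < M := hC₃.trans_le hM3
  -- M bounds ψ, φ on the support and also S, R. The bound δ ≤ 1 gives the approximant of φ size at
  -- most M + 1, so both errors are at most δ(M + 1) + Mδ.
  set δ := min 1 (ε / (2 * M + 1)) with hδ
  have hδ0 : 0 < δ := lt_min one_pos (by positivity)
  have hδ1 : δ ≤ 1 := min_le_left _ _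
  have hδε : δ * (2 * M + 1) ≤ ε := (le_div_iff₀ (by positivity)).1 (min_le_right _ _)
  obtain ⟨s, h1, h2⟩ := hS δ hδ0
  obtain ⟨t, h3, h4⟩ := hR δ hδ0
  refine ⟨s * t, fun x hx => ?_, fun u => ?_⟩
  · have e : (s * t) x - ψ x * φ x = (s x - ψ x) * t x + ψ x * (t x - φ x) := by
      rw [SimpleFunc.coe_mul, Pi.mul_apply]; noncomm_ring
    have ht : ‖t x‖ ≤ M + 1 := by
      have := norm_sub_norm_le (t x) (φ x)
      linarith [h3 x hx, hC₂ x hx]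
    calc ‖(s * t) x - ψ x * φ x‖ ≤ ‖s x - ψ x‖ * ‖t x‖ + ‖ψ x‖ * ‖t x - φ x‖ := by
          rw [e, ← norm_mul, ← norm_mul]; exact norm_add_le _ _
      _ ≤ δ * (M + 1) + M * δ := by
          gcongr
          · exact h1 x hx
          · exact (hC₁ x hx).trans hM1
          · exact h3 x hx
      _ ≤ ε := by linarith
  · have e : simpleIntegral P L (s * t) u - (S * R) u =
        (simpleIntegral P L s (simpleIntegral P L t u) - S (simpleIntegral P L t u)) +
          S (simpleIntegral P L t u - R u) := by
      rw [h.simpleIntegral_mul, mul_apply_eq_comp, mul_apply_eq_comp, map_sub]; abel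
    have ht : ‖simpleIntegral P L t u‖ ≤ (M + 1) * ‖u‖ := by
      have e1 := norm_sub_norm_le (simpleIntegral P L t u) (R u)
      have e2 := h4 u
      have e3 := hRb u
      have e4 : C₄ * ‖u‖ ≤ M * ‖u‖ := by gcongr
      have e5 : δ * ‖u‖ ≤ 1 * ‖u‖ := by gcongr
      linarith
    rw [e]
    calc _ ≤ δ * ((M + 1) * ‖u‖) + M * (δ * ‖u‖) := by
          refine (norm_add_le _ _).trans (add_le_add ((h2 _).trans ?_) ((hSb _).trans ?_))
          · gcongr
          · gcongr
            exact h4 u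
      _ = δ * (2 * M + 1) * ‖u‖ := by ring
      _ ≤ ε * ‖u‖ := by gcongr

/-- Two ε-approximants differ by at most 2ε on the support, so their integrals do so in norm. This
converts pointwise identities on the support into operator identities. -/
theorem unique (h : IsIQPVM P L) [CompleteSpace H] (hS : IsSliceIntegral P L ψ S)
    (hR : IsSliceIntegral P L ψ R) : S = R := by
  ext u
  have hε : ∀ ε : ℝ, 0 < ε → ‖S u - R u‖ ≤ ε * (4 * ‖u‖) := fun ε hε => by
    obtain ⟨s, h1, h2⟩ := hS ε hε
    obtain ⟨t, h3, h4⟩ := hR ε hε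
    have h5 : ‖simpleIntegral P L (s - t) u‖ ≤ (2 * ε) * ‖u‖ :=
      h.norm_simpleIntegral_le (by positivity) (fun x hx => by
        have : (s - t) x = (s x - ψ x) - (t x - ψ x) := by
          rw [SimpleFunc.coe_sub, Pi.sub_apply]; abel
        rw [this]
        linarith [norm_sub_le (s x - ψ x) (t x - ψ x), h1 x hx, h3 x hx]) u
    have e : S u - R u = simpleIntegral P L (s - t) u - (simpleIntegral P L s u - S u) +
        (simpleIntegral P L t u - R u) := by
      rw [h.simpleIntegral_sub, sub_apply]; abel
    rw [e]
    refine (norm_add_le _ _).trans ?_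
    have := norm_sub_le (simpleIntegral P L (s - t) u) (simpleIntegral P L s u - S u)
    linarith [h2 u, h4 u]
  have h0 : ‖S u - R u‖ ≤ 0 := by
    refine le_of_forall_pos_le_add fun ε he => ?_
    refine (hε (ε / (4 * ‖u‖ + 1)) (by positivity)).trans ?_
    rw [zero_add, div_mul_eq_mul_div, div_le_iff₀ (by positivity)]
    nlinarith
  exact sub_eq_zero.1 (norm_le_zero_iff.1 h0)

variable [CompleteSpace H]

theorem _root_.norm_qadjoint_le {D : H →L[ℍᵐᵒᵖ] H} {c : ℝ} (hc : 0 ≤ c)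
    (hD : ∀ u, ‖D u‖ ≤ c * ‖u‖) (u : H) : ‖qadjoint D u‖ ≤ c * ‖u‖ := by
  have h1 : ‖qadjoint D u‖ ^ 2 = inner ℝ u (D (qadjoint D u)) := by
    rw [real_inner_def, ← qinner_qadjoint, qinner_self, Quaternion.re_coe]
  have h2 := real_inner_le_norm u (D (qadjoint D u))
  have h3 := hD (qadjoint D u)
  rcases (norm_nonneg (qadjoint D u)).eq_or_lt with h | h
  · rw [← h]; positivity
  · have h4 : ‖u‖ * ‖D (qadjoint D u)‖ ≤ ‖u‖ * (c * ‖qadjoint D u‖) := by gcongr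
    nlinarith

theorem qadjoint (h : IsIQPVM P L) (hS : IsSliceIntegral P L ψ S) :
    IsSliceIntegral P L (fun x => star (ψ x)) (qadjoint S) := fun ε hε => by
  obtain ⟨s, h1, h2⟩ := hS ε hε
  refine ⟨s.map star, fun x hx => ?_, fun u => ?_⟩
  · rw [SimpleFunc.map_apply, ← star_sub, Quaternion.norm_star]
    exact h1 x hx
  · rw [← h.qadjoint_simpleIntegral, ← sub_apply, ← qadjoint_sub]
    exact norm_qadjoint_le hε.le h2 u

theorem inner_eq (h : IsIQPVM P L) (hS : IsSliceIntegral P L ψ S) (hψ : Measurable ψ) (u : H) :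
    inner ℝ u (S u) = ∫ x, (ψ x).re ∂P.measure u := by
  obtain ⟨C, hC⟩ := hS.exists_bound
  have hre : ∀ q : ℍ, |q.re| ≤ ‖q‖ := fun q => by
    refine abs_le_of_sq_le_sq ?_ (norm_nonneg _)
    rw [sq ‖q‖, ← Quaternion.normSq_eq_norm_mul_self, Quaternion.normSq_def']
    nlinarith [sq_nonneg q.imI, sq_nonneg q.imJ, sq_nonneg q.imK]
  have hI : Integrable (fun x => (ψ x).re) (P.measure u) := by
    refine Integrable.of_bound
      (Quaternion.continuous_re.measurable.comp hψ).aestronglyMeasurable C ?_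
    filter_upwards [P.ae_mem_supp u] with x hx using (hre _).trans (hC x hx)
  have hε : ∀ ε : ℝ, 0 < ε → |inner ℝ u (S u) - ∫ x, (ψ x).re ∂P.measure u| ≤
      ε * (2 * ‖u‖ ^ 2) := fun ε hε => by
    obtain ⟨s, h1, h2⟩ := hS ε hε
    have hIs : Integrable (fun x => (s x).re) (P.measure u) :=
      (s.map fun q : ℍ => q.re).integrable_of_isFiniteMeasure
    have e1 : |inner ℝ u (simpleIntegral P L s u) - inner ℝ u (S u)| ≤ ε * ‖u‖ ^ 2 := by
      rw [← inner_sub_right]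
      refine (abs_real_inner_le_norm _ _).trans ?_
      have := mul_le_mul_of_nonneg_left (h2 u) (norm_nonneg u)
      nlinarith
    have e2 : |∫ x, (s x).re ∂P.measure u - ∫ x, (ψ x).re ∂P.measure u| ≤ ε * ‖u‖ ^ 2 := by
      rw [← integral_sub hIs hI, ← P.measureReal_univ]
      have hae : ∀ᵐ x ∂P.measure u, ‖(s x).re - (ψ x).re‖ ≤ ε := by
        filter_upwards [P.ae_mem_supp u] with x hx
        have := hre (s x - ψ x)
        rw [Quaternion.re_sub] at this
        exact this.trans (h1 x hx)
      exact norm_integral_le_of_norm_le_const hae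
    rw [h.inner_simpleIntegral, abs_sub_comm] at e1
    have := abs_sub_le (inner ℝ u (S u)) (∫ x, (s x).re ∂P.measure u) (∫ x, (ψ x).re ∂P.measure u)
    linarith
  have h0 : |inner ℝ u (S u) - ∫ x, (ψ x).re ∂P.measure u| ≤ 0 := by
    refine le_of_forall_pos_le_add fun ε he => ?_
    refine (hε (ε / (2 * ‖u‖ ^ 2 + 1)) (by positivity)).trans ?_
    rw [zero_add, div_mul_eq_mul_div, div_le_iff₀ (by positivity)]
    nlinarith
  exact sub_eq_zero.1 (abs_eq_zero.1 (le_antisymm h0 (abs_nonneg _)))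

/-- S*S is the integral of ψ̄ψ = |ψ|². The spectral properties are read off from this formula. -/
theorem norm_sq_eq (h : IsIQPVM P L) (hS : IsSliceIntegral P L ψ S) (hψ : Measurable ψ) (u : H) :
    ‖S u‖ ^ 2 = ∫ x, ‖ψ x‖ ^ 2 ∂P.measure u := by
  have h1 := ((hS.qadjoint h).mul h hS).inner_eq h
    ((continuous_star.measurable.comp hψ).mul hψ) u
  rw [mul_apply_eq_comp, real_inner_def, qinner_qadjoint_right, qinner_self,
    Quaternion.re_coe] at h1
  rw [h1]
  refine integral_congr_ae (Eventually.of_forall fun x => ?_)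
  simp only [Quaternion.star_mul_self, Quaternion.re_coe, Quaternion.normSq_eq_norm_mul_self, sq]

/-- The quadratic form of the integral of a real function. -/
theorem qinner_eq (h : IsIQPVM P L) {f : sliceHalfPlane ι → ℝ} (hf : Measurable f)
    (hS : IsSliceIntegral P L (fun x => (f x : ℍ)) S) (u : H) :
    qinner u (S u) = ((∫ x, f x ∂P.measure u : ℝ) : ℍ) := by
  have h1 : _root_.qadjoint S = S :=
    unique h ((hS.qadjoint h).congr fun x _ => Quaternion.star_coe (f x)) hS
  have h2 : star (qinner u (S u)) = qinner u (S u) := by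
    rw [star_qinner, ← qinner_qadjoint_right, h1]
  have h3 := hS.inner_eq h (Quaternion.continuous_coe.measurable.comp hf) u
  rw [real_inner_def] at h3
  rw [quaternion_coe_re h2, h3]
  simp

/-- Cutting approximants off outside the support gives global uniform convergence. Any other
convergent sequence is close to them on the support, which controls its integrals. -/
theorem hasIQIntegral (h : IsIQPVM P L) (hS : IsSliceIntegral P L ψ S) (hψ : Measurable ψ) :
    HasIQIntegral P L ψ S := by
  refine ⟨hS.exists_bound, hψ.indicator P.isClosed_supp.measurableSet, ?_, ?_⟩
  · choose s hs _ using fun n : ℕ => hS (1 / ((n : ℝ) + 1)) (by positivity)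
    refine ⟨fun n => (s n).restrict P.supp, ?_⟩
    rw [Metric.tendstoUniformly_iff]
    intro ε hε
    obtain ⟨n, hn⟩ := exists_nat_one_div_lt hε
    filter_upwards [eventually_ge_atTop n] with m hm x
    rw [dist_comm, dist_eq_norm, SimpleFunc.restrict_apply _ P.isClosed_supp.measurableSet]
    by_cases hx : x ∈ P.supp
    · rw [Set.indicator_of_mem hx, Set.indicator_of_mem hx]
      exact (hs m x hx).trans_lt ((Nat.one_div_le_one_div hm).trans_lt hn)
    · rw [Set.indicator_of_notMem hx, Set.indicator_of_notMem hx]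
      simpa using hε
  · intro s hs ε hε
    obtain ⟨t, h1, h2⟩ := hS (ε / 3) (by positivity)
    rw [Metric.tendstoUniformly_iff] at hs
    filter_upwards [hs (ε / 3) (by positivity)] with n hn u
    have h5 : ‖simpleIntegral P L (s n - t) u‖ ≤ (2 * (ε / 3)) * ‖u‖ :=
      h.norm_simpleIntegral_le (by positivity) (fun x hx => by
        have e : (s n - t) x = (s n x - ψ x) - (t x - ψ x) := by
          rw [SimpleFunc.coe_sub, Pi.sub_apply]; abel
        have hnx := hn x
        rw [Set.indicator_of_mem hx, dist_comm, dist_eq_norm] at hnx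
        rw [e]
        linarith [norm_sub_le (s n x - ψ x) (t x - ψ x), h1 x hx]) u
    have e : simpleIntegral P L (s n) u - S u =
        simpleIntegral P L (s n - t) u + (simpleIntegral P L t u - S u) := by
      rw [h.simpleIntegral_sub, sub_apply]; abel
    rw [e]
    linarith [norm_add_le (simpleIntegral P L (s n - t) u) (simpleIntegral P L t u - S u), h2 u]

end IsSliceIntegral

theorem HasIQIntegral.isSliceIntegral {P : QPVM ι H} {L : ℍ → H →L[ℍᵐᵒᵖ] H}
    {ψ : sliceHalfPlane ι → ℍ} {S : H →L[ℍᵐᵒᵖ] H} (hS : HasIQIntegral P L ψ S) :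
    IsSliceIntegral P L ψ S := fun ε hε => by
  obtain ⟨s, hs⟩ := hS.exists_approx
  have h1 := hS.tendsto s hs ε hε
  rw [Metric.tendstoUniformly_iff] at hs
  obtain ⟨n, hn1, hn2⟩ := (h1.and (hs ε hε)).exists
  refine ⟨s n, fun x hx => ?_, hn1⟩
  have := (hn2 x).le
  rwa [Set.indicator_of_mem hx, dist_comm, dist_eq_norm] at this

end SimpleIntegral

/-! ### The calculus as an integral, and uniqueness of the projection-valued measure -/

section CalculusIntegral

variable {ι : ℍ} {H : Type*} [NormedAddCommGroup H] [Module ℍᵐᵒᵖ H] [QuaternionicInner H]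

attribute [local instance] complexInnerSpace InnerProductSpace.complexToReal

/-- Round f down to a multiple of ε; setting f to 0 off K keeps the range finite. -/
theorem exists_simpleFunc_near {X : Type*} [TopologicalSpace X] [T2Space X] [MeasurableSpace X]
    [BorelSpace X] (f : C(X, ℝ)) {K : Set X} (hK : IsCompact K) {ε : ℝ} (hε : 0 < ε) :
    ∃ s : SimpleFunc X ℝ, ∀ x ∈ K, |s x - f x| ≤ ε := by
  obtain ⟨c, hc⟩ := hK.exists_bound_of_continuousOn f.continuous.continuousOn
  have hbd : ∀ x, |K.indicator f x| ≤ max c 0 := fun x => by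
    by_cases hx : x ∈ K
    · rw [Set.indicator_of_mem hx]; exact (hc x hx).trans (le_max_left _ _)
    · rw [Set.indicator_of_notMem hx, abs_zero]; exact le_max_right _ _
  let t : SimpleFunc X ℤ :=
    { toFun := fun x => ⌊K.indicator f x / ε⌋
      measurableSet_fiber' := fun n => by
        have : Measurable fun x => ⌊K.indicator f x / ε⌋ :=
          Int.measurable_floor.comp
            ((f.continuous.measurable.indicator hK.isClosed.measurableSet).div_const ε)
        exact this (measurableSet_singleton n)
      finite_range' := by
        refine (Set.finite_Icc ⌊-(max c 0) / ε⌋ ⌊max c 0 / ε⌋).subset ?_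
        rintro _ ⟨x, rfl⟩
        have := abs_le.1 (hbd x)
        exact ⟨Int.floor_mono (div_le_div_of_nonneg_right this.1 hε.le),
          Int.floor_mono (div_le_div_of_nonneg_right this.2 hε.le)⟩ }
  refine ⟨t.map fun n : ℤ => ε * (n : ℝ), fun x hx => ?_⟩
  have h1 : (t.map fun n : ℤ => ε * (n : ℝ)) x = ε * (⌊f x / ε⌋ : ℝ) := by
    change ε * ((⌊K.indicator f x / ε⌋ : ℤ) : ℝ) = _
    rw [Set.indicator_of_mem hx]
  have h2 := Int.floor_le (f x / ε)
  have h3 := Int.lt_floor_add_one (f x / ε)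
  have h4 : f x = ε * (f x / ε) := by field_simp
  rw [h1, abs_le]
  constructor <;> nlinarith

namespace SliceCalculus

variable [CompleteSpace H] {T : H →L[ℍᵐᵒᵖ] H}

/-- The calculus with values in the quaternionic operators. -/
def qop (hι : ι ∈ imUnits) (Φ : SliceCalculus ι T) (f : C(sliceHalfPlane ι, ℝ)) :
    H →L[ℍᵐᵒᵖ] H :=
  { toFun := Φ.toHom f
    map_add' := map_add _
    map_smul' := fun p u => by
      obtain ⟨p, rfl⟩ := op_surjective p
      exact Φ.map_op_smul hι f p u
    cont := (Φ.toHom f).continuous }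

@[simp] theorem qop_apply (hι : ι ∈ imUnits) (Φ : SliceCalculus ι T) (f : C(sliceHalfPlane ι, ℝ))
    (u : H) : Φ.qop hι f u = Φ.toHom f u := rfl

theorem qinner_qop (hι : ι ∈ imUnits) (Φ : SliceCalculus ι T) (f : C(sliceHalfPlane ι, ℝ))
    (u v : H) : qinner u (Φ.qop hι f v) = qinner (Φ.qop hι f u) v :=
  qinner_eq_of_inner_eq fun p => by
    rw [← map_smul, qop_apply, qop_apply, Φ.symm]

theorem supp_qpvm_subset (hι : ι ∈ imUnits) (Φ : SliceCalculus ι T) :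
    (Φ.qpvm hι).supp ⊆ Φ.carrier := by
  intro x hx
  by_contra hxK
  refine hx ⟨Φ.carrierᶜ, ⟨Φ.isCompact.isClosed.isOpen_compl, ?_⟩, hxK⟩
  refine ContinuousLinearMap.ext fun u => ?_
  rw [zero_apply, ← QPVM.measure_eq_zero_iff _ Φ.isCompact.isClosed.measurableSet.compl,
    measure_qpvm,
    measure_compl_carrier]

theorem integral_simpleFunc_mul (hι : ι ∈ imUnits) (Φ : SliceCalculus ι T)
    (f : C(sliceHalfPlane ι, ℝ)) (s : SimpleFunc (sliceHalfPlane ι) ℝ) (u : H) :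
    ∑ a ∈ s.range, a * ∫ x in s ⁻¹' {a}, f x ∂Φ.measure hι u =
      ∫ x, s x * f x ∂Φ.measure hι u := by
  have h1 : ∀ x, s x * f x = ∑ a ∈ s.range, (s ⁻¹' {a}).indicator (fun x => a * f x) x :=
    fun x => by
      rw [Finset.sum_eq_single_of_mem (s x) (s.mem_range_self x)]
      · rw [Set.indicator_of_mem (by simp)]
      · intro b _ hb
        exact Set.indicator_of_notMem (by simpa using hb.symm) _
  simp only [h1]
  rw [integral_finsetSum]
  · refine Finset.sum_congr rfl fun a _ => ?_
    rw [integral_indicator (s.measurableSet_preimage _), integral_const_mul]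
  · intro a _
    exact ((Φ.integrable_measure hι u f).const_mul a).indicator (s.measurableSet_preimage _)

/-- The functional calculus is integration with respect to the projection-valued measure. -/
theorem isSliceIntegral_qop (hι : ι ∈ imUnits) (Φ : SliceCalculus ι T)
    {L : ℍ → H →L[ℍᵐᵒᵖ] H} (h : IsIQPVM (Φ.qpvm hι) L) (f : C(sliceHalfPlane ι, ℝ)) :
    IsSliceIntegral (Φ.qpvm hι) L (fun x => (f x : ℍ)) (Φ.qop hι f) := by
  intro ε hε
  obtain ⟨s, hs⟩ := exists_simpleFunc_near f Φ.isCompact hε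
  refine ⟨s.map fun r : ℝ => (r : ℍ), fun x hx => ?_, fun u => ?_⟩
  · rw [SimpleFunc.map_apply, ← Quaternion.coe_sub, Quaternion.norm_coe]
    exact hs x (Φ.supp_qpvm_subset hι hx)
  set I := simpleIntegral (Φ.qpvm hι) L (s.map fun r : ℝ => (r : ℍ)) with hI
  -- The three terms of ‖Iu - Φ(f)u‖² are integrals against μ_u, the mixed one by `inner_proj_map`.
  -- Together they form ∫(s - f)² dμ_u.
  have e1 : ‖I u‖ ^ 2 = ∫ x, s x * s x ∂Φ.measure hι u := by
    rw [hI, h.norm_simpleIntegral_sq, measure_qpvm]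
    refine integral_congr_ae (Eventually.of_forall fun x => ?_)
    simp only [SimpleFunc.coe_map, Function.comp_apply, Quaternion.norm_coe, Real.norm_eq_abs,
      sq_abs, ← sq]
  have e2 : ‖Φ.toHom f u‖ ^ 2 = ∫ x, f x * f x ∂Φ.measure hι u := by
    have := Φ.integral_measure hι u (f * f)
    rw [map_mul, mul_apply_eq_comp, ← Φ.symm, real_inner_self_eq_norm_sq] at this
    exact this.symm
  have e3 : inner ℝ (I u) (Φ.toHom f u) = ∫ x, s x * f x ∂Φ.measure hι u := by
    rw [← Φ.integral_simpleFunc_mul hι, hI, simpleIntegral_map, sum_apply, sum_inner]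
    refine Finset.sum_congr rfl fun a _ => ?_
    rw [mul_apply_eq_comp, h.leftMul.map_coe, real_inner_smul_left]
    congr 1
    exact Φ.inner_proj_map hι u f (s.measurableSet_preimage _)
  have i1 : Integrable (fun x => s x * s x) (Φ.measure hι u) :=
    (s.map fun r => r * r).integrable_of_isFiniteMeasure
  have i2 : Integrable (fun x => f x * f x) (Φ.measure hι u) :=
    Φ.integrable_measure hι u (f * f)
  obtain ⟨c, hc⟩ := s.exists_forall_norm_le
  have i3 : Integrable (fun x => s x * f x) (Φ.measure hι u) :=
    (Φ.integrable_measure hι u f).bdd_mul s.measurable.aestronglyMeasurable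
      (Eventually.of_forall hc)
  have e4 : ‖I u - Φ.toHom f u‖ ^ 2 = ∫ x, (s x - f x) ^ 2 ∂Φ.measure hι u := by
    rw [norm_sub_sq_real, e1, e2, e3, ← integral_const_mul, ← integral_sub i1 (i3.const_mul 2),
      ← integral_add (f := fun x => s x * s x - 2 * (s x * f x)) (i1.sub (i3.const_mul 2)) i2]
    refine integral_congr_ae (Eventually.of_forall fun x => ?_)
    simp only
    ring
  refine (sq_le_sq₀ (norm_nonneg _) (by positivity)).1 ?_
  change ‖I u - Φ.toHom f u‖ ^ 2 ≤ _
  rw [e4, mul_pow, ← Φ.measureReal_univ hι]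
  have hae : ∀ᵐ x ∂Φ.measure hι u, ‖(s x - f x) ^ 2‖ ≤ ε ^ 2 := by
    filter_upwards [Φ.ae_mem_carrier hι u] with x hx
    rw [norm_pow]
    exact pow_le_pow_left₀ (norm_nonneg _) (hs x hx) 2
  exact (le_abs_self _).trans (norm_integral_le_of_norm_le_const hae)

theorem qop_twoRe (hι : ι ∈ imUnits) (Φ : SliceCalculus ι T) :
    Φ.qop hι (twoRe ι) = T + qadjoint T :=
  ContinuousLinearMap.ext fun u => DFunLike.congr_fun Φ.map_twoRe u

theorem qop_twoIm_sq (hι : ι ∈ imUnits) (Φ : SliceCalculus ι T) :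
    Φ.qop hι (twoIm ι) * Φ.qop hι (twoIm ι) = -((T - qadjoint T) * (T - qadjoint T)) := by
  refine ContinuousLinearMap.ext fun u => ?_
  have := DFunLike.congr_fun Φ.map_twoIm_sq u
  rw [map_mul] at this
  exact this

end SliceCalculus

end CalculusIntegral

/-! ### Functions on the half-plane -/

section HalfPlaneFunctions

variable {ι : ℍ}

theorem coe_add_star (z : sliceHalfPlane ι) :
    (z : ℍ) + star (z : ℍ) = (twoRe ι z : ℍ) := by
  rw [Quaternion.self_add_star']; rfl

theorem star_coe_hp (hι : ι ∈ imUnits) (z : sliceHalfPlane ι) :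
    star (z : ℍ) = (hpRe z : ℍ) - ι * (hpIm z : ℍ) := by
  rw [coe_eq_hpRe_add hι z, star_add, star_mul, Quaternion.star_coe, Quaternion.star_coe,
    star_of_mem_imUnits hι, mul_neg, Quaternion.coe_commutes, ← sub_eq_add_neg]

theorem coe_sub_star (hι : ι ∈ imUnits) (z : sliceHalfPlane ι) :
    (z : ℍ) - star (z : ℍ) = ι * (twoIm ι z : ℍ) := by
  have h : twoIm ι z = hpIm z + hpIm z := two_mul (hpIm z)
  rw [h, star_coe_hp hι, coe_eq_hpRe_add hι z, Quaternion.coe_add, mul_add]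
  abel

theorem commute_coe (hι : ι ∈ imUnits) (z : sliceHalfPlane ι) : ι * (z : ℍ) = z * ι := by
  rw [coe_eq_hpRe_add hι z, mul_add, add_mul, ← Quaternion.coe_commutes, mul_assoc,
    Quaternion.coe_commutes (hpIm z)]

theorem anticommute_coe (hι : ι ∈ imUnits) {j : ℍ} (hj : ι * j = -(j * ι))
    (z : sliceHalfPlane ι) : j * (z : ℍ) = star (z : ℍ) * j := by
  have : j * ι = -(ι * j) := by rw [hj, neg_neg]
  rw [star_coe_hp hι, coe_eq_hpRe_add hι z, mul_add, sub_mul, ← mul_assoc, this, neg_mul,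
    mul_assoc ι j, mul_assoc ι _ j, Quaternion.coe_commutes (hpRe z),
    Quaternion.coe_commutes (hpIm z), sub_eq_add_neg]

end HalfPlaneFunctions

/-! ### Uniqueness of the scalar measures of a representing pair -/

section Uniqueness

variable {ι : ℍ} {H : Type*} [NormedAddCommGroup H] [Module ℍᵐᵒᵖ H] [QuaternionicInner H]
  [CompleteSpace H] {T : H →L[ℍᵐᵒᵖ] H} {P : QPVM ι H} {L : ℍ → H →L[ℍᵐᵒᵖ] H}

attribute [local instance] complexInnerSpace InnerProductSpace.complexToReal

theorem measurable_coe_hp : Measurable fun z : sliceHalfPlane ι => (z : ℍ) := measurable_subtype_coe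

theorem IsSliceIntegral.add_qadjoint (h : IsIQPVM P L)
    (hT : IsSliceIntegral P L (fun z => (z : ℍ)) T) :
    IsSliceIntegral P L (fun z => (twoRe ι z : ℍ)) (T + _root_.qadjoint T) :=
  (hT.add h (hT.qadjoint h)).congr fun z _ => coe_add_star z

/-- On the half-plane z - z̄ = ι·2β, so -ι(z - z̄) = 2β. -/
theorem IsSliceIntegral.neg_leftMul_mul (h : IsIQPVM P L) (hι : ι ∈ imUnits)
    (hT : IsSliceIntegral P L (fun z => (z : ℍ)) T) :
    IsSliceIntegral P L (fun z => (twoIm ι z : ℍ)) (-(L ι * (T - _root_.qadjoint T))) :=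
  (((IsSliceIntegral.const P L ι).mul h (hT.sub h (hT.qadjoint h))).neg h).congr fun z _ => by
    rw [coe_sub_star hι, ← mul_assoc, show ι * ι = -1 from hι, neg_mul, one_mul, neg_neg]

theorem IsSliceIntegral.neg_sq (h : IsIQPVM P L) (hι : ι ∈ imUnits)
    (hT : IsSliceIntegral P L (fun z => (z : ℍ)) T) :
    IsSliceIntegral P L (fun z => ((twoIm ι * twoIm ι) z : ℍ))
      (-((T - _root_.qadjoint T) * (T - _root_.qadjoint T))) := by
  have hD := hT.sub h (hT.qadjoint h)
  refine ((hD.mul h hD).neg h).congr fun z _ => ?_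
  rw [coe_sub_star hι, mul_assoc ι, ← mul_assoc _ ι, Quaternion.coe_commutes, mul_assoc ι,
    ← mul_assoc ι ι, show ι * ι = -1 from hι, neg_mul, one_mul, neg_neg, ContinuousMap.mul_apply,
    Quaternion.coe_mul]

theorem isCompact_setOf_norm_le (hι : ι ∈ imUnits) (R : ℝ) :
    IsCompact {z : sliceHalfPlane ι | ‖(z : ℍ)‖ ≤ R} := by
  have : ProperSpace ℍ := FiniteDimensional.proper_real ℍ
  have h1 : IsCompact (Metric.closedBall (0 : ℍ) R) := isCompact_closedBall 0 R
  have h2 := (isClosed_sliceHalfPlane hι).isClosedEmbedding_subtypeVal.isCompact_preimage h1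
  convert h2 using 1
  ext z
  simp

/-- Every projection-valued measure representing `T` has the scalar measures of the calculus. -/
theorem IsSliceIntegral.measure_eq (h : IsIQPVM P L) (hι : ι ∈ imUnits) (Φ : SliceCalculus ι T)
    (hT : IsSliceIntegral P L (fun z => (z : ℍ)) T) (u : H) :
    P.measure u = Φ.measure hι u := by
  -- The functions whose integral against (P, L) is given by the calculus. Integrals of members
  -- agree for both measures, and Stone–Weierstrass extends this to all f.
  let A : Subalgebra ℝ C(sliceHalfPlane ι, ℝ) :=
    { carrier := {g | IsSliceIntegral P L (fun z => (g z : ℍ)) (Φ.qop hι g)}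
      mul_mem' := fun {f g} hf hg => by
        have hq : Φ.qop hι (f * g) = Φ.qop hι f * Φ.qop hι g :=
          ContinuousLinearMap.ext fun u => DFunLike.congr_fun (map_mul Φ.toHom f g) u
        change IsSliceIntegral P L _ (Φ.qop hι (f * g))
        rw [hq]
        exact (IsSliceIntegral.mul h hf hg).congr fun z _ => by
          rw [ContinuousMap.mul_apply, Quaternion.coe_mul]
      add_mem' := fun {f g} hf hg => by
        have hq : Φ.qop hι (f + g) = Φ.qop hι f + Φ.qop hι g :=
          ContinuousLinearMap.ext fun u => DFunLike.congr_fun (map_add Φ.toHom f g) u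
        change IsSliceIntegral P L _ (Φ.qop hι (f + g))
        rw [hq]
        exact (IsSliceIntegral.add h hf hg).congr fun z _ => by
          rw [ContinuousMap.add_apply, Quaternion.coe_add]
      algebraMap_mem' := fun r => by
        have hq : Φ.qop hι (algebraMap ℝ _ r) = L (r : ℍ) :=
          ContinuousLinearMap.ext fun u => by
            rw [h.leftMul.map_coe, SliceCalculus.qop_apply, AlgHom.commutes]; rfl
        change IsSliceIntegral P L _ (Φ.qop hι (algebraMap ℝ _ r))
        rw [hq]
        exact (IsSliceIntegral.const P L (r : ℍ)).congr fun z _ => by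
          rw [_root_.algebraMap_apply, smul_eq_mul, mul_one] }
  have hA : A.SeparatesPoints := by
    refine SliceCalculus.separatesPoints hι ?_ ?_
    · change IsSliceIntegral P L _ (Φ.qop hι (twoRe ι))
      rw [Φ.qop_twoRe]
      exact hT.add_qadjoint h
    · change IsSliceIntegral P L _ (Φ.qop hι (twoIm ι * twoIm ι))
      have hq : Φ.qop hι (twoIm ι * twoIm ι) =
          -((T - _root_.qadjoint T) * (T - _root_.qadjoint T)) :=
        ContinuousLinearMap.ext fun u => DFunLike.congr_fun Φ.map_twoIm_sq u
      rw [hq]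
      exact hT.neg_sq h hι
  have hgA : ∀ g ∈ A, ∫ x, g x ∂P.measure u = ∫ x, g x ∂Φ.measure hι u := fun g hg => by
    have h1 := IsSliceIntegral.inner_eq h hg
      (Quaternion.continuous_coe.comp g.continuous).measurable u
    rw [Φ.integral_measure, ← Φ.qop_apply hι, h1]
    simp
  obtain ⟨R, hR⟩ := hT.exists_bound
  -- A compact set carrying both measures; the support of P is only known to lie in a ball.
  set K : Set (sliceHalfPlane ι) := Φ.carrier ∪ {z | ‖(z : ℍ)‖ ≤ R}
  have hK : IsCompact K := Φ.isCompact.union (isCompact_setOf_norm_le hι R)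
  refine ext_of_forall_integral_eq_of_IsFiniteMeasure fun f => ?_
  have hε : ∀ ε : ℝ, 0 < ε → |∫ x, f x ∂P.measure u - ∫ x, f x ∂Φ.measure hι u| ≤
      ε * (2 * ‖u‖ ^ 2) := fun ε hε => by
    obtain ⟨g, hg, hgf⟩ :=
      ContinuousMap.exists_mem_subalgebra_near_continuous_of_isCompact_of_separatesPoints hA
        f.toContinuousMap hK hε
    have key : ∀ μ : Measure (sliceHalfPlane ι), IsFiniteMeasure μ → (∀ᵐ x ∂μ, x ∈ K) →
        |∫ x, g x ∂μ - ∫ x, f x ∂μ| ≤ ε * μ.real Set.univ := fun μ hμ hμK => by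
      have hae : ∀ᵐ x ∂μ, ‖g x - f x‖ ≤ ε := by
        filter_upwards [hμK] with x hx using (hgf x hx).le
      have hif : Integrable f μ := f.integrable μ
      have hig : Integrable g μ := by
        obtain ⟨c, hc⟩ := hK.exists_bound_of_continuousOn g.continuous.continuousOn
        refine Integrable.of_bound g.continuous.aestronglyMeasurable c ?_
        filter_upwards [hμK] with x hx using hc x hx
      rw [← integral_sub hig hif]
      exact norm_integral_le_of_norm_le_const hae
    have k1 := key (P.measure u) inferInstance (by
      filter_upwards [P.ae_mem_supp u] with x hx using Or.inr (hR x hx))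
    have k2 := key (Φ.measure hι u) inferInstance (by
      filter_upwards [Φ.ae_mem_carrier hι u] with x hx using Or.inl hx)
    rw [P.measureReal_univ, abs_sub_comm] at k1
    rw [Φ.measureReal_univ, ← hgA g hg] at k2
    have := abs_sub_le (∫ x, f x ∂P.measure u) (∫ x, g x ∂P.measure u)
      (∫ x, f x ∂Φ.measure hι u)
    linarith
  have h0 : |∫ x, f x ∂P.measure u - ∫ x, f x ∂Φ.measure hι u| ≤ 0 := by
    refine le_of_forall_pos_le_add fun ε he => ?_
    refine (hε (ε / (2 * ‖u‖ ^ 2 + 1)) (by positivity)).trans ?_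
    rw [zero_add, div_mul_eq_mul_div, div_le_iff₀ (by positivity)]
    nlinarith
  exact sub_eq_zero.1 (abs_eq_zero.1 (le_antisymm h0 (abs_nonneg _)))

end Uniqueness

/-! ### Quaternionic linear algebra relative to an imaginary unit -/

section ImUnit

variable {ι : ℍ}

theorem mul_self_cancel_imUnits (hι : ι ∈ imUnits) (q : ℍ) : ι * (ι * q) = -q := by
  rw [← mul_assoc, show ι * ι = -1 from hι, neg_mul, one_mul]

/-- The centralizer of an imaginary unit. -/
theorem mem_slicePlane_of_commute (hι : ι ∈ imUnits) {p : ℍ} (hp : ι * p = p * ι) :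
    p ∈ slicePlane ι := by
  set p' := p - (p.re : ℍ) with hp'
  have hstar : star p' = -p' := by
    ext <;> simp [hp']
  have hc : ι * p' = p' * ι := by
    rw [hp', mul_sub, sub_mul, hp, Quaternion.coe_commutes]
  -- For imaginary p' commuting with ι, the product ιp' is self-conjugate, hence real, and p' =
  -- -ι(ιp').
  have hr : star (ι * p') = ι * p' := by
    rw [star_mul, hstar, star_of_mem_imUnits hι, neg_mul_neg, hc]
  have h1 := quaternion_coe_re hr
  refine ⟨p.re, -(ι * p').re, ?_⟩
  have h2 : p' = -(ι * (ι * p')) := by rw [mul_self_cancel_imUnits hι, neg_neg]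
  rw [h1] at h2
  rw [Quaternion.coe_neg, mul_neg, ← h2, hp']
  abel

/-- `ℍ = ℂ_ι + ℂ_ι j`. -/
theorem exists_slicePlane_decomposition (hι : ι ∈ imUnits) {j : ℍ} (hj : j ∈ imUnits)
    (hιj : ι * j = -(j * ι)) (q : ℍ) :
    ∃ a ∈ slicePlane ι, ∃ b ∈ slicePlane ι, q = a + b * j := by
  have hsq : ι * ι = -1 := hι
  have hjq : j * j = -1 := hj
  set c : ℍ := ((1 / 2 : ℝ) : ℍ) with hc
  have hcι : ∀ x : ℍ, c * x = x * c := fun x => Quaternion.coe_commutes _ x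
  have hcc : c + c = 1 := by
    rw [hc, ← Quaternion.coe_add, ← Quaternion.coe_one]; norm_num
  -- ½(q - ιqι) commutes with ι and ½(q + ιqι) anticommutes with it. Multiplying the latter by j
  -- makes it commute, and j² = -1 accounts for the sign.
  refine ⟨c * (q - ι * q * ι), ?_, -(c * (q + ι * q * ι) * j), ?_, ?_⟩
  · refine mem_slicePlane_of_commute hι ?_
    rw [← mul_assoc, ← hcι, mul_assoc, mul_assoc c]
    congr 1
    have e1 : ι * (ι * q * ι) = -(q * ι) := by
      rw [← mul_assoc, ← mul_assoc, hsq, neg_one_mul, neg_mul]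
    have e2 : ι * q * ι * ι = -(ι * q) := by rw [mul_assoc, hsq, mul_neg_one]
    rw [mul_sub, sub_mul, e1, e2]
    abel
  · refine mem_slicePlane_of_commute hι ?_
    have e1 : ι * (ι * q * ι) = -(q * ι) := by
      rw [← mul_assoc, ← mul_assoc, hsq, neg_one_mul, neg_mul]
    have e2 : ι * q * ι * ι = -(ι * q) := by rw [mul_assoc, hsq, mul_neg_one]
    have e3 : ι * (q + ι * q * ι) = -((q + ι * q * ι) * ι) := by
      rw [mul_add, add_mul, e1, e2]; abel
    have e4 : j * ι = -(ι * j) := by rw [hιj, neg_neg]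
    rw [mul_neg, neg_mul, ← mul_assoc, ← mul_assoc, ← hcι, mul_assoc c ι, e3, mul_neg, neg_mul,
      mul_assoc _ j ι, e4, mul_neg, ← mul_assoc c, mul_assoc (c * _) ι j]
  · have e : -(c * (q + ι * q * ι) * j) * j = c * (q + ι * q * ι) := by
      rw [neg_mul, mul_assoc _ j j, hjq, mul_neg_one, neg_neg]
    rw [e, ← mul_add]
    have e2 : q - ι * q * ι + (q + ι * q * ι) = q + q := by abel
    rw [e2, mul_add, ← add_mul, hcc, one_mul]

theorem exists_mul_ne_mul (hι : ι ∈ imUnits) : ∃ p : ℍ, ι * p ≠ p * ι := by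
  by_contra hcon
  push Not at hcon
  have hre := re_of_mem_imUnits hι
  simp only [Quaternion.ext_iff, Quaternion.re_mul, Quaternion.imI_mul, Quaternion.imJ_mul,
    Quaternion.imK_mul] at hcon
  have hI := hcon (⟨0, 1, 0, 0⟩ : ℍ[ℝ])
  have hJ := hcon (⟨0, 0, 1, 0⟩ : ℍ[ℝ])
  obtain ⟨-, -, h2, h3⟩ := hI
  obtain ⟨-, -, -, h4⟩ := hJ
  simp only [mul_zero, mul_one, zero_mul, add_zero, zero_add, sub_zero, zero_sub,
    one_mul] at h2 h3 h4
  have h0 : ι = 0 := by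
    ext <;> simp only [Quaternion.re_zero, Quaternion.imI_zero, Quaternion.imJ_zero,
      Quaternion.imK_zero] <;> linarith
  have := norm_of_mem_imUnits hι
  rw [h0, norm_zero] at this
  exact zero_ne_one this

/-- There is an imaginary unit anticommuting with a given one. -/
theorem exists_anticommuting (hι : ι ∈ imUnits) : ∃ j ∈ imUnits, ι * j = -(j * ι) := by
  obtain ⟨p, hp⟩ := exists_mul_ne_mul hι
  have hsq : ι * ι = -1 := hι
  -- A nonzero commutator with ι is purely imaginary and anticommutes with ι; it only needs
  -- normalising.
  set w := ι * p - p * ι with hw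
  have hw0 : w ≠ 0 := sub_ne_zero.2 hp
  have hanti : ι * w = -(w * ι) := by
    rw [hw, mul_sub, sub_mul, ← mul_assoc ι ι, mul_assoc p ι ι, hsq, mul_assoc ι p ι]
    simp
    abel
  have hre : w.re = 0 := by
    rw [hw, Quaternion.re_sub, Quaternion.re_mul, Quaternion.re_mul]; ring
  have hstar : star w = -w := by
    ext <;> simp [hre]
  have hww : w * w = ((-(‖w‖ * ‖w‖) : ℝ) : ℍ) := by
    have := Quaternion.self_mul_star w
    rw [hstar, mul_neg, Quaternion.normSq_eq_norm_mul_self] at this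
    rw [Quaternion.coe_neg, ← this, neg_neg]
  have hn : ‖w‖ ≠ 0 := norm_ne_zero_iff.2 hw0
  refine ⟨((‖w‖⁻¹ : ℝ) : ℍ) * w, ?_, ?_⟩
  · change ((‖w‖⁻¹ : ℝ) : ℍ) * w * (((‖w‖⁻¹ : ℝ) : ℍ) * w) = -1
    rw [mul_assoc, ← mul_assoc w, ← Quaternion.coe_commutes _ w, mul_assoc _ w w, hww,
      ← Quaternion.coe_mul, ← Quaternion.coe_mul, ← Quaternion.coe_one, ← Quaternion.coe_neg]
    congr 1
    field_simp
  · rw [← mul_assoc, ← Quaternion.coe_commutes _ ι, mul_assoc, hanti, mul_neg, mul_assoc]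

end ImUnit

/-! ### Existence of an adapted left multiplication -/

section Operators

variable {H : Type*} [NormedAddCommGroup H] [Module ℍᵐᵒᵖ H]

theorem qop_neg_mul (A B : H →L[ℍᵐᵒᵖ] H) : -A * B = -(A * B) := neg_mul A B

theorem qop_mul_neg (A B : H →L[ℍᵐᵒᵖ] H) : A * -B = -(A * B) := mul_neg A B

theorem qop_neg_mul_neg (A B : H →L[ℍᵐᵒᵖ] H) : -A * -B = A * B := neg_mul_neg A B

end Operators

/-! ### Positive square roots and the Zorn construction -/

section Existence

variable {ι : ℍ} {H : Type*} [NormedAddCommGroup H] [Module ℍᵐᵒᵖ H] [QuaternionicInner H]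

attribute [local instance] complexInnerSpace InnerProductSpace.complexToReal

theorem Commute.toRealOp {A B : H →L[ℍᵐᵒᵖ] H} (h : Commute A B) :
    Commute (_root_.toRealOp A) (_root_.toRealOp B) :=
  ContinuousLinearMap.ext fun u => DFunLike.congr_fun h.eq u

/-- Evaluate the form at w - tBw, obtaining -2tn + t²k with n = ‖Bw‖². For t = n/(k + 1) one has tk
< n, so the value is negative unless Bw = 0. -/
theorem IsPositiveOp.apply_eq_zero [CompleteSpace H] {B : H →L[ℍᵐᵒᵖ] H} (hB : IsPositiveOp B)
    {w : H} (hw : inner ℝ w (B w) = 0) : B w = 0 := by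
  have hpos : ∀ u, 0 ≤ inner ℝ u (B u) := fun u => by
    obtain ⟨r, hr, h⟩ := hB u
    rw [real_inner_def, h, Quaternion.re_coe]
    exact hr
  have hsym : ∀ u v, inner ℝ u (B v) = inner ℝ (B u) v := fun u v => by
    rw [real_inner_def, real_inner_def, ← qinner_qadjoint, hB.qadjoint_eq]
  by_contra h0
  set n := ‖B w‖ ^ 2 with hn
  have hn0 : 0 < n := by positivity
  set k := inner ℝ (B w) (B (B w)) with hk
  have hk0 : 0 ≤ k := hpos _
  set t := n / (k + 1) with ht
  have ht0 : 0 < t := by positivity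
  have h1 := hpos (w - t • B w)
  have h2 : inner ℝ (w - t • B w) (B (w - t • B w)) = -2 * t * n + t ^ 2 * k := by
    rw [map_sub, qop_map_real_smul, inner_sub_left, inner_sub_right, inner_sub_right, hw,
      real_inner_smul_right, real_inner_smul_left, real_inner_smul_left, real_inner_smul_right,
      hsym w, real_inner_self_eq_norm_sq]
    ring
  rw [h2] at h1
  have h3 : t * (k + 1) = n := by rw [ht]; field_simp
  nlinarith

/-- Commuting square roots satisfy (B + B')(B - B') = 0. For w = (B - B')u this gives ⟨w, Bw⟩ + ⟨w,
B'w⟩ = 0, so positivity yields Bw = B'w = 0, and then ‖w‖² = ⟨(B - B')u|w⟩ = 0. -/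
theorem IsPositiveOp.eq_of_sq_eq [CompleteSpace H] {B B' : H →L[ℍᵐᵒᵖ] H} (hB : IsPositiveOp B)
    (hB' : IsPositiveOp B') (hsq : B * B = B' * B') (hc : B * B' = B' * B) : B = B' := by
  have hpos : ∀ {C : H →L[ℍᵐᵒᵖ] H}, IsPositiveOp C → ∀ u, 0 ≤ inner ℝ u (C u) := fun hC u => by
    obtain ⟨r, hr, h⟩ := hC u
    rw [real_inner_def, h, Quaternion.re_coe]
    exact hr
  ext u
  set w := B u - B' u with hw
  have h1 : B w + B' w = 0 := by
    have e1 := DFunLike.congr_fun hsq u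
    have e2 := DFunLike.congr_fun hc u
    simp only [mul_apply_eq_comp] at e1 e2
    rw [hw, map_sub, map_sub, e1, e2]; abel
  have h2 : inner ℝ w (B w) + inner ℝ w (B' w) = 0 := by
    rw [← inner_add_right, h1, inner_zero_right]
  have h3 : B w = 0 := hB.apply_eq_zero (by linarith [hpos hB w, hpos hB' w])
  have h4 : B' w = 0 := hB'.apply_eq_zero (by linarith [hpos hB w, hpos hB' w])
  have h5 : qinner w w = 0 := by
    have e1 : qinner (B u) w = 0 := by
      rw [← hB.qadjoint_eq, qinner_qadjoint, h3, qinner_zero_right]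
    have e2 : qinner (B' u) w = 0 := by
      rw [← hB'.qadjoint_eq, qinner_qadjoint, h4, qinner_zero_right]
    have e3 : qinner w w = qinner (B u) w - qinner (B' u) w := qinner_sub_left _ _ _
    rw [e3, e1, e2, sub_self]
  rw [qinner_self] at h5
  have h6 : ‖w‖ ^ 2 = 0 := by
    rw [← Quaternion.coe_zero] at h5
    exact Quaternion.coe_injective h5
  exact sub_eq_zero.1 (norm_eq_zero.1 (pow_eq_zero_iff two_ne_zero |>.1 h6))

namespace SliceCalculus

variable [CompleteSpace H] {T : H →L[ℍᵐᵒᵖ] H}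

theorem isIQPVM_of_commute (hι : ι ∈ imUnits) (Φ : SliceCalculus ι T) {L : ℍ → H →L[ℍᵐᵒᵖ] H}
    (hL : IsLeftScalarMul L) (h : ∀ q f u, L q (Φ.toHom f u) = Φ.toHom f (L q u)) :
    IsIQPVM (Φ.qpvm hι) L :=
  ⟨hL, fun E _ q => ContinuousLinearMap.ext fun u =>
    Φ.proj_commute hι E (S := L q) (S' := L (star q)) (fun u v => by
      rw [real_inner_def, real_inner_def, ← hL.qadjoint_apply, qinner_qadjoint_right])
      (h (star q)) u⟩

/-- If `L_ι |T - T*| = T - T*`, then `T` is the integral of the identity. -/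
theorem isSliceIntegral_id (hι : ι ∈ imUnits) (Φ : SliceCalculus ι T) {L : ℍ → H →L[ℍᵐᵒᵖ] H}
    (h : IsIQPVM (Φ.qpvm hι) L) (hL : L ι * Φ.qop hι (twoIm ι) = T - qadjoint T) :
    IsSliceIntegral (Φ.qpvm hι) L (fun z => (z : ℍ)) T := by
  have h1 := Φ.isSliceIntegral_qop hι h (twoRe ι)
  have h2 := (IsSliceIntegral.const _ L ι).mul h (Φ.isSliceIntegral_qop hι h (twoIm ι))
  rw [hL] at h2
  rw [Φ.qop_twoRe] at h1
  have h3 := (IsSliceIntegral.const (Φ.qpvm hι) L ((1 / 2 : ℝ) : ℍ)).mul h (h1.add h h2)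
  have h4 : L ((1 / 2 : ℝ) : ℍ) * (T + qadjoint T + (T - qadjoint T)) = T := by
    refine ContinuousLinearMap.ext fun u => ?_
    rw [mul_apply_eq_comp, h.leftMul.map_coe, add_apply, add_apply, sub_apply]
    have : T u + qadjoint T u + (T u - qadjoint T u) = (2 : ℝ) • T u := by
      rw [two_smul]; abel
    rw [this, smul_smul]
    norm_num
  rw [h4] at h3
  refine h3.congr fun z _ => ?_
  rw [← coe_add_star, ← coe_sub_star hι]
  have : (z : ℍ) + star (z : ℍ) + (z - star (z : ℍ)) = ((2 : ℝ) : ℍ) * z := by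
    rw [← one_add_one_eq_two, Quaternion.coe_add, Quaternion.coe_one, add_mul, one_mul]; abel
  rw [this, ← mul_assoc, ← Quaternion.coe_mul]
  norm_num

theorem isPositiveOp_qop_twoIm (hι : ι ∈ imUnits) (Φ : SliceCalculus ι T) :
    IsPositiveOp (Φ.qop hι (twoIm ι)) := fun u => by
  refine ⟨inner ℝ u (Φ.toHom (twoIm ι) u),
    Φ.inner_map_nonneg (fun x => mul_nonneg zero_le_two (hpIm_nonneg x)) u, ?_⟩
  have h : star (qinner u (Φ.qop hι (twoIm ι) u)) = qinner u (Φ.qop hι (twoIm ι) u) := by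
    rw [star_qinner, qinner_qop]
  exact quaternion_coe_re h

theorem _root_.IsNormalOp.commute_add_sub (hT : IsNormalOp T) :
    Commute (T - qadjoint T) (T + qadjoint T) := by
  have h1 : Commute T (qadjoint T) := hT
  exact ((Commute.refl T).add_right h1).sub_left (h1.symm.add_right (Commute.refl _))

theorem map_comm_of_commute (hι : ι ∈ imUnits) (Φ : SliceCalculus ι T) {S : H →L[ℍᵐᵒᵖ] H}
    (h1 : Commute S (T + qadjoint T)) (h2 : Commute S ((T - qadjoint T) * (T - qadjoint T)))
    (f : C(sliceHalfPlane ι, ℝ)) (u : H) : S (Φ.toHom f u) = Φ.toHom f (S u) :=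
  DFunLike.congr_fun (Φ.commute hι h1.toRealOp h2.toRealOp f).eq u

theorem sub_map_comm (hι : ι ∈ imUnits) (hT : IsNormalOp T) (Φ : SliceCalculus ι T)
    (f : C(sliceHalfPlane ι, ℝ)) (u : H) :
    (T - qadjoint T) (Φ.toHom f u) = Φ.toHom f ((T - qadjoint T) u) :=
  Φ.map_comm_of_commute hι hT.commute_add_sub ((Commute.refl _).mul_right (Commute.refl _)) f u

/-- Vectors on which `T - T*` acts as `|T - T*|` followed by right multiplication with `ι`. -/
def IsAdapted (hι : ι ∈ imUnits) (Φ : SliceCalculus ι T) (u : H) : Prop :=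
  (T - qadjoint T) u = op ι • Φ.qop hι (twoIm ι) u

/-- Sets of adapted vectors on which the calculus has real matrix entries. -/
structure IsRealSet (hι : ι ∈ imUnits) (Φ : SliceCalculus ι T) (S : Set H) : Prop where
  adapted : ∀ u ∈ S, Φ.IsAdapted hι u
  -- Reality of all entries, not only of ⟨u|v⟩, makes a maximal set invariant under the calculus.
  real : ∀ u ∈ S, ∀ v ∈ S, ∀ f, star (qinner u (Φ.qop hι f v)) = qinner u (Φ.qop hι f v)

theorem exists_maximal_isRealSet (hι : ι ∈ imUnits) (Φ : SliceCalculus ι T) :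
    ∃ S : Set H, Maximal (fun S => Φ.IsRealSet hι S) S := by
  refine zorn_subset {S | Φ.IsRealSet hι S} fun c hc hchain => ⟨⋃₀ c, ⟨?_, ?_⟩, fun s hs =>
    Set.subset_sUnion_of_mem hs⟩
  · rintro u ⟨s, hs, hu⟩
    exact (hc hs).adapted u hu
  · rintro u ⟨s, hs, hu⟩ v ⟨t, ht, hv⟩ f
    rcases hchain.total hs ht with hst | hts
    · exact (hc ht).real u (hst hu) v hv f
    · exact (hc hs).real u hu v (hts hv) f

/-- The diagonal entries of w are automatically real because the calculus is symmetric, so w can be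
added to S. -/
theorem mem_of_maximal (hι : ι ∈ imUnits) (Φ : SliceCalculus ι T) {S : Set H}
    (hS : Maximal (fun S => Φ.IsRealSet hι S) S) {w : H} (hw : Φ.IsAdapted hι w)
    (hreal : ∀ u ∈ S, ∀ f, star (qinner u (Φ.qop hι f w)) = qinner u (Φ.qop hι f w)) :
    w ∈ S := by
  have h : Φ.IsRealSet hι (insert w S) := by
    refine ⟨?_, ?_⟩
    · rintro u (rfl | hu)
      · exact hw
      · exact hS.prop.adapted u hu
    · rintro u (rfl | hu) v (rfl | hv) f
      · rw [star_qinner, qinner_qop]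
      · rw [qinner_qop, star_qinner, ← hreal v hv f, star_qinner]
      · exact hreal u hu f
      · exact hS.prop.real u hu v hv f
  exact hS.le_of_ge h (Set.subset_insert w S) (Set.mem_insert w S)

theorem isAdapted_add (hι : ι ∈ imUnits) (Φ : SliceCalculus ι T) {u v : H}
    (hu : Φ.IsAdapted hι u) (hv : Φ.IsAdapted hι v) : Φ.IsAdapted hι (u + v) := by
  rw [IsAdapted, map_add, map_add, smul_add, hu, hv]

theorem isAdapted_smul (hι : ι ∈ imUnits) (Φ : SliceCalculus ι T) (c : ℝ) {u : H}
    (hu : Φ.IsAdapted hι u) : Φ.IsAdapted hι (c • u) := by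
  rw [IsAdapted, qop_map_real_smul, qop_map_real_smul, ← real_smul_op_smul, hu]

theorem isAdapted_map (hι : ι ∈ imUnits) (hT : IsNormalOp T) (Φ : SliceCalculus ι T)
    (f : C(sliceHalfPlane ι, ℝ)) {u : H} (hu : Φ.IsAdapted hι u) :
    Φ.IsAdapted hι (Φ.qop hι f u) := by
  have h : Φ.qop hι (twoIm ι) (Φ.qop hι f u) = Φ.qop hι f (Φ.qop hι (twoIm ι) u) := by
    simp only [qop_apply]
    rw [← mul_apply_eq_comp, ← mul_apply_eq_comp, ← map_mul, ← map_mul, mul_comm]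
  rw [IsAdapted, h, ← map_smul, ← hu]
  exact Φ.sub_map_comm hι hT f u

theorem isClosed_isAdapted (hι : ι ∈ imUnits) (Φ : SliceCalculus ι T) :
    IsClosed {u | Φ.IsAdapted hι u} :=
  isClosed_eq (T - qadjoint T).continuous
    ((continuous_op_smul ι).comp (Φ.qop hι (twoIm ι)).continuous)

theorem qop_mul_apply (hι : ι ∈ imUnits) (Φ : SliceCalculus ι T) (f g : C(sliceHalfPlane ι, ℝ))
    (u : H) : Φ.qop hι f (Φ.qop hι g u) = Φ.qop hι (f * g) u := by
  simp only [qop_apply]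
  rw [map_mul, mul_apply_eq_comp]

/-! ### Structure of a maximal real set -/

section Maximal

variable {S : Set H}

theorem map_mem_of_maximal (hι : ι ∈ imUnits) (hT : IsNormalOp T) (Φ : SliceCalculus ι T)
    (hS : Maximal (fun S => Φ.IsRealSet hι S) S) (f : C(sliceHalfPlane ι, ℝ)) {u : H}
    (hu : u ∈ S) : Φ.qop hι f u ∈ S :=
  Φ.mem_of_maximal hι hS (Φ.isAdapted_map hι hT f (hS.prop.adapted u hu)) fun v hv g => by
    rw [qop_mul_apply]
    exact hS.prop.real v hv u hu _

/-- A maximal real set is a closed real subspace. -/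
def subspaceOfMaximal (hι : ι ∈ imUnits) (Φ : SliceCalculus ι T)
    (hS : Maximal (fun S => Φ.IsRealSet hι S) S) : Submodule ℝ H where
  carrier := S
  add_mem' := fun {u v} hu hv => Φ.mem_of_maximal hι hS
    (Φ.isAdapted_add hι (hS.prop.adapted u hu) (hS.prop.adapted v hv)) fun w hw f => by
      rw [map_add, qinner_add_right, star_add, hS.prop.real w hw u hu, hS.prop.real w hw v hv]
  zero_mem' := Φ.mem_of_maximal hι hS (by simp [IsAdapted]) fun w _ f => by simp
  smul_mem' := fun c u hu => Φ.mem_of_maximal hι hS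
    (Φ.isAdapted_smul hι c (hS.prop.adapted u hu)) fun w hw f => by
      rw [qop_map_real_smul, qinner_real_smul_right, star_mul, hS.prop.real w hw u hu,
        Quaternion.star_coe, Quaternion.coe_commutes]

theorem isClosed_of_maximal (hι : ι ∈ imUnits) (Φ : SliceCalculus ι T)
    (hS : Maximal (fun S => Φ.IsRealSet hι S) S) : IsClosed S := by
  rw [← closure_subset_iff_isClosed]
  intro w hw
  refine Φ.mem_of_maximal hι hS
    (closure_minimal hS.prop.adapted (Φ.isClosed_isAdapted hι) hw) fun u hu f => ?_
  have hcl : IsClosed {w | star (qinner u (Φ.qop hι f w)) = qinner u (Φ.qop hι f w)} := by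
    have hc : Continuous fun w => qinner u (Φ.qop hι f w) :=
      continuous_const.qinner (Φ.qop hι f).continuous
    exact isClosed_eq (continuous_star.comp hc) hc
  exact closure_minimal (fun v hv => hS.prop.real u hu v hv f) hcl hw

/-- An adapted vector orthogonal to S has zero entries against S, so it lies in S and vanishes. Let
D = T - T* and B = |D|. Since D² = -B² and BD = DB, the vector Bv - (Dv)ι is adapted for every v,
hence Bv = (Dv)ι for v ⟂ S. Applying this to vp as well gives Dv(ιp - pι) = 0. A p not commuting
with ι forces Dv = Bv = 0, so v itself is adapted and vanishes. -/
theorem qperp_of_maximal (hι : ι ∈ imUnits) (hT : IsNormalOp T) (Φ : SliceCalculus ι T)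
    (hS : Maximal (fun S => Φ.IsRealSet hι S) S) : qperp S = {0} := by
  set B := Φ.qop hι (twoIm ι) with hB
  set D := T - qadjoint T with hD
  have hDadj : qadjoint D = -D := by
    rw [hD, qadjoint_sub, qadjoint_qadjoint, neg_sub]
  have hnull : ∀ w ∈ qperp S, Φ.IsAdapted hι w → w = 0 := fun w hw hwA => by
    have hmem : w ∈ S := Φ.mem_of_maximal hι hS hwA fun u hu f => by
      have : qinner u (Φ.qop hι f w) = 0 := by
        rw [qinner_qop, ← star_qinner, hw _ (Φ.map_mem_of_maximal hι hT hS f hu), star_zero]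
      rw [this, star_zero]
    have h := hw w hmem
    rw [qinner_self, ← Quaternion.coe_zero] at h
    exact norm_eq_zero.1 (pow_eq_zero_iff two_ne_zero |>.1 (Quaternion.coe_injective h))
  have hBD : ∀ u, B (D u) = D (B u) := fun u => (Φ.sub_map_comm hι hT (twoIm ι) u).symm
  have hDD : ∀ u, D (D u) = -B (B u) := fun u => by
    have := DFunLike.congr_fun (Φ.qop_twoIm_sq hι) u
    simp only [mul_apply_eq_comp, neg_apply] at this
    rw [hB, this, neg_neg]
  have hsmul : ∀ u ∈ qperp S, ∀ p : ℍ, op p • u ∈ qperp S := fun u hu p z hz => by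
    rw [qinner_smul_left, hu z hz, mul_zero]
  have hBS : ∀ u ∈ qperp S, B u ∈ qperp S := fun u hu z hz => by
    rw [← qinner_qop]
    exact hu _ (Φ.map_mem_of_maximal hι hT hS _ hz)
  have hDS : ∀ u ∈ qperp S, D u ∈ qperp S := fun u hu z hz => by
    rw [← qinner_qadjoint_right, hDadj, neg_apply, qinner_neg_right, hD, hS.prop.adapted z hz,
      qinner_smul_right, hu _ (Φ.map_mem_of_maximal hι hT hS _ hz), zero_mul, neg_zero]
  have hkey : ∀ v ∈ qperp S, B v = op ι • D v := fun v hv => by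
    have hw : B v - op ι • D v ∈ qperp S := fun z hz => by
      rw [qinner_sub_left, hBS v hv z hz, hsmul _ (hDS v hv) ι z hz, sub_zero]
    refine sub_eq_zero.1 (hnull _ hw ?_)
    change D (B v - op ι • D v) = op ι • B (B v - op ι • D v)
    rw [map_sub, map_sub, map_smul, map_smul, hDD, hBD, smul_sub, smul_neg, sub_neg_eq_add,
      smul_smul, ← op_mul, show ι * ι = -1 from hι, op_neg, op_one, neg_one_smul, sub_neg_eq_add,
      add_comm]
  ext v
  refine ⟨fun hv => ?_, fun hv => ?_⟩
  · obtain ⟨p, hp⟩ := exists_mul_ne_mul hι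
    have h1 := hkey _ (hsmul v hv p)
    rw [map_smul, map_smul, hkey v hv, smul_smul, smul_smul, ← op_mul, ← op_mul, ← sub_eq_zero,
      ← sub_smul, ← op_sub] at h1
    have h2 : D v = 0 := by
      have h3 := congrArg norm h1
      rw [norm_op_smul, norm_zero, mul_eq_zero, norm_eq_zero, norm_eq_zero] at h3
      exact h3.resolve_left (sub_ne_zero.2 hp)
    refine hnull v hv ?_
    change D v = op ι • B v
    rw [hkey v hv, h2]
    simp
  · rw [Set.mem_singleton_iff.1 hv]
    intro z _
    exact qinner_zero_left z

end Maximal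

/-- There is a left multiplication adapted to a normal operator. -/
theorem exists_adapted_leftMul (hι : ι ∈ imUnits) (hT : IsNormalOp T) (Φ : SliceCalculus ι T) :
    ∃ L : ℍ → H →L[ℍᵐᵒᵖ] H, IsIQPVM (Φ.qpvm hι) L ∧
      L ι * Φ.qop hι (twoIm ι) = T - qadjoint T := by
  obtain ⟨S, hS⟩ := Φ.exists_maximal_isRealSet hι
  set V : Submodule ℝ H := Φ.subspaceOfMaximal hι hS with hV
  have hVS : ∀ x : V, (x : H) ∈ S := fun x => x.2
  have hcomp : CompleteSpace V :=
    (Φ.isClosed_of_maximal hι hS).completeSpace_coe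
  obtain ⟨w, b, hb⟩ := exists_hilbertBasis ℝ V
  -- The function f = 1 shows that scalar products in S are real, so real orthonormality in S is
  -- quaternionic orthonormality.
  have hreal : ∀ u ∈ S, ∀ v ∈ S, qinner u v = ((inner ℝ u v : ℝ) : ℍ) := fun u hu v hv => by
    have h := hS.prop.real u hu v hv 1
    have h1 : Φ.qop hι 1 v = v := by rw [qop_apply, map_one, one_apply_eq_self]
    rw [h1] at h
    exact quaternion_coe_re h
  have hN : IsHilbertBasis ((fun x : V => (x : H)) '' w) := by
    refine ⟨?_, ?_, ?_⟩
    · rintro _ ⟨x, hx, rfl⟩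
      have := b.orthonormal.1 ⟨x, hx⟩
      rw [hb] at this
      exact this
    · rintro _ ⟨x, hx, rfl⟩ _ ⟨y, hy, rfl⟩ hxy
      have := b.orthonormal.2 (i := ⟨x, hx⟩) (j := ⟨y, hy⟩) fun h => hxy (by
        rw [Subtype.mk.inj h])
      rw [hb] at this
      have h0 : inner ℝ (x : H) (y : H) = 0 := this
      rw [hreal _ (hVS x) _ (hVS y), h0, Quaternion.coe_zero]
    · rw [← Φ.qperp_of_maximal hι hT hS]
      refine Set.Subset.antisymm (fun u hu z hz => ?_) fun u hu z hz => ?_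
      · have h1 := (b.hasSum_repr ⟨z, hz⟩).mapL V.subtypeL
        have h2 := h1.map (AddMonoidHom.mk' (fun x => qinner u x) (qinner_add_right u))
          (continuous_const.qinner continuous_id)
        refine h2.unique (hasSum_zero.congr_fun ?_)
        intro i
        change qinner u (((b.repr ⟨z, hz⟩ i) • b i : V) : H) = 0
        rw [hb, Submodule.coe_smul, qinner_real_smul_right, hu _ ⟨i, i.2, rfl⟩, mul_zero]
      · obtain ⟨x, -, rfl⟩ := hz
        exact hu _ (hVS x)
  have hNS : ∀ z ∈ (fun x : V => (x : H)) '' w, z ∈ S := by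
    rintro _ ⟨x, -, rfl⟩
    exact hVS x
  have hL := hN.isLeftScalarMul
  -- Vectors of S have real coordinates, which commute with q, so left and right multiplication
  -- agree on S.
  have hLS : ∀ q : ℍ, ∀ u ∈ S, hN.leftMul q u = op q • u := fun q u hu =>
    hN.ext_qinner fun z hz => by
      rw [hN.qinner_of_hasSum (hN.hasSum_leftMul q u) hz, qinner_smul_right,
        hreal z (hNS z hz) u hu, Quaternion.coe_commutes]
  refine ⟨fun q => hN.leftMul q, Φ.isIQPVM_of_commute hι hL fun q f u => ?_, ?_⟩
  · have h : hN.leftMul q * Φ.qop hι f = Φ.qop hι f * hN.leftMul q := hN.op_ext fun z hz => by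
      rw [mul_apply_eq_comp, mul_apply_eq_comp, hLS q z (hNS z hz),
        hLS q _ (Φ.map_mem_of_maximal hι hT hS f (hNS z hz)), map_smul]
    exact DFunLike.congr_fun h u
  · refine hN.op_ext fun z hz => ?_
    rw [mul_apply_eq_comp, hLS ι _ (Φ.map_mem_of_maximal hι hT hS _ (hNS z hz)),
      hS.prop.adapted z (hNS z hz)]

end SliceCalculus

end Existence

/-! ### Representing measures -/

section Representation

variable {ι : ℍ} {H : Type*} [NormedAddCommGroup H] [Module ℍᵐᵒᵖ H] [QuaternionicInner H]
  {P : QPVM ι H} {L : ℍ → H →L[ℍᵐᵒᵖ] H} {T : H →L[ℍᵐᵒᵖ] H}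

attribute [local instance] complexInnerSpace InnerProductSpace.complexToReal

theorem IsLeftScalarMul.imUnit_mul_self (hL : IsLeftScalarMul L) {k : ℍ} (hk : k ∈ imUnits) :
    L k * L k = -1 := by
  rw [← hL.map_mul, show k * k = -1 from hk, hL.map_neg, hL.map_one]

variable [CompleteSpace H]

theorem qadjoint_sub_qadjoint (T : H →L[ℍᵐᵒᵖ] H) :
    qadjoint (T - qadjoint T) = -(T - qadjoint T) := by
  rw [qadjoint_sub, qadjoint_qadjoint, neg_sub]

theorem IsLeftScalarMul.qadjoint_imUnit (hL : IsLeftScalarMul L) {k : ℍ} (hk : k ∈ imUnits) :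
    qadjoint (L k) = -L k := by
  rw [hL.qadjoint_apply, star_of_mem_imUnits hk, hL.map_neg]

theorem IsLeftScalarMul.commute_qadjoint (hL : IsLeftScalarMul L) (hι : ι ∈ imUnits)
    (hιT : L ι * T = T * L ι) : L ι * qadjoint T = qadjoint T * L ι := by
  have h1 := congrArg qadjoint hιT
  rw [qadjoint_mul, qadjoint_mul, hL.qadjoint_imUnit hι, qop_mul_neg, qop_neg_mul, neg_inj] at h1
  exact h1.symm

theorem measurable_twoIm : Measurable fun z : sliceHalfPlane ι => twoIm ι z :=
  (twoIm ι).continuous.measurable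

namespace IsSliceIntegral

theorem leftMul_comm (h : IsIQPVM P L) (hι : ι ∈ imUnits)
    (hT : IsSliceIntegral P L (fun z => (z : ℍ)) T) : L ι * T = T * L ι :=
  unique h ((const P L ι).mul h hT)
    ((hT.mul h (const P L ι)).congr fun z _ => (commute_coe hι z).symm)

theorem leftMul_comm_qadjoint (h : IsIQPVM P L) (hι : ι ∈ imUnits)
    (hT : IsSliceIntegral P L (fun z => (z : ℍ)) T) :
    L ι * _root_.qadjoint T = _root_.qadjoint T * L ι :=
  unique h ((const P L ι).mul h (hT.qadjoint h))
    (((hT.qadjoint h).mul h (const P L ι)).congr fun z _ => by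
      have := congrArg star (commute_coe hι z)
      rw [star_mul, star_mul, star_of_mem_imUnits hι, mul_neg, neg_mul, neg_inj] at this
      exact this)

theorem leftMul_anticomm (h : IsIQPVM P L) (hι : ι ∈ imUnits)
    (hT : IsSliceIntegral P L (fun z => (z : ℍ)) T) {j : ℍ} (hj : ι * j = -(j * ι)) :
    L j * T = _root_.qadjoint T * L j :=
  unique h ((const P L j).mul h hT)
    (((hT.qadjoint h).mul h (const P L j)).congr fun z _ => (anticommute_coe hι hj z).symm)

theorem isPositiveOp (h : IsIQPVM P L) (hι : ι ∈ imUnits)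
    (hT : IsSliceIntegral P L (fun z => (z : ℍ)) T) :
    IsPositiveOp (-(L ι * (T - _root_.qadjoint T))) := fun u =>
  ⟨_, integral_nonneg fun z => mul_nonneg zero_le_two (hpIm_nonneg z),
    (hT.neg_leftMul_mul h hι).qinner_eq h measurable_twoIm u⟩

theorem isAbsOp (h : IsIQPVM P L) (hι : ι ∈ imUnits)
    (hT : IsSliceIntegral P L (fun z => (z : ℍ)) T) :
    IsAbsOp (T - _root_.qadjoint T) (-(L ι * (T - _root_.qadjoint T))) := by
  refine ⟨hT.isPositiveOp h hι, ?_⟩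
  rw [qadjoint_sub_qadjoint, qop_neg_mul]
  have h1 := hT.neg_leftMul_mul h hι
  exact unique h ((h1.mul h h1).congr fun z _ => (Quaternion.coe_mul _ _).symm) (hT.neg_sq h hι)

/-- The integrals of `z` and of `2 Im z` determine the left multiplication on `Ker (T - T*)^⊥`. -/
theorem leftMul_eq_on_qperp {L' : ℍ → H →L[ℍᵐᵒᵖ] H} (hL : IsLeftScalarMul L)
    (hL' : IsLeftScalarMul L') (hι : ι ∈ imUnits)
    (hLT : L ι * (T - _root_.qadjoint T) = L' ι * (T - _root_.qadjoint T)) {q : ℍ}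
    (hq : q ∈ slicePlane ι) {u : H} (hu : u ∈ qperp (opKer (T - _root_.qadjoint T))) :
    L' q u = L q u := by
  set D := T - _root_.qadjoint T with hD
  have hDadj : _root_.qadjoint D = -D := qadjoint_sub_qadjoint T
  set W := L' ι - L ι with hW
  have hWadj : _root_.qadjoint W = -W := by
    rw [hW, qadjoint_sub, hL.qadjoint_imUnit hι, hL'.qadjoint_imUnit hι]
    abel
  -- W and D are skew-adjoint, so WD = 0 gives DW = 0, and W maps into Ker D. For u ⟂ Ker D this
  -- makes ‖Wu‖² = -⟨W(Wu)|u⟩ zero.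
  have hWD : W * D = 0 := by rw [hW, sub_mul, hLT, sub_self]
  have hDW : D * W = 0 := by
    have h1 := congrArg _root_.qadjoint hWD
    rw [qadjoint_mul, hDadj, hWadj, qop_neg_mul_neg] at h1
    rw [h1]
    exact (eq_qadjoint_of fun u v => by simp [qinner_zero_left, qinner_zero_right]).symm
  have hmem : ∀ v, W v ∈ opKer D := fun v => DFunLike.congr_fun hDW v
  have hWu : W u = 0 := by
    have h1 : qinner (W u) (W u) = 0 := by
      rw [← qinner_qadjoint, hWadj, neg_apply, qinner_neg_left]
      have h2 := hu _ (hmem (W u))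
      rw [← star_qinner, h2, star_zero, neg_zero]
    rw [qinner_self, ← Quaternion.coe_zero] at h1
    exact norm_eq_zero.1 (pow_eq_zero_iff two_ne_zero |>.1 (Quaternion.coe_injective h1))
  have hιu : L' ι u = L ι u := sub_eq_zero.1 hWu
  obtain ⟨α, β, rfl⟩ := hq
  rw [hL.map_add, hL'.map_add, hL.map_mul, hL'.map_mul, add_apply, add_apply, mul_apply_eq_comp,
    mul_apply_eq_comp, hL.map_coe, hL'.map_coe, hL.map_coe, hL'.map_coe, qop_map_real_smul,
    qop_map_real_smul, hιu]

end IsSliceIntegral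

namespace SliceCalculus

/-- Both sides are positive square roots of -(T - T*)², and they commute because L_ι and T - T*
commute with the calculus. The left side does not involve L, so neither does the product L_ι(T -
T*). -/
theorem qop_twoIm_eq (hι : ι ∈ imUnits) (hT : IsNormalOp T) (Φ : SliceCalculus ι T)
    (hL : IsLeftScalarMul L) (hιT : L ι * T = T * L ι)
    (hpos : IsPositiveOp (-(L ι * (T - qadjoint T)))) :
    Φ.qop hι (twoIm ι) = -(L ι * (T - qadjoint T)) := by
  have hιT' := hL.commute_qadjoint hι hιT
  have c1 : Commute (L ι) (T + qadjoint T) := Commute.add_right hιT hιT'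
  have c2 : Commute (L ι) (T - qadjoint T) := Commute.sub_right hιT hιT'
  refine (Φ.isPositiveOp_qop_twoIm hι).eq_of_sq_eq hpos ?_ ?_
  · rw [Φ.qop_twoIm_sq, qop_neg_mul_neg, mul_assoc (L ι), ← mul_assoc (T - qadjoint T), ← c2.eq,
      ← mul_assoc, ← mul_assoc, hL.imUnit_mul_self hι, qop_neg_mul, one_mul, qop_neg_mul]
  · rw [qop_mul_neg, qop_neg_mul, neg_inj]
    refine ContinuousLinearMap.ext fun u => ?_
    have e1 := Φ.map_comm_of_commute hι c1 (c2.mul_right c2) (twoIm ι)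
    have e2 := Φ.sub_map_comm hι hT (twoIm ι)
    simp only [mul_apply_eq_comp, qop_apply]
    rw [e2, e1]

/-- Left multiplications with the algebraic properties forced by a representation of `T`. -/
theorem isSliceIntegral_of_comm (hι : ι ∈ imUnits) (hT : IsNormalOp T) (Φ : SliceCalculus ι T)
    (hL : IsLeftScalarMul L) (hιT : L ι * T = T * L ι) {j : ℍ} (hj : j ∈ imUnits)
    (hιj : ι * j = -(j * ι)) (hjT : L j * T = qadjoint T * L j)
    (hpos : IsPositiveOp (-(L ι * (T - qadjoint T)))) :
    IsIQPVM (Φ.qpvm hι) L ∧ IsSliceIntegral (Φ.qpvm hι) L (fun z => (z : ℍ)) T := by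
  have hιT' := hL.commute_qadjoint hι hιT
  -- Multiply the given relation by L_j on both sides and use L_j² = -1.
  have hjT' : L j * qadjoint T = T * L j := by
    have hsq := hL.imUnit_mul_self hj
    have h1 : L j * (L j * T) * L j = L j * (qadjoint T * L j) * L j := by rw [hjT]
    rw [← mul_assoc, hsq, mul_assoc (L j), mul_assoc (qadjoint T), hsq, qop_mul_neg, qop_mul_neg,
      qop_neg_mul, qop_neg_mul, one_mul, mul_one, neg_inj] at h1
    exact h1.symm
  have c1 : Commute (L ι) (T + qadjoint T) := Commute.add_right hιT hιT'
  have c2 : Commute (L ι) (T - qadjoint T) := Commute.sub_right hιT hιT'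
  have d1 : Commute (L j) (T + qadjoint T) := by
    change L j * (T + qadjoint T) = (T + qadjoint T) * L j
    rw [mul_add, add_mul, hjT, hjT', add_comm]
  have d2 : L j * (T - qadjoint T) = -((T - qadjoint T) * L j) := by
    rw [mul_sub, sub_mul, hjT, hjT', neg_sub]
  have d3 : Commute (L j) ((T - qadjoint T) * (T - qadjoint T)) := by
    change L j * ((T - qadjoint T) * (T - qadjoint T)) = (T - qadjoint T) * (T - qadjoint T) * L j
    rw [← mul_assoc, d2, qop_neg_mul, mul_assoc, d2, qop_mul_neg, neg_neg, mul_assoc]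
  -- L_j anticommutes with T - T* but commutes with its square, so both L_ι and L_j commute with the
  -- calculus. The decomposition ℍ = ℂ_ι + ℂ_ι j gives every q.
  have hcomm : ∀ q f u, L q (Φ.toHom f u) = Φ.toHom f (L q u) := fun q f u => by
    have e1 := Φ.map_comm_of_commute hι c1 (c2.mul_right c2) f
    have e2 := Φ.map_comm_of_commute hι d1 d3 f
    have e3 : ∀ a ∈ slicePlane ι, ∀ v, L a (Φ.toHom f v) = Φ.toHom f (L a v) := by
      rintro _ ⟨α, β, rfl⟩ v
      rw [hL.map_add, hL.map_mul, add_apply, add_apply, mul_apply_eq_comp, mul_apply_eq_comp,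
        hL.map_coe, hL.map_coe, hL.map_coe, hL.map_coe, qop_map_real_smul, qop_map_real_smul, e1,
        map_add, map_smul, map_smul]
    obtain ⟨a, ha, b, hb, rfl⟩ := exists_slicePlane_decomposition hι hj hιj q
    rw [hL.map_add, hL.map_mul, add_apply, add_apply, mul_apply_eq_comp, mul_apply_eq_comp, e2,
      e3 a ha, e3 b hb, map_add]
  have h := Φ.isIQPVM_of_commute hι hL hcomm
  refine ⟨h, Φ.isSliceIntegral_id hι h ?_⟩
  rw [Φ.qop_twoIm_eq hι hT hL hιT hpos, qop_mul_neg, ← mul_assoc, hL.imUnit_mul_self hι,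
    qop_neg_mul, one_mul, neg_neg]

end SliceCalculus

end Representation

/-! ### Spheres and the slice half-plane -/

section Sphere

variable {ι : ℍ}

variable (ι) in
/-- The point of the slice half-plane on the sphere of `q`. -/
def slicePoint (q : ℍ) : sliceHalfPlane ι := hpMk ι q.re ‖q.im‖

theorem slicePoint_coe (hι : ι ∈ imUnits) (z : sliceHalfPlane ι) : slicePoint ι (z : ℍ) = z :=
  hpMk_hpRe_hpIm hι z

theorem hpRe_slicePoint (hι : ι ∈ imUnits) (q : ℍ) : hpRe (slicePoint ι q) = q.re :=
  hpRe_hpMk hι _ _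

theorem hpIm_slicePoint (hι : ι ∈ imUnits) (q : ℍ) : hpIm (slicePoint ι q) = ‖q.im‖ :=
  (hpIm_hpMk hι _ _).trans (abs_of_nonneg (norm_nonneg _))

theorem im_mul_im (q : ℍ) : q.im * q.im = ((-(‖q.im‖ * ‖q.im‖) : ℝ) : ℍ) := by
  have := Quaternion.self_mul_star q.im
  rw [Quaternion.star_im, mul_neg, Quaternion.normSq_eq_norm_mul_self] at this
  rw [Quaternion.coe_neg, ← this, neg_neg]

theorem exists_imUnit_eq (hι : ι ∈ imUnits) (q : ℍ) :
    ∃ j ∈ imUnits, q = (q.re : ℍ) + j * (‖q.im‖ : ℍ) := by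
  by_cases h : ‖q.im‖ = 0
  · refine ⟨ι, hι, ?_⟩
    have h0 := norm_eq_zero.1 h
    rw [h, Quaternion.coe_zero, mul_zero, add_zero]
    conv_lhs => rw [← Quaternion.re_add_im q, h0, add_zero]
  · refine ⟨q.im * ((‖q.im‖⁻¹ : ℝ) : ℍ), ?_, ?_⟩
    · change q.im * ((‖q.im‖⁻¹ : ℝ) : ℍ) * (q.im * ((‖q.im‖⁻¹ : ℝ) : ℍ)) = -1
      rw [mul_assoc, Quaternion.coe_commutes, ← mul_assoc, ← mul_assoc, im_mul_im,
        ← Quaternion.coe_mul, ← Quaternion.coe_mul, ← Quaternion.coe_one, ← Quaternion.coe_neg]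
      congr 1
      field_simp
    · rw [mul_assoc, ← Quaternion.coe_mul, inv_mul_cancel₀ h, Quaternion.coe_one, mul_one,
        Quaternion.re_add_im]

/-- Real part and norm of the imaginary part are constant on a sphere and are coordinates on the
half-plane. -/
theorem setOf_mem_qSphere (hι : ι ∈ imUnits) (q : ℍ) :
    {z : sliceHalfPlane ι | (z : ℍ) ∈ qSphere q} = {slicePoint ι q} := by
  ext z
  rw [Set.mem_ofPred_eq, Set.mem_singleton_iff]
  constructor
  · rintro ⟨α, β, j, hj, κ, hκ, hq, hz⟩
    refine hp_ext hι ?_ ?_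
    · rw [hpRe_slicePoint hι, hq, re_coe_add_mul hj, hpRe, hz, re_coe_add_mul hκ]
    · rw [hpIm_slicePoint hι, hq, norm_im_coe_add_mul hj, hpIm, hz, norm_im_coe_add_mul hκ]
  · rintro rfl
    obtain ⟨j, hj, hq⟩ := exists_imUnit_eq hι q
    refine ⟨q.re, ‖q.im‖, j, hj, ι, hι, hq, ?_⟩
    rw [coe_eq_hpRe_add hι, hpRe_slicePoint hι, hpIm_slicePoint hι]

theorem commute_coe_coe (hι : ι ∈ imUnits) (z w : sliceHalfPlane ι) : Commute (z : ℍ) (w : ℍ) := by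
  rw [coe_eq_hpRe_add hι z]
  have h1 : ∀ r : ℝ, Commute (r : ℍ) (w : ℍ) := fun r => Quaternion.coe_commutes r w
  exact (h1 _).add_left ((show Commute ι (w : ℍ) from commute_coe hι w).mul_left (h1 _))

theorem norm_slicePoint (hι : ι ∈ imUnits) (q : ℍ) : ‖(slicePoint ι q : ℍ)‖ ^ 2 = ‖q‖ ^ 2 := by
  have h : ∀ p : ℍ, ‖p‖ ^ 2 = p.re ^ 2 + ‖p.im‖ ^ 2 := fun p => by
    rw [sq ‖p‖, sq ‖p.im‖, ← Quaternion.normSq_eq_norm_mul_self,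
      ← Quaternion.normSq_eq_norm_mul_self, Quaternion.normSq_def', Quaternion.normSq_def']
    simp
    ring
  have h1 : (slicePoint ι q : ℍ).re = q.re := hpRe_slicePoint hι q
  have h2 : ‖(slicePoint ι q : ℍ).im‖ = ‖q.im‖ := hpIm_slicePoint hι q
  rw [h, h q, h1, h2]

/-- The quadratic polynomial whose zero set is the sphere of `q`. -/
def sphPoly (q z : ℍ) : ℍ := z * z - ((2 * q.re : ℝ) : ℍ) * z + ((‖q‖ ^ 2 : ℝ) : ℍ)

theorem continuous_sphPoly (q : ℍ) :
    Continuous fun z : sliceHalfPlane ι => sphPoly q z := by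
  unfold sphPoly
  fun_prop

/-- The point w of the half-plane on the sphere of q satisfies w + w̄ = 2Re(q) and ww̄ = |q|², and z
commutes with w and w̄. -/
theorem sphPoly_eq (hι : ι ∈ imUnits) (q : ℍ) (z : sliceHalfPlane ι) :
    sphPoly q z = (z - slicePoint ι q) * (z - star (slicePoint ι q : ℍ)) := by
  set w := slicePoint ι q with hw
  have h1 : Commute (z : ℍ) (w : ℍ) := commute_coe_coe hι z w
  have h2 : ((2 * q.re : ℝ) : ℍ) = w + star (w : ℍ) := by
    rw [coe_add_star, ← hpRe_slicePoint hι q]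
    rfl
  have h3 : Commute (star (w : ℍ)) (z : ℍ) := by
    have : star (w : ℍ) = ((2 * q.re : ℝ) : ℍ) - w := by rw [h2]; abel
    rw [this]
    exact (show Commute ((2 * q.re : ℝ) : ℍ) (z : ℍ) from Quaternion.coe_commutes _ _).sub_left
      h1.symm
  have h4 : ((‖q‖ ^ 2 : ℝ) : ℍ) = w * star (w : ℍ) := by
    rw [Quaternion.self_mul_star, Quaternion.normSq_eq_norm_mul_self, ← sq, hw, norm_slicePoint hι]
  rw [sphPoly, h2, h4, add_mul, sub_mul, mul_sub, mul_sub, h3.eq]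
  abel

theorem sphPoly_eq_zero_iff (hι : ι ∈ imUnits) (q : ℍ) (z : sliceHalfPlane ι) :
    sphPoly q z = 0 ↔ z = slicePoint ι q := by
  rw [sphPoly_eq hι, mul_eq_zero]
  constructor
  · rintro (h | h)
    · exact Subtype.ext (sub_eq_zero.1 h)
    · have h1 := sub_eq_zero.1 h
      refine hp_ext hι ?_ ?_
      · rw [hpRe, h1, Quaternion.re_star]; rfl
      · rw [hpIm, h1, Quaternion.im_star, norm_neg]; rfl
  · rintro rfl
    exact Or.inl (sub_self _)

/-- Quaternions on the same sphere are conjugate. -/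
theorem exists_conj_slicePoint (hι : ι ∈ imUnits) (q : ℍ) :
    ∃ p : ℍ, ‖p‖ = 1 ∧ (slicePoint ι q : ℍ) * p = p * q := by
  suffices h : ∃ p : ℍ, p ≠ 0 ∧ (slicePoint ι q : ℍ) * p = p * q by
    obtain ⟨p, hp, h⟩ := h
    refine ⟨((‖p‖⁻¹ : ℝ) : ℍ) * p, ?_, ?_⟩
    · rw [norm_mul, Quaternion.norm_coe, norm_inv, norm_norm,
        inv_mul_cancel₀ (norm_ne_zero_iff.2 hp)]
    · rw [← mul_assoc, ← Quaternion.coe_commutes, mul_assoc, h, mul_assoc]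
  set n := ‖q.im‖ with hn
  have hq0 : (slicePoint ι q : ℍ) = (q.re : ℍ) + ι * (n : ℍ) := by
    rw [coe_eq_hpRe_add hι, hpRe_slicePoint hι, hpIm_slicePoint hι]
  have hred : ∀ p : ℍ, ι * (n : ℍ) * p = p * q.im → (slicePoint ι q : ℍ) * p = p * q := by
    intro p hp
    conv_rhs => rw [← Quaternion.re_add_im q]
    rw [hq0, add_mul, mul_add, hp, Quaternion.coe_commutes]
  have haa : ι * (n : ℍ) * (ι * (n : ℍ)) = ((-(n * n) : ℝ) : ℍ) := by
    rw [mul_assoc, Quaternion.coe_commutes, ← mul_assoc, ← mul_assoc, show ι * ι = -1 from hι,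
      mul_assoc, ← Quaternion.coe_mul, Quaternion.coe_neg, neg_one_mul]
  -- For a = ιn and b = Im q, both of square -n², the element p = ab - n² satisfies ap = pb. It
  -- vanishes only if n = 0, where p = 1 works, or if b = -a, where a unit anticommuting with ι
  -- works.
  by_cases hp0 : ι * (n : ℍ) * q.im - ((n * n : ℝ) : ℍ) = 0
  · by_cases hn0 : n = 0
    · refine ⟨1, one_ne_zero, hred _ ?_⟩
      rw [norm_eq_zero.1 (hn.symm.trans hn0), hn0]
      simp
    · obtain ⟨j, hj, hιj⟩ := exists_anticommuting hι
      refine ⟨j, fun h => ?_, hred _ ?_⟩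
      · have := norm_of_mem_imUnits hj
        rw [h, norm_zero] at this
        exact zero_ne_one this
      · have h1 : q.im = -(ι * (n : ℍ)) := by
          have h2 := congrArg (fun x => ι * (n : ℍ) * x) (sub_eq_zero.1 hp0)
          rw [← mul_assoc, haa, ← Quaternion.coe_commutes, Quaternion.coe_neg, neg_mul] at h2
          have h3 : ((n * n : ℝ) : ℍ) ≠ 0 := by
            rw [← Quaternion.coe_zero]
            exact fun h => mul_ne_zero hn0 hn0 (Quaternion.coe_injective h)
          have h4 : ((n * n : ℝ) : ℍ) * q.im = ((n * n : ℝ) : ℍ) * -(ι * (n : ℍ)) := by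
            rw [mul_neg, ← h2, neg_neg]
          exact mul_left_cancel₀ h3 h4
        rw [h1, mul_neg, ← mul_assoc, mul_assoc ι, Quaternion.coe_commutes, ← mul_assoc, hιj,
          neg_mul]
  · refine ⟨_, hp0, hred _ ?_⟩
    rw [mul_sub, sub_mul, ← mul_assoc, haa, mul_assoc _ q.im, im_mul_im, ← hn,
      ← Quaternion.coe_commutes (n * n), ← Quaternion.coe_commutes (-(n * n)), Quaternion.coe_neg,
      neg_mul, neg_mul]
    abel

end Sphere

/-! ### The spherical spectrum -/

section Spectrum

variable {ι : ℍ} {H : Type*} [NormedAddCommGroup H] [Module ℍᵐᵒᵖ H] [QuaternionicInner H]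
  {P : QPVM ι H} {L : ℍ → H →L[ℍᵐᵒᵖ] H} {T S : H →L[ℍᵐᵒᵖ] H}

attribute [local instance] complexInnerSpace InnerProductSpace.complexToReal

namespace QPVM

variable {E : Set (sliceHalfPlane ι)}

theorem map_compl_apply_eq_zero_iff (hE : MeasurableSet E) (u : H) :
    P Eᶜ u = 0 ↔ P E u = u := by
  rw [P.map_compl hE, sub_apply, one_apply_eq_self, sub_eq_zero, eq_comm]

theorem mem_range_iff (hE : MeasurableSet E) (u : H) : u ∈ Set.range (P E) ↔ P E u = u :=
  ⟨fun ⟨v, hv⟩ => by rw [← hv, P.map_idem hE], fun h => ⟨u, h⟩⟩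

theorem mem_supp_iff {z : sliceHalfPlane ι} :
    z ∈ P.supp ↔ ∀ U : Set (sliceHalfPlane ι), IsOpen U → z ∈ U → P U ≠ 0 :=
  ⟨fun h U hU hz h0 => h ⟨U, ⟨hU, h0⟩, hz⟩, fun h ⟨U, ⟨hU, h0⟩, hz⟩ => h U hU hz h0⟩

variable [CompleteSpace H]

theorem ae_mem (hE : MeasurableSet E) {u : H} (hu : P E u = u) : ∀ᵐ x ∂P.measure u, x ∈ E := by
  rw [ae_iff]
  exact (P.measure_eq_zero_iff hE.compl u).2 ((map_compl_apply_eq_zero_iff hE u).2 hu)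

theorem range_compl (hE : MeasurableSet E) : Set.range (P Eᶜ) = qperp (Set.range (P E)) := by
  ext u
  rw [mem_range_iff hE.compl, ← map_compl_apply_eq_zero_iff hE.compl, compl_compl]
  constructor
  · rintro h _ ⟨v, rfl⟩
    rw [← P.symm hE, h, qinner_zero_left]
  · intro h
    have h1 := h _ ⟨u, rfl⟩
    rw [P.qinner_apply_self hE, ← Quaternion.coe_zero] at h1
    exact norm_eq_zero.1 (pow_eq_zero_iff two_ne_zero |>.1 (Quaternion.coe_injective h1))

end QPVM

namespace IsSliceIntegral

variable {ψ : sliceHalfPlane ι → ℍ}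

theorem isCompact_supp (hι : ι ∈ imUnits) (hT : IsSliceIntegral P L (fun z => (z : ℍ)) T) :
    IsCompact P.supp := by
  obtain ⟨C, hC⟩ := hT.exists_bound
  exact (isCompact_setOf_norm_le hι C).of_isClosed_subset P.isClosed_supp hC

/-- `Δ_q(T)` as the integral of the polynomial `sphPoly q`. -/
theorem exists_sphDelta (h : IsIQPVM P L) (hT : IsSliceIntegral P L (fun z => (z : ℍ)) T) (q : ℍ) :
    ∃ D : H →L[ℍᵐᵒᵖ] H, IsSliceIntegral P L (fun z => sphPoly q z) D ∧
      ∀ u, sphDelta T q u = D u := by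
  refine ⟨_, ((hT.mul h hT).sub h ((const P L ((2 * q.re : ℝ) : ℍ)).mul h hT)).add h
    (const P L ((‖q‖ ^ 2 : ℝ) : ℍ)), fun u => ?_⟩
  rw [add_apply, sub_apply, mul_apply_eq_comp, mul_apply_eq_comp, h.leftMul.map_coe,
    h.leftMul.map_coe, real_smul_def, real_smul_def, sphDelta]

variable [CompleteSpace H]

theorem integrable_norm_sq (hS : IsSliceIntegral P L ψ S) (hψ : Measurable ψ) (u : H) :
    Integrable (fun x => ‖ψ x‖ ^ 2) (P.measure u) := by
  obtain ⟨C, hC⟩ := hS.exists_bound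
  refine Integrable.of_bound (hψ.norm.pow_const 2).aestronglyMeasurable (C ^ 2) ?_
  filter_upwards [P.ae_mem_supp u] with x hx
  rw [Real.norm_eq_abs, abs_of_nonneg (sq_nonneg _)]
  exact pow_le_pow_left₀ (norm_nonneg _) (hC x hx) 2

/-- ∫|ψ|² dμ_u vanishes exactly when μ_u is carried by the zero set of ψ. -/
theorem apply_eq_zero_iff (h : IsIQPVM P L) (hS : IsSliceIntegral P L ψ S) (hψ : Measurable ψ)
    (u : H) : S u = 0 ↔ P {x | ψ x = 0} u = u := by
  have hE : MeasurableSet {x | ψ x = 0} := hψ (measurableSet_singleton 0)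
  rw [← QPVM.map_compl_apply_eq_zero_iff hE, ← P.measure_eq_zero_iff hE.compl, ← norm_eq_zero,
    ← pow_eq_zero_iff two_ne_zero, hS.norm_sq_eq h hψ,
    integral_eq_zero_iff_of_nonneg (fun x => sq_nonneg _) (hS.integrable_norm_sq hψ u)]
  rw [EventuallyEq, ae_iff]
  simp only [Pi.zero_apply, pow_eq_zero_iff two_ne_zero, norm_eq_zero]
  rfl

theorem norm_apply_le (h : IsIQPVM P L) (hS : IsSliceIntegral P L ψ S) (hψ : Measurable ψ)
    {E : Set (sliceHalfPlane ι)} (hE : MeasurableSet E) {c : ℝ} (hc : 0 ≤ c)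
    (hψE : ∀ x ∈ E, ‖ψ x‖ ≤ c) {u : H} (hu : P E u = u) : ‖S u‖ ≤ c * ‖u‖ := by
  refine (sq_le_sq₀ (norm_nonneg _) (by positivity)).1 ?_
  rw [hS.norm_sq_eq h hψ, mul_pow, ← P.measureReal_univ, mul_comm, ← smul_eq_mul,
    ← integral_const]
  refine integral_mono_ae (hS.integrable_norm_sq hψ u) (integrable_const _) ?_
  filter_upwards [QPVM.ae_mem hE hu] with x hx
  exact pow_le_pow_left₀ (norm_nonneg _) (hψE x hx) 2

theorem le_norm_apply (h : IsIQPVM P L) (hS : IsSliceIntegral P L ψ S) (hψ : Measurable ψ)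
    {c : ℝ} (hc : 0 ≤ c) (hψE : ∀ x ∈ P.supp, c ≤ ‖ψ x‖) (u : H) : c * ‖u‖ ≤ ‖S u‖ := by
  refine (sq_le_sq₀ (by positivity) (norm_nonneg _)).1 ?_
  rw [hS.norm_sq_eq h hψ, mul_pow, ← P.measureReal_univ, mul_comm, ← smul_eq_mul,
    ← integral_const]
  refine integral_mono_ae (integrable_const _) (hS.integrable_norm_sq hψ u) ?_
  filter_upwards [P.ae_mem_supp u] with x hx
  exact pow_le_pow_left₀ hc (hψE x hx) 2

theorem norm_qadjoint_apply (h : IsIQPVM P L) (hS : IsSliceIntegral P L ψ S) (hψ : Measurable ψ)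
    (u : H) : ‖_root_.qadjoint S u‖ = ‖S u‖ := by
  refine (pow_left_inj₀ (norm_nonneg _) (norm_nonneg _) two_ne_zero).1 ?_
  rw [hS.norm_sq_eq h hψ, (hS.qadjoint h).norm_sq_eq h (continuous_star.measurable.comp hψ)]
  simp only [norm_star]

/-- The orthogonal complement of the range is Ker S*, which equals Ker S because ‖S*u‖ = ‖Su‖. This
is what empties the residual spectrum. -/
theorem closure_range_eq_univ (h : IsIQPVM P L) (hS : IsSliceIntegral P L ψ S)
    (hψ : Measurable ψ) (hinj : ∀ u, S u = 0 → u = 0) : closure (Set.range S) = Set.univ := by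
  have h1 : (toRealOp S).range.topologicalClosure = ⊤ := by
    rw [Submodule.topologicalClosure_eq_top_iff, Submodule.eq_bot_iff]
    intro v hv
    refine hinj v ?_
    rw [← norm_eq_zero, ← hS.norm_qadjoint_apply h hψ, norm_eq_zero, ← inner_self_eq_zero (𝕜 := ℝ),
      real_inner_def, qinner_qadjoint, ← star_qinner, Quaternion.re_star]
    exact (Submodule.mem_orthogonal _ _).1 hv _ ⟨_root_.qadjoint S v, rfl⟩
  have h2 := congrArg (fun V : Submodule ℝ H => (V : Set H)) h1
  exact h2

theorem sphDelta_eq_zero_iff (h : IsIQPVM P L) (hι : ι ∈ imUnits)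
    (hT : IsSliceIntegral P L (fun z => (z : ℍ)) T) (q : ℍ) (u : H) :
    sphDelta T q u = 0 ↔ P {slicePoint ι q} u = u := by
  obtain ⟨D, hD, hDu⟩ := hT.exists_sphDelta h q
  rw [hDu, hD.apply_eq_zero_iff h (continuous_sphPoly q).measurable]
  simp only [sphPoly_eq_zero_iff hι]
  rfl

theorem ker_sphDelta_eq_iff (h : IsIQPVM P L) (hι : ι ∈ imUnits)
    (hT : IsSliceIntegral P L (fun z => (z : ℍ)) T) (q : ℍ) :
    {u | sphDelta T q u = 0} = {0} ↔ P {slicePoint ι q} = 0 := by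
  constructor
  · intro h1
    ext u
    have h2 : P {slicePoint ι q} u ∈ {u | sphDelta T q u = 0} :=
      (hT.sphDelta_eq_zero_iff h hι q _).2 (P.map_idem (measurableSet_singleton _) u)
    rw [h1] at h2
    exact h2
  · intro h1
    ext u
    rw [Set.mem_ofPred_eq, hT.sphDelta_eq_zero_iff h hι, h1, zero_apply, Set.mem_singleton_iff,
      eq_comm]

theorem closure_range_sphDelta (h : IsIQPVM P L)
    (hT : IsSliceIntegral P L (fun z => (z : ℍ)) T) {q : ℍ}
    (hq : {u | sphDelta T q u = 0} = {0}) : closure (Set.range (sphDelta T q)) = Set.univ := by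
  obtain ⟨D, hD, hDu⟩ := hT.exists_sphDelta h q
  rw [show sphDelta T q = D from funext hDu]
  refine hD.closure_range_eq_univ h (continuous_sphPoly q).measurable fun u hu => ?_
  have h1 : u ∈ {u | sphDelta T q u = 0} := (hDu u).trans hu
  rw [hq] at h1
  exact h1

/-- Near a support point the polynomial is small while P is nonzero, which produces vectors that
Δ_q(T) nearly annihilates. Off the support the polynomial is bounded below, the support being
compact. -/
theorem sphInvBounded_iff (h : IsIQPVM P L) (hι : ι ∈ imUnits)
    (hT : IsSliceIntegral P L (fun z => (z : ℍ)) T) (q : ℍ) :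
    sphInvBounded T q ↔ slicePoint ι q ∉ P.supp := by
  obtain ⟨D, hD, hDu⟩ := hT.exists_sphDelta h q
  have hc := continuous_sphPoly (ι := ι) q
  constructor
  · rintro ⟨C, hC⟩ hmem
    -- Chosen so that |C|ε = 1 - ε; then ‖u‖ ≤ |C|ε‖u‖ forces u = 0.
    set ε := 1 / (|C| + 1) with hε
    have hε0 : 0 < ε := by positivity
    have hU : IsOpen {z : sliceHalfPlane ι | ‖sphPoly q z‖ < ε} :=
      isOpen_lt hc.norm continuous_const
    refine QPVM.mem_supp_iff.1 hmem _ hU ?_ ?_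
    · rw [Set.mem_ofPred_eq, (sphPoly_eq_zero_iff hι q _).2 rfl, norm_zero]
      exact hε0
    · ext v
      set u := P {z : sliceHalfPlane ι | ‖sphPoly q z‖ < ε} v with hu
      have h1 : ‖D u‖ ≤ ε * ‖u‖ := hD.norm_apply_le h hc.measurable hU.measurableSet hε0.le
        (fun x hx => le_of_lt hx) (P.map_idem hU.measurableSet v)
      have h2 := hC u
      rw [hDu] at h2
      have h3 : C * ‖D u‖ ≤ |C| * (ε * ‖u‖) :=
        (mul_le_mul_of_nonneg_right (le_abs_self C) (norm_nonneg _)).trans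
          (mul_le_mul_of_nonneg_left h1 (abs_nonneg C))
      have h4 : ε * (|C| + 1) = 1 := by rw [hε]; field_simp
      have h5 : ‖u‖ ≤ 0 := by
        have h6 : ε * ‖u‖ ≤ 0 := by nlinarith
        by_contra hcon
        push Not at hcon
        exact absurd h6 (not_le.2 (mul_pos hε0 hcon))
      exact norm_le_zero_iff.1 h5
  · intro hmem
    obtain ⟨c, hc0, hcK⟩ := (hT.isCompact_supp hι).exists_forall_le' (a := 0)
      hc.norm.continuousOn fun z hz => norm_pos_iff.2 fun h0 =>
        hmem ((sphPoly_eq_zero_iff hι q z).1 h0 ▸ hz)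
    refine ⟨c⁻¹, fun u => ?_⟩
    have h1 := hD.le_norm_apply h hc.measurable hc0.le hcK u
    rw [hDu, inv_mul_eq_div, le_div_iff₀ hc0, mul_comm]
    exact h1

/-- A bounded inverse already implies injectivity, and injectivity implies dense range, so it alone
decides membership in the resolvent set. -/
theorem mem_sphSpectrum_iff (h : IsIQPVM P L) (hι : ι ∈ imUnits)
    (hT : IsSliceIntegral P L (fun z => (z : ℍ)) T) (q : ℍ) :
    q ∈ sphSpectrum T ↔ slicePoint ι q ∈ P.supp := by
  rw [sphSpectrum, Set.mem_compl_iff, sphResolvent, Set.mem_ofPred_eq, not_iff_comm,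
    ← hT.sphInvBounded_iff h hι]
  constructor
  · intro hb
    have h0 : {u | sphDelta T q u = 0} = {0} := by
      obtain ⟨C, hC⟩ := hb
      ext u
      refine ⟨fun hu => ?_, fun hu => ?_⟩
      · have := hC u
        rw [show sphDelta T q u = 0 from hu, norm_zero, mul_zero] at this
        exact norm_le_zero_iff.1 this
      · rw [Set.mem_singleton_iff.1 hu]
        simp [sphDelta]
    exact ⟨h0, dense_iff_closure_eq.2 (hT.closure_range_sphDelta h h0), hb⟩
  · exact fun hb => hb.2.2

theorem mem_sphContinuousSpectrum_iff (h : IsIQPVM P L) (hι : ι ∈ imUnits)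
    (hT : IsSliceIntegral P L (fun z => (z : ℍ)) T) (q : ℍ) :
    q ∈ sphContinuousSpectrum T ↔ P {slicePoint ι q} = 0 ∧ slicePoint ι q ∈ P.supp := by
  rw [sphContinuousSpectrum, Set.mem_ofPred_eq, hT.sphInvBounded_iff h hι, not_not,
    ← hT.ker_sphDelta_eq_iff h hι]
  exact ⟨fun hq => ⟨hq.1, hq.2.2⟩, fun hq => ⟨hq.1, hT.closure_range_sphDelta h hq.1, hq.2⟩⟩

theorem sphResidualSpectrum_eq_empty (h : IsIQPVM P L)
    (hT : IsSliceIntegral P L (fun z => (z : ℍ)) T) : sphResidualSpectrum T = ∅ :=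
  Set.eq_empty_of_forall_notMem fun _ hq => hq.2 (hT.closure_range_sphDelta h hq.1)

theorem image_supp_eq (h : IsIQPVM P L) (hι : ι ∈ imUnits)
    (hT : IsSliceIntegral P L (fun z => (z : ℍ)) T) :
    Subtype.val '' P.supp = sphSpectrum T ∩ sliceHalfPlane ι := by
  ext q
  constructor
  · rintro ⟨z, hz, rfl⟩
    exact ⟨(hT.mem_sphSpectrum_iff h hι _).2 ((slicePoint_coe hι z).symm ▸ hz), z.2⟩
  · rintro ⟨hq, hqι⟩
    have h1 := (hT.mem_sphSpectrum_iff h hι q).1 hq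
    rw [slicePoint_coe hι ⟨q, hqι⟩] at h1
    exact ⟨_, h1, rfl⟩

/-- Isolated points of the support are atoms. -/
theorem map_singleton_ne_zero_of_isolated (h : IsIQPVM P L) (hι : ι ∈ imUnits)
    (hT : IsSliceIntegral P L (fun z => (z : ℍ)) T) {z : sliceHalfPlane ι}
    {U : Set (sliceHalfPlane ι)} (hU : IsOpen U)
    (hUz : U ∩ {w : sliceHalfPlane ι | (w : ℍ) ∈ sphSpectrum T} = {z}) : P {z} ≠ 0 := by
  have h1 : {w : sliceHalfPlane ι | (w : ℍ) ∈ sphSpectrum T} = P.supp := by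
    ext w
    rw [Set.mem_ofPred_eq, hT.mem_sphSpectrum_iff h hι, slicePoint_coe hι]
  have hz : z ∈ U ∩ {w : sliceHalfPlane ι | (w : ℍ) ∈ sphSpectrum T} := hUz ▸ Set.mem_singleton z
  rw [h1] at hUz hz
  rw [← hUz, P.map_inter_supp hU.measurableSet]
  exact QPVM.mem_supp_iff.1 hz.2 U hU hz.1

/-- T - T* is the integral of z - z̄, whose zero set is the real axis. -/
theorem range_map_real (h : IsIQPVM P L) (hT : IsSliceIntegral P L (fun z => (z : ℍ)) T) :
    MeasurableSet {z : sliceHalfPlane ι | ∃ r : ℝ, (z : ℍ) = (r : ℍ)} ∧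
    Set.range (P {z : sliceHalfPlane ι | ∃ r : ℝ, (z : ℍ) = (r : ℍ)}) =
      opKer (T - _root_.qadjoint T) := by
  have hψ : Measurable fun z : sliceHalfPlane ι => (z : ℍ) - star (z : ℍ) :=
    (continuous_subtype_val.sub (continuous_star.comp continuous_subtype_val)).measurable
  have hE : {z : sliceHalfPlane ι | ∃ r : ℝ, (z : ℍ) = (r : ℍ)} =
      {z : sliceHalfPlane ι | (z : ℍ) - star (z : ℍ) = 0} := by
    ext z
    rw [Set.mem_ofPred_eq, Set.mem_ofPred_eq, sub_eq_zero]
    constructor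
    · rintro ⟨r, hr⟩
      rw [hr, Quaternion.star_coe]
    · exact fun hz => ⟨_, quaternion_coe_re hz.symm⟩
  have hm : MeasurableSet {z : sliceHalfPlane ι | (z : ℍ) - star (z : ℍ) = 0} :=
    hψ (measurableSet_singleton 0)
  rw [hE]
  refine ⟨hm, Set.ext fun u => ?_⟩
  rw [QPVM.mem_range_iff hm, ← (hT.sub h (hT.qadjoint h)).apply_eq_zero_iff h hψ]
  rfl

/-- Points of the support are approximate right eigenvalues. -/
theorem exists_approx_eigenvector (h : IsIQPVM P L) (hι : ι ∈ imUnits)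
    (hT : IsSliceIntegral P L (fun z => (z : ℍ)) T) {q : ℍ} (hq : slicePoint ι q ∈ P.supp)
    {ε : ℝ} (hε : 0 < ε) : ∃ u : H, ‖u‖ = 1 ∧ ‖T u - op q • u‖ < ε := by
  set w := slicePoint ι q with hw
  set E := {z : sliceHalfPlane ι | ‖(z : ℍ) - w‖ < ε / 2} with hE
  have hcont : Continuous fun z : sliceHalfPlane ι => (z : ℍ) - w :=
    continuous_subtype_val.sub continuous_const
  have hEo : IsOpen E := isOpen_lt hcont.norm continuous_const
  have hPE : P E ≠ 0 := QPVM.mem_supp_iff.1 hq E hEo (by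
    rw [hE, Set.mem_ofPred_eq, sub_self, norm_zero]; positivity)
  -- L_w acts on a basis vector x as right multiplication by w. As P(E) commutes with L_w, the same
  -- holds for v = P(E)x.
  obtain ⟨N, hN, -, hLN⟩ := h.leftMul.exists_basis
  obtain ⟨x, hx, hPx⟩ : ∃ x ∈ N, P E x ≠ 0 := by
    by_contra hcon
    push Not at hcon
    exact hPE (hN.op_ext fun z hz => (hcon z hz).trans rfl)
  set v := P E x with hv
  have hLv : L w v = op (w : ℍ) • v := by
    have := DFunLike.congr_fun (h.commute E hEo.measurableSet w) x
    rw [mul_apply_eq_comp, mul_apply_eq_comp, hLN x hx, map_smul] at this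
    exact this.symm
  have h1 : ‖T v - op (w : ℍ) • v‖ ≤ ε / 2 * ‖v‖ := by
    have := (hT.sub h (const P L (w : ℍ))).norm_apply_le h hcont.measurable hEo.measurableSet
      (by positivity : 0 ≤ ε / 2) (fun z hz => le_of_lt hz) (P.map_idem hEo.measurableSet x)
    rw [sub_apply, ← hv, hLv] at this
    exact this
  -- Since wp = pq with |p| = 1, passing from v to vp replaces the approximate right eigenvalue w by
  -- q.
  obtain ⟨p, hp, hpq⟩ := exists_conj_slicePoint hι q
  have hv0 : ‖v‖ ≠ 0 := norm_ne_zero_iff.2 hPx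
  refine ⟨(‖v‖⁻¹ : ℝ) • op p • v, ?_, ?_⟩
  · rw [norm_smul, norm_op_smul, hp, one_mul, norm_inv, norm_norm, inv_mul_cancel₀ hv0]
  · have h2 : T ((‖v‖⁻¹ : ℝ) • op p • v) - op q • (‖v‖⁻¹ : ℝ) • op p • v =
        (‖v‖⁻¹ : ℝ) • op p • (T v - op (w : ℍ) • v) := by
      rw [qop_map_real_smul, map_smul, ← real_smul_op_smul, smul_sub, smul_sub, smul_smul (op q),
        smul_smul (op p), ← op_mul, ← op_mul, hpq]
    rw [h2, norm_smul, norm_op_smul, hp, one_mul, norm_inv, norm_norm]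
    calc ‖v‖⁻¹ * ‖T v - op (w : ℍ) • v‖ ≤ ‖v‖⁻¹ * (ε / 2 * ‖v‖) := by gcongr
      _ = ε / 2 := by field_simp
      _ < ε := by linarith

end IsSliceIntegral

end Spectrum

end

/-! ### The spectral theorem -/

theorem theoremA {H : Type*} [NormedAddCommGroup H] [Module ℍᵐᵒᵖ H] [QuaternionicInner H]
    [CompleteSpace H] [Nontrivial H] (ι : ℍ) (hι : ι ∈ imUnits)
    (T : H →L[ℍᵐᵒᵖ] H) (hT : IsNormalOp T) :
    ∃ (P : QPVM ι H) (L : ℍ → H →L[ℍᵐᵒᵖ] H),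
      -- existence of a bounded iqPVM representing `T`
      IsIQPVM P L ∧ Bornology.IsBounded P.supp ∧ HasIQIntegral P L (fun z => (z : ℍ)) T ∧
      -- uniqueness, and properties of every representing iqPVM
      (∀ (P' : QPVM ι H) (L' : ℍ → H →L[ℍᵐᵒᵖ] H), IsIQPVM P' L' →
        HasIQIntegral P' L' (fun z => (z : ℍ)) T →
          (∀ E, MeasurableSet E → P' E = P E) ∧
          (∀ q ∈ slicePlane ι, ∀ u ∈ qperp (opKer (T - qadjoint T)), L' q u = L q u) ∧
          (L' ι * T = T * L' ι ∧ L' ι * qadjoint T = qadjoint T * L' ι) ∧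
          (∀ j ∈ imUnits, ι * j = -(j * ι) → L' j * T = qadjoint T * L' j) ∧
          IsAbsOp (T - qadjoint T) (-(L' ι * (T - qadjoint T))) ∧
          -- on `ℂ⁺_ι` the coordinate `β` of `α + ι β` is the norm of the imaginary part
          HasIQIntegral P' L' (fun z => ((2 * ‖(z : ℍ).im‖ : ℝ) : ℍ))
            (-(L' ι * (T - qadjoint T)))) ∧
      -- characterisation of the admissible left scalar multiplications
      (∀ L' : ℍ → H →L[ℍᵐᵒᵖ] H, IsLeftScalarMul L' →
        ((IsIQPVM P L' ∧ HasIQIntegral P L' (fun z => (z : ℍ)) T) ↔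
          (L' ι * T = T * L' ι ∧
            (∃ j ∈ imUnits, ι * j = -(j * ι) ∧ L' j * T = qadjoint T * L' j) ∧
            IsPositiveOp (-(L' ι * (T - qadjoint T)))))) ∧
      -- support
      Subtype.val '' P.supp = sphSpectrum T ∩ sliceHalfPlane ι ∧
      -- kernel of `T - T*`
      Set.range (P {z : sliceHalfPlane ι | ∃ r : ℝ, (z : ℍ) = (r : ℍ)}) =
        opKer (T - qadjoint T) ∧
      Set.range (P {z : sliceHalfPlane ι | ∃ r : ℝ, (z : ℍ) = (r : ℍ)}ᶜ) =
        qperp (opKer (T - qadjoint T)) ∧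
      -- spherical point spectrum
      (∀ q : ℍ, q ∈ sphPointSpectrum T ↔ P {z : sliceHalfPlane ι | (z : ℍ) ∈ qSphere q} ≠ 0) ∧
      (∀ z : sliceHalfPlane ι, (z : ℍ) ∈ sphPointSpectrum T ↔ P {z} ≠ 0) ∧
      (∀ z : sliceHalfPlane ι,
        (∃ U : Set (sliceHalfPlane ι), IsOpen U ∧
          U ∩ {w : sliceHalfPlane ι | (w : ℍ) ∈ sphSpectrum T} = {z}) →
          (z : ℍ) ∈ sphPointSpectrum T) ∧
      -- residual spherical spectrum
      sphResidualSpectrum T = ∅ ∧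
      -- continuous spherical spectrum
      (∀ q : ℍ, q ∈ sphContinuousSpectrum T ↔
        P {z : sliceHalfPlane ι | (z : ℍ) ∈ qSphere q} = 0 ∧
          ∀ U : Set (sliceHalfPlane ι), IsOpen U →
            {z : sliceHalfPlane ι | (z : ℍ) ∈ qSphere q} ⊆ U → P U ≠ 0) ∧
      (∀ z : sliceHalfPlane ι, (z : ℍ) ∈ sphContinuousSpectrum T ↔
        P {z} = 0 ∧ ∀ U : Set (sliceHalfPlane ι), IsOpen U → z ∈ U → P U ≠ 0) ∧
      (∀ q ∈ sphContinuousSpectrum T, ∀ ε : ℝ, 0 < ε →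
        ∃ u : H, ‖u‖ = 1 ∧ ‖T u - op q • u‖ < ε) := by
  obtain ⟨Φ⟩ := exists_sliceCalculus hι hT
  obtain ⟨L, h, hLT⟩ := Φ.exists_adapted_leftMul hι hT
  have hid := Φ.isSliceIntegral_id hι h hLT
  have hLι : ∀ {P' : QPVM ι H} {L' : ℍ → H →L[ℍᵐᵒᵖ] H}, IsIQPVM P' L' →
      IsSliceIntegral P' L' (fun z => (z : ℍ)) T →
      Φ.qop hι (twoIm ι) = -(L' ι * (T - qadjoint T)) := fun h' hT' =>
    Φ.qop_twoIm_eq hι hT h'.leftMul (hT'.leftMul_comm h' hι) (hT'.isPositiveOp h' hι)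
  obtain ⟨hRm, hR⟩ := hid.range_map_real h
  have hpoint : ∀ q : ℍ, q ∈ sphPointSpectrum T ↔ Φ.qpvm hι {slicePoint ι q} ≠ 0 := fun q =>
    (hid.ker_sphDelta_eq_iff h hι q).not
  have hcont := hid.mem_sphContinuousSpectrum_iff h hι
  refine ⟨Φ.qpvm hι, L, h, ?_, hid.hasIQIntegral h measurable_coe_hp, ?_, ?_,
    hid.image_supp_eq h hι, hR, ?_, ?_, ?_, ?_, hid.sphResidualSpectrum_eq_empty h, ?_, ?_, ?_⟩
  · exact (hid.isCompact_supp hι).isBounded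
  · intro P' L' h' hT'
    have hT' := hT'.isSliceIntegral
    refine ⟨fun E hE => ?_, fun q hq u hu => ?_, ⟨hT'.leftMul_comm h' hι,
      hT'.leftMul_comm_qadjoint h' hι⟩, fun j _ hj => hT'.leftMul_anticomm h' hι hj,
      hT'.isAbsOp h' hι, ?_⟩
    · exact QPVM.ext_of_measure (fun u => (hT'.measure_eq h' hι Φ u).trans
        (hid.measure_eq h hι Φ u).symm) hE
    · refine IsSliceIntegral.leftMul_eq_on_qperp h.leftMul h'.leftMul hι ?_ hq hu
      exact neg_injective ((hLι h hid).symm.trans (hLι h' hT'))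
    · exact (hT'.neg_leftMul_mul h' hι).hasIQIntegral h'
        (Quaternion.continuous_coe.measurable.comp measurable_twoIm)
  · intro L' hL'
    constructor
    · rintro ⟨h', hT'⟩
      have hT' := hT'.isSliceIntegral
      obtain ⟨j, hj, hιj⟩ := exists_anticommuting hι
      exact ⟨hT'.leftMul_comm h' hι, ⟨j, hj, hιj, hT'.leftMul_anticomm h' hι hιj⟩,
        hT'.isPositiveOp h' hι⟩
    · rintro ⟨hιT, ⟨j, hj, hιj, hjT⟩, hpos⟩
      obtain ⟨h', hT'⟩ := Φ.isSliceIntegral_of_comm hι hT hL' hιT hj hιj hjT hpos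
      exact ⟨h', hT'.hasIQIntegral h' measurable_coe_hp⟩
  · rw [QPVM.range_compl hRm, hR]
  · intro q
    rw [hpoint, setOf_mem_qSphere hι]
  · intro z
    rw [hpoint, slicePoint_coe hι]
  · rintro z ⟨U, hU, hUz⟩
    rw [hpoint, slicePoint_coe hι]
    exact hid.map_singleton_ne_zero_of_isolated h hι hU hUz
  · intro q
    rw [hcont, setOf_mem_qSphere hι, QPVM.mem_supp_iff]
    simp only [Set.singleton_subset_iff]
  · intro z
    rw [hcont, slicePoint_coe hι, QPVM.mem_supp_iff]
  · intro q hq ε hε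
    exact hid.exists_approx_eigenvector h hι ((hcont q).1 hq).2 hε
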